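/- All graphs are finite and simple. For a graph $G$, $\delta(G)$ is its minimum degree, and $\sigma_2(G)=\min\{d_G(u)+d_G(v)\mid u\neq v,\ uv\notin E(G)\}$ (with $\sigma_2(G)=+\infty$ if $G$ is complete). A graph is $2$-connected if it has at least $3$ vertices and remains connected after the deletion of any set of at most one vertex. A partition $\mathcal{P}$ of $V(G)$ is a $2$-proper partition of $G$ if every part of $\mathcal{P}$ induces a $2$-connected subgraph of $G$. Write $[k]=\{1,\dots,k\}$. Define the following graphs. - $F_5$ has vertex set $\{a,b_1,b_2,b_3,b_4\}$ and edge set $\{ab_i\mid i\in[4]\}\cup\{b_1b_2,b_3b_4\}$. - $\mathcal{F}_{11}$ is the family of graphs with vertex set $\{a,b_1,b_2\}\cup\{c_i\mid i\in[8]\}$ and edge set $\{ac_i\mid i\in[8]\}\cup\{b_1c_i\mid i\in[4]\}\cup\{b_2c_i\mid i\in[8]\setminus[4]\}\cup\{c_1c_2,c_3c_4,c_5c_6,c_7c_8\}\cup L$, where $L\subseteq\{ab_1,ab_2\}$. - $\mathcal{F}_{12}$ is the family of graphs with vertex set $\{a,b_1,b_2\}\cup\{c_i\mid i\in[9]\}$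 and edge set $\{ac_i\mid i\in[8]\}\cup\{b_1c_i\mid i\in[4]\}\cup\{b_2c_i\mid i\in[8]\setminus[4]\}\cup\{c_1c_2,c_3c_4,c_5c_6,c_7c_9,c_8c_9\}\cup L$, where $L\subseteq\{ab_1,ab_2,ac_9,b_2c_9\}$ and $L\cap\{ac_9,b_2c_9\}\neq\emptyset$. - For $s\geq 2$, $H_{s,s}$ is obtained from two vertex-disjoint complete graphs $S_1$, $S_2$, each of order $s-1$, by adding four new vertices $a,b,c_1,c_2$ and the edges $\{ax,bx\mid x\in V(S_1)\cup V(S_2)\}\cup\{ab,ac_1,ac_2,c_1c_2\}$; and $H_{s,s}^-=H_{s,s}-ab$. For even $n\geq 6$, $\mathcal{H}_n^{=}=\{H_{s,s},H_{s,s}^-\mid 2s+2=n\}$. **Corollary.** Let $G$ be a non-complete graph of order $n$ with minimum degree $\delta\geq 1$. If $$\sigma_2(G)\geq\frac{n}{\delta}+\delta-1,$$ then either $G$ has a $2$-proper partition $\mathcal{P}$ with $|\mathcal{P}|\leq\dfrac{2(n-1)}{\sigma_2(G)}$, or $G$ is isomorphic to a graph in $\{F_5\}\cup\mathcal{F}_{11}\cup\mathcal{F}_{12}\cup\mathcal{H}_6^{=}\cup\mathcal{H}_8^{=}$.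 -/

import Mathlib

namespace ProperPartition

/-- `G` is `k`-connected: `|G| > k`, and `G - S` is connected for every set `S` of fewer than `k`
vertices. -/
def IsKConnected {V : Type*} (k : ℕ) (G : SimpleGraph V) : Prop :=
  (k : ℕ∞) < ENat.card V ∧
    ∀ S : Set V, S.encard < (k : ℕ∞) → (G.induce Sᶜ).Connected

/-- A partition `P` of the vertex set (into non-empty parts) is a `k`-proper partition of `G` if
every part induces a `k`-connected subgraph of `G`. -/
def IsProperPartition {V : Type*} [Fintype V] [DecidableEq V] (k : ℕ) (G : SimpleGraph V)
    (P : Finpartition (Finset.univ : Finset V)) : Prop :=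
  ∀ A ∈ P.parts, IsKConnected k (G.induce (A : Set V))

/-- The minimum degree sum `σ₂(G)` of two distinct non-adjacent vertices, with value `⊤` if `G` is
complete. -/
noncomputable def sigma2 {V : Type*} [Fintype V] (G : SimpleGraph V) [DecidableRel G.Adj] : ℕ∞ :=
  ⨅ (u : V) (v : V) (_ : u ≠ v) (_ : ¬ G.Adj u v), ((G.degree u + G.degree v : ℕ) : ℕ∞)

/-- `σ₂(G)` is infinite exactly when `G` is complete. -/
theorem sigma2_eq_top_iff {V : Type*} [Fintype V] (G : SimpleGraph V) [DecidableRel G.Adj] :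
    sigma2 G = ⊤ ↔ G = ⊤ := by
  constructor
  · intro h
    ext u v
    simp only [sigma2, iInf_eq_top, ENat.natCast_ne_top, SimpleGraph.top_adj] at h ⊢
    exact ⟨fun huv => huv.ne, fun huv => by_contra fun hn => h u v huv hn⟩
  · rintro rfl
    simp only [sigma2, iInf_eq_top, SimpleGraph.top_adj]
    intro u v huv hn
    exact absurd huv hn

/-! ### The exceptional graphs -/

/-- The graph `F₅` (two triangles sharing a vertex): `0` is the vertex `a`, and `1, 2, 3, 4` are
`b₁, b₂, b₃, b₄`. -/
def F5 : SimpleGraph (Fin 5) :=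
  SimpleGraph.fromEdgeSet
    {s(0, 1), s(0, 2), s(0, 3), s(0, 4), s(1, 2), s(3, 4)}

/-- The vertex set `{a, b₁, b₂} ∪ {c₁, …, cₘ}`. -/
abbrev FVertex (m : ℕ) : Type := Fin 3 ⊕ Fin m

/-- The vertex `a`. -/
abbrev va {m : ℕ} : FVertex m := Sum.inl 0
/-- The vertex `b₁`. -/
abbrev vb1 {m : ℕ} : FVertex m := Sum.inl 1
/-- The vertex `b₂`. -/
abbrev vb2 {m : ℕ} : FVertex m := Sum.inl 2
/-- The vertices `c`, indexed from `0`: `vc 0, vc 1, …` are `c₁, c₂, …`. -/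
abbrev vc {m : ℕ} (i : Fin m) : FVertex m := Sum.inr i

/-- The graph on `{a, b₁, b₂, c₁, …, c₈}` with edges `a cᵢ` for `1 ≤ i ≤ 8`, `b₁ cᵢ` for
`1 ≤ i ≤ 4`, `b₂ cᵢ` for `5 ≤ i ≤ 8`, `c₁c₂`, `c₃c₄`, `c₅c₆`, `c₇c₈`, and the edges in `L`. -/
def F11 (L : Set (Sym2 (FVertex 8))) : SimpleGraph (FVertex 8) :=
  SimpleGraph.fromEdgeSet
    ({e | ∃ i : Fin 8, e = s(va, vc i)} ∪
     {e | ∃ i : Fin 8, (i : ℕ) < 4 ∧ e = s(vb1, vc i)} ∪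
     {e | ∃ i : Fin 8, 4 ≤ (i : ℕ) ∧ e = s(vb2, vc i)} ∪
     {s(vc 0, vc 1), s(vc 2, vc 3), s(vc 4, vc 5), s(vc 6, vc 7)} ∪ L)

/-- `G` is isomorphic to a member of the family `𝓕₁₁`. -/
def IsF11 {V : Type*} (G : SimpleGraph V) : Prop :=
  ∃ L : Set (Sym2 (FVertex 8)), L ⊆ {s(va, vb1), s(va, vb2)} ∧ Nonempty (G ≃g F11 L)

/-- The graph on `{a, b₁, b₂, c₁, …, c₉}` with edges `a cᵢ` for `1 ≤ i ≤ 8`, `b₁ cᵢ` for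
`1 ≤ i ≤ 4`, `b₂ cᵢ` for `5 ≤ i ≤ 8`, `c₁c₂`, `c₃c₄`, `c₅c₆`, `c₇c₉`, `c₈c₉`, and the edges in
`L`. -/
def F12 (L : Set (Sym2 (FVertex 9))) : SimpleGraph (FVertex 9) :=
  SimpleGraph.fromEdgeSet
    ({e | ∃ i : Fin 9, (i : ℕ) < 8 ∧ e = s(va, vc i)} ∪
     {e | ∃ i : Fin 9, (i : ℕ) < 4 ∧ e = s(vb1, vc i)} ∪
     {e | ∃ i : Fin 9, 4 ≤ (i : ℕ) ∧ (i : ℕ) < 8 ∧ e = s(vb2, vc i)} ∪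
     {s(vc 0, vc 1), s(vc 2, vc 3), s(vc 4, vc 5), s(vc 6, vc 8), s(vc 7, vc 8)} ∪ L)

/-- `G` is isomorphic to a member of the family `𝓕₁₂`. -/
def IsF12 {V : Type*} (G : SimpleGraph V) : Prop :=
  ∃ L : Set (Sym2 (FVertex 9)),
    L ⊆ {s(va, vb1), s(va, vb2), s(va, vc 8), s(vb2, vc 8)} ∧
    (L ∩ {s(va, vc 8), s(vb2, vc 8)}).Nonempty ∧ Nonempty (G ≃g F12 L)

/-- The vertex set of `H_{s,t}`: the four vertices `a, b, c₁, c₂` (as `0, 1, 2, 3`), followed by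
`V(S₁)` and `V(S₂)`, of sizes `s - 1` and `t - 1`. Only used for `2 ≤ s` and `2 ≤ t`. -/
abbrev HVertex (s t : ℕ) : Type := Fin 4 ⊕ (Fin (s - 1) ⊕ Fin (t - 1))

/-- The graph `H_{s,t}`: `S₁` and `S₂` are disjoint complete graphs, `a` and `b` are joined to all
vertices of both, and `ab`, `ac₁`, `ac₂`, `c₁c₂` are added. -/
def H (s t : ℕ) : SimpleGraph (HVertex s t) :=
  SimpleGraph.fromEdgeSet
    ({e | ∃ x y : Fin (s - 1), x ≠ y ∧ e = s(Sum.inr (Sum.inl x), Sum.inr (Sum.inl y))} ∪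
     {e | ∃ x y : Fin (t - 1), x ≠ y ∧ e = s(Sum.inr (Sum.inr x), Sum.inr (Sum.inr y))} ∪
     {e | ∃ x : Fin (s - 1) ⊕ Fin (t - 1), e = s(Sum.inl 0, Sum.inr x)} ∪
     {e | ∃ x : Fin (s - 1) ⊕ Fin (t - 1), e = s(Sum.inl 1, Sum.inr x)} ∪
     {s(Sum.inl 0, Sum.inl 1), s(Sum.inl 0, Sum.inl 2), s(Sum.inl 0, Sum.inl 3),
      s(Sum.inl 2, Sum.inl 3)})

/-- The graph `H⁻_{s,t} = H_{s,t} - ab`. -/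
def HMinus (s t : ℕ) : SimpleGraph (HVertex s t) :=
  (H s t).deleteEdges {s(Sum.inl 0, Sum.inl 1)}

/-- `G` is isomorphic to a member of `𝓗ₙ⁼ = {H_{s,s}, H⁻_{s,s} | s ≥ 2, 2 s + 2 = n}`. -/
def IsHEq {V : Type*} (n : ℕ) (G : SimpleGraph V) : Prop :=
  ∃ s : ℕ, 2 ≤ s ∧ 2 * s + 2 = n ∧ (Nonempty (G ≃g H s s) ∨ Nonempty (G ≃g HMinus s s))

end ProperPartition

/-! Write σ₂(G) = δ + D. The hypothesis then reads n ≤ δ(D + 1), and δ ≤ D because σ₂(G) ≥ 2δ; the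
case δ = 1 is void, since a vertex of degree one forces σ₂(G) < n. The induction on n concerns
`OreClass G δ D`, where δ and D are only lower bounds, so that induced subgraphs qualify, complete
ones included. `Good` therefore keeps a cover with one part as a separate outcome: its bound needs σ
≤ 2(n - 1), which holds for the original graph because that graph is not complete.

For the step from (δ, D) to (δ + 1, D + 1), let σ = δ + D + 2. Suppose first that some block B has
at least σ vertices. Every vertex outside B has at most one neighbour in B, so removing B lowers
both parameters by at most one, and the identity (δ + 1)(D + 2) = δ(D + 1) + σ preserves the bound
on the order. If the rest is covered by induction, B is one more part. If the rest is exceptional,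
its vertices of low degree need neighbours in B, and by maximality of the block they all have the
same one, x. The rest together with x is then a part, and induction applies to B - x. Only if both
sides are exceptional for (2, 2) does this fail, and then G belongs to 𝓕₁₁ or 𝓕₁₂.

Suppose next that every block has fewer than σ vertices. A cover is built along the tree of blocks,
together with an independent set of representatives, at least as many as the parts, of degree sum at
most n - 1. Since k ≥ 2 independent vertices have degree sum at least kσ/2, the required bound
follows. Representatives are interior vertices of blocks, that is, vertices without neighbours
outside the block. They exist by `OreClass.card_le_sum`: at least deg z independent vertices, all
distinct from z and not adjacent to it, have closed neighbourhoods of total size at least n.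
Vertices chosen in disjoint branches that miss z violate this, so every vertex lies in a block with
an interior vertex (`OreClass.exists_proper`). A block B whose vertex p is already used is replaced
by a non-separable core inside B - p (`OreClass.exists_core`), and the vertices outside the core are
left to other blocks further down (`OreClass.exists_proper_ne`).

The induction starts at δ = 2. If there is a vertex of degree two, its non-neighbours have degree at
least D while n ≤ 2D + 2, and the two sides of a cut vertex give at most three parts or one of F₅,
H_{2,2}, H_{3,3}, up to the edge ab. If there is none, G lies in a class with δ = 3 and the step
applies. -/

set_option linter.unusedSectionVars false

namespace ProperPartition

/-! ### Connected sets, blocks and branches -/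

section Connectivity

variable {V : Type*} [DecidableEq V] {G : SimpleGraph V}

/-- `S` induces a preconnected subgraph: no non-empty proper subset of `S` is closed under
adjacency within `S`. -/
def Conn (G : SimpleGraph V) (S : Finset V) : Prop :=
  ∀ T ⊆ S, T.Nonempty → (∀ a ∈ T, ∀ b ∈ S, G.Adj a b → b ∈ T) → T = S

theorem conn_singleton (a : V) : Conn G {a} := by
  intro T hT hne _
  exact (Finset.subset_singleton_iff.1 hT).resolve_left hne.ne_empty

theorem Conn.subset {S T : Finset V} (hS : Conn G S) (h : (S ∩ T).Nonempty)
    (hc : ∀ a ∈ S, a ∈ T → ∀ b ∈ S, G.Adj a b → b ∈ T) : S ⊆ T := by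
  have := hS (S ∩ T) Finset.inter_subset_left h (by
    intro a ha b hb hab
    rw [Finset.mem_inter] at ha ⊢
    exact ⟨hb, hc a ha.1 ha.2 b hb hab⟩)
  exact Finset.inter_eq_left.1 this

theorem Conn.union {S T : Finset V} (hS : Conn G S) (hT : Conn G T) (h : (S ∩ T).Nonempty) :
    Conn G (S ∪ T) := by
  obtain ⟨x, hx⟩ := h
  rw [Finset.mem_inter] at hx
  intro X hX hne hcl
  have key : ∀ R, R ⊆ S ∪ T → Conn G R → (R ∩ X).Nonempty → R ⊆ X := by
    intro R hR hRc hRX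
    exact hRc.subset hRX fun a _ haX b hb hab => hcl a haX b (hR hb) hab
  have hSX : S ⊆ X → X = S ∪ T := fun h1 => by
    have h2 := key T Finset.subset_union_right hT ⟨x, Finset.mem_inter.2 ⟨hx.2, h1 hx.1⟩⟩
    exact hX.antisymm (Finset.union_subset h1 h2)
  have hTX : T ⊆ X → X = S ∪ T := fun h1 => by
    have h2 := key S Finset.subset_union_left hS ⟨x, Finset.mem_inter.2 ⟨hx.1, h1 hx.2⟩⟩
    exact hX.antisymm (Finset.union_subset h2 h1)
  obtain ⟨y, hy⟩ := hne
  rcases Finset.mem_union.1 (hX hy) with h1 | h1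
  · exact hSX (key S Finset.subset_union_left hS ⟨y, Finset.mem_inter.2 ⟨h1, hy⟩⟩)
  · exact hTX (key T Finset.subset_union_right hT ⟨y, Finset.mem_inter.2 ⟨h1, hy⟩⟩)

theorem conn_pair {a b : V} (h : G.Adj a b) : Conn G {a, b} := by
  intro T hT hne hcl
  refine hT.antisymm ?_
  obtain ⟨x, hx⟩ := hne
  have hx' := hT hx
  simp only [Finset.mem_insert, Finset.mem_singleton] at hx'
  have hab : a ∈ T ↔ b ∈ T :=
    ⟨fun h1 => hcl a h1 b (by simp) h, fun h1 => hcl b h1 a (by simp) h.symm⟩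
  intro y hy
  simp only [Finset.mem_insert, Finset.mem_singleton] at hy
  rcases hx' with rfl | rfl <;> rcases hy with rfl | rfl <;> tauto

theorem Conn.union_adj {S T : Finset V} (hS : Conn G S) (hT : Conn G T) {a b : V} (ha : a ∈ S)
    (hb : b ∈ T) (h : G.Adj a b) : Conn G (S ∪ T) := by
  have h1 : Conn G (S ∪ {a, b}) := hS.union (conn_pair h) ⟨a, by simp [ha]⟩
  have h2 : Conn G (S ∪ {a, b} ∪ T) := h1.union hT ⟨b, by simp [hb]⟩
  convert h2 using 1
  ext x
  simp only [Finset.mem_union, Finset.mem_insert, Finset.mem_singleton]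
  constructor
  · tauto
  · rintro ((h | rfl | rfl) | h) <;> tauto

theorem Conn.insert_adj {S : Finset V} (hS : Conn G S) {a b : V} (ha : a ∈ S)
    (h : G.Adj a b) : Conn G (insert b S) := by
  have := (hS.union_adj (conn_singleton b) ha (Finset.mem_singleton_self b) h)
  rwa [Finset.union_comm] at this

theorem conn_of_base {S : Finset V} (r : V)
    (h : ∀ w ∈ S, ∃ T ⊆ S, Conn G T ∧ r ∈ T ∧ w ∈ T) : Conn G S := by
  intro X hX hne hcl
  have key : ∀ R, R ⊆ S → Conn G R → (R ∩ X).Nonempty → R ⊆ X := by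
    intro R hR hRc hRX
    exact hRc.subset hRX fun a _ haX b hb hab => hcl a haX b (hR hb) hab
  obtain ⟨x, hx⟩ := hne
  obtain ⟨T, hTS, hT, hr, hxT⟩ := h x (hX hx)
  have hrX : r ∈ X := key T hTS hT ⟨x, Finset.mem_inter.2 ⟨hxT, hx⟩⟩ hr
  refine hX.antisymm fun w hw => ?_
  obtain ⟨T, hTS, hT, hr, hwT⟩ := h w hw
  exact key T hTS hT ⟨r, Finset.mem_inter.2 ⟨hr, hrX⟩⟩ hwT

/-- A set that is not connected splits into two non-empty parts with no edges between them. -/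
theorem exists_split {S : Finset V} (h : ¬ Conn G S) :
    ∃ T₁ T₂ : Finset V, T₁.Nonempty ∧ T₂.Nonempty ∧ Disjoint T₁ T₂ ∧ T₁ ∪ T₂ = S ∧
      ∀ a ∈ T₁, ∀ b ∈ T₂, ¬ G.Adj a b := by
  unfold Conn at h
  push Not at h
  obtain ⟨T, hTS, hne, hcl, hneq⟩ := h
  refine ⟨T, S \ T, hne, ?_, Finset.disjoint_sdiff, Finset.union_sdiff_of_subset hTS, ?_⟩
  · rw [Finset.sdiff_nonempty]
    exact fun h => hneq (hTS.antisymm h)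
  · intro a ha b hb hab
    rw [Finset.mem_sdiff] at hb
    exact hb.2 (hcl a ha b hb.1 hab)

open Classical in
/-- The connected component of `r` in the subgraph induced by `S`. -/
noncomputable def comp (G : SimpleGraph V) (S : Finset V) (r : V) : Finset V :=
  S.filter fun w => ∃ T ⊆ S, Conn G T ∧ r ∈ T ∧ w ∈ T

theorem mem_comp {S : Finset V} {r w : V} :
    w ∈ comp G S r ↔ w ∈ S ∧ ∃ T ⊆ S, Conn G T ∧ r ∈ T ∧ w ∈ T := by
  classical
  exact Finset.mem_filter

theorem comp_subset (S : Finset V) (r : V) : comp G S r ⊆ S := fun _ hw => (mem_comp.1 hw).1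

theorem subset_comp {S T : Finset V} {r : V} (hT : T ⊆ S) (hc : Conn G T) (hr : r ∈ T) :
    T ⊆ comp G S r := fun _ hw =>
  mem_comp.2 ⟨hT hw, T, hT, hc, hr, hw⟩

theorem self_mem_comp {S : Finset V} {r : V} (hr : r ∈ S) : r ∈ comp G S r :=
  subset_comp (Finset.singleton_subset_iff.2 hr) (conn_singleton r)
    (Finset.mem_singleton_self r) (Finset.mem_singleton_self r)

theorem conn_comp (S : Finset V) (r : V) : Conn G (comp G S r) := by
  refine conn_of_base r fun w hw => ?_
  obtain ⟨_, T, hTS, hT, hr, hwT⟩ := mem_comp.1 hw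
  exact ⟨T, subset_comp hTS hT hr, hT, hr, hwT⟩

theorem comp_closed {S : Finset V} {r a b : V} (ha : a ∈ comp G S r) (hb : b ∈ S)
    (hab : G.Adj a b) : b ∈ comp G S r := by
  obtain ⟨_, T, hTS, hT, hr, haT⟩ := mem_comp.1 ha
  exact subset_comp (Finset.insert_subset hb hTS) (hT.insert_adj haT hab)
    (Finset.mem_insert_of_mem hr) (Finset.mem_insert_self b T)

/-- `B` induces a connected subgraph without cut vertices. -/
def NS (G : SimpleGraph V) (B : Finset V) : Prop :=
  Conn G B ∧ ∀ c, Conn G (B.erase c)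

theorem ns_pair {a b : V} (h : G.Adj a b) : NS G {a, b} := by
  refine ⟨conn_pair h, fun c => ?_⟩
  have hab := h.ne
  by_cases h1 : c = a
  · subst h1
    have : ({c, b} : Finset V).erase c = {b} := by ext x; simp; aesop
    rw [this]; exact conn_singleton b
  by_cases h2 : c = b
  · subst h2
    have : ({a, c} : Finset V).erase c = {a} := by ext x; simp; aesop
    rw [this]; exact conn_singleton a
  rw [Finset.erase_eq_of_notMem (by simp [h1, h2])]
  exact conn_pair h

theorem NS.union {B C : Finset V} (hB : NS G B) (hC : NS G C) {a b : V} (hab : a ≠ b)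
    (haB : a ∈ B) (haC : a ∈ C) (hbB : b ∈ B) (hbC : b ∈ C) : NS G (B ∪ C) := by
  refine ⟨hB.1.union hC.1 ⟨a, by simp [haB, haC]⟩, fun c => ?_⟩
  rw [Finset.erase_union_distrib]
  refine (hB.2 c).union (hC.2 c) ?_
  by_cases h : a = c
  · exact ⟨b, by simp [← h, hab.symm, hbB, hbC]⟩
  · exact ⟨a, by simp [h, haB, haC]⟩

/-- Adding a vertex with two neighbours keeps a set non-separable. -/
theorem NS.insert {B : Finset V} (hB : NS G B) {x a b : V} (hab : a ≠ b) (ha : a ∈ B)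
    (hb : b ∈ B) (hxa : G.Adj a x) (hxb : G.Adj b x) : NS G (insert x B) := by
  by_cases hx : x ∈ B
  · rwa [Finset.insert_eq_of_mem hx]
  refine ⟨hB.1.insert_adj ha hxa, fun c => ?_⟩
  by_cases hc : c = x
  · subst hc
    rw [Finset.erase_insert hx]; exact hB.1
  rw [Finset.erase_insert_of_ne (Ne.symm hc)]
  by_cases h : a = c
  · exact (hB.2 c).insert_adj (Finset.mem_erase.2 ⟨fun h' => hab (h.trans h'.symm), hb⟩) hxb
  · exact (hB.2 c).insert_adj (Finset.mem_erase.2 ⟨h, ha⟩) hxa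

/-- `Y` is a union of components of `K - c`, and the rest still hangs together through `c`: a closed
set containing `c` stays closed in `K` after adding `Y`, and one avoiding `c` is already closed in
`K`. -/
theorem Conn.sdiff {K Y : Finset V} {c : V} (hK : Conn G K) (hcK : c ∈ K) (hY : Y ⊆ K.erase c)
    (hcl : ∀ a ∈ Y, ∀ b ∈ K.erase c, G.Adj a b → b ∈ Y) : Conn G (K \ Y) := by
  have hcY : c ∉ Y := fun h => by simpa using hY h
  intro T hT hne hTcl
  by_cases hcT : c ∈ T
  · have : K ⊆ T ∪ Y := hK.subset ⟨c, by simp [hcK, hcT]⟩ (by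
      intro a _ haT b hb hab
      by_cases hbY : b ∈ Y
      · exact Finset.mem_union_right _ hbY
      rcases Finset.mem_union.1 haT with h | h
      · exact Finset.mem_union_left _ (hTcl a h b (Finset.mem_sdiff.2 ⟨hb, hbY⟩) hab)
      · by_cases hbc : b = c
        · subst hbc; exact Finset.mem_union_left _ hcT
        · exact Finset.mem_union_right _ (hcl a h b (Finset.mem_erase.2 ⟨hbc, hb⟩) hab))
    refine hT.antisymm fun x hx => ?_
    rw [Finset.mem_sdiff] at hx
    exact (Finset.mem_union.1 (this hx.1)).resolve_right hx.2
  · exfalso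
    obtain ⟨t, ht⟩ := hne
    have htK := (Finset.mem_sdiff.1 (hT ht)).1
    have : K ⊆ T := hK.subset ⟨t, by simp [htK, ht]⟩ (by
      intro a _ haT b hb hab
      refine hTcl a haT b (Finset.mem_sdiff.2 ⟨hb, fun hbY => ?_⟩) hab
      have ha := Finset.mem_sdiff.1 (hT haT)
      exact ha.2 (hcl b hbY a (Finset.mem_erase.2 ⟨fun h => hcT (h ▸ haT), ha.1⟩) hab.symm))
    exact hcT (this hcK)

/-- Stands in for adding an ear. A vertex `c` of `K` may cut off a set `Y` without neighbours in
`B`. Deleting `Y` keeps `K` connected and keeps both attachments, so the cardinality of `K` drops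
and induction applies. When no such `Y` exists, every component of `K - c` reaches `B`, and `B ∪ K`
has no cut vertex. -/
theorem exists_ear {B : Finset V} (hB : NS G B) :
    ∀ (n : ℕ) (K : Finset V), K.card = n → Conn G K → Disjoint K B →
      (∃ b₁ ∈ B, ∃ b₂ ∈ B, b₁ ≠ b₂ ∧ (∃ k ∈ K, G.Adj b₁ k) ∧ ∃ k ∈ K, G.Adj b₂ k) →
      ∃ K', K'.Nonempty ∧ Disjoint K' B ∧ NS G (B ∪ K') := by
  intro n
  induction n using Nat.strong_induction_on with
  | _ n ih =>
  intro K hn hK hKB hatt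
  obtain ⟨b₁, hb₁, b₂, hb₂, hne, ⟨k₁, hk₁, ha₁⟩, k₂, hk₂, ha₂⟩ := hatt
  by_cases hbad : ∃ c ∈ K, ∃ Y ⊆ K.erase c, Y.Nonempty ∧
      (∀ a ∈ Y, ∀ b ∈ K.erase c, G.Adj a b → b ∈ Y) ∧ ∀ a ∈ Y, ∀ b ∈ B, ¬ G.Adj a b
  · obtain ⟨c, hc, Y, hY, hYne, hcl, hYB⟩ := hbad
    have hYK : Y ⊆ K := hY.trans (Finset.erase_subset _ _)
    refine ih (K \ Y).card ?_ (K \ Y) rfl (hK.sdiff hc hY hcl)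
      (hKB.mono_left Finset.sdiff_subset) ⟨b₁, hb₁, b₂, hb₂, hne, ⟨k₁, ?_, ha₁⟩, k₂, ?_, ha₂⟩
    · rw [← hn]
      exact Finset.card_lt_card (Finset.sdiff_ssubset hYK hYne)
    · exact Finset.mem_sdiff.2 ⟨hk₁, fun h => hYB k₁ h b₁ hb₁ ha₁.symm⟩
    · exact Finset.mem_sdiff.2 ⟨hk₂, fun h => hYB k₂ h b₂ hb₂ ha₂.symm⟩
  · push Not at hbad
    refine ⟨K, ⟨k₁, hk₁⟩, hKB, hB.1.union_adj hK hb₁ hk₁ ha₁, fun c => ?_⟩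
    rw [Finset.erase_union_distrib]
    by_cases hcK : c ∈ K
    · have hcB : c ∉ B := Finset.disjoint_left.1 hKB hcK
      rw [Finset.erase_eq_of_notMem hcB]
      -- Every non-empty closed set absorbs `B`, so a closed set and its complement cannot both be
      -- non-empty.
      have key : ∀ X ⊆ B ∪ K.erase c, X.Nonempty →
          (∀ a ∈ X, ∀ b ∈ B ∪ K.erase c, G.Adj a b → b ∈ X) → B ⊆ X := by
        intro X hX hXne hXcl
        refine hB.1.subset ?_ fun a ha haX b hb hab =>
          hXcl a haX b (Finset.mem_union_left _ hb) hab
        by_contra hemp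
        rw [Finset.not_nonempty_iff_eq_empty, ← Finset.disjoint_iff_inter_eq_empty] at hemp
        have hXK : X ⊆ K.erase c := fun x hx =>
          (Finset.mem_union.1 (hX hx)).resolve_left fun h => Finset.disjoint_left.1 hemp h hx
        obtain ⟨a, ha, b, hb, hab⟩ := hbad c hcK X hXK hXne fun a ha b hb hab =>
          hXcl a ha b (Finset.mem_union_right _ hb) hab
        exact Finset.disjoint_left.1 hemp hb (hXcl a ha b (Finset.mem_union_left _ hb) hab)
      intro X hX hXne hXcl
      by_contra hneq
      have h1 := key X hX hXne hXcl
      have h2 := key ((B ∪ K.erase c) \ X) Finset.sdiff_subset (by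
        rw [Finset.sdiff_nonempty]; exact fun h => hneq (hX.antisymm h)) (by
        intro a ha b hb hab
        rw [Finset.mem_sdiff] at ha ⊢
        exact ⟨hb, fun h => ha.2 (hXcl b h a ha.1 hab.symm)⟩)
      exact (Finset.mem_sdiff.1 (h2 hb₁)).2 (h1 hb₁)
    · rw [Finset.erase_eq_of_notMem hcK]
      by_cases h : b₁ = c
      · exact (hB.2 c).union_adj hK
          (Finset.mem_erase.2 ⟨fun h' => hne (h.trans h'.symm), hb₂⟩) hk₂ ha₂
      · exact (hB.2 c).union_adj hK (Finset.mem_erase.2 ⟨h, hb₁⟩) hk₁ ha₁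

/-- Maximal non-separable sets with at least two vertices. -/
def IsBlock (G : SimpleGraph V) (B : Finset V) : Prop :=
  NS G B ∧ 2 ≤ B.card ∧ ∀ B', NS G B' → B ⊆ B' → B' = B

theorem exists_block [Fintype V] {A : Finset V} (hA : NS G A) (h2 : 2 ≤ A.card) :
    ∃ B, IsBlock G B ∧ A ⊆ B := by
  classical
  obtain ⟨B, hB, hmax⟩ := Finset.exists_max_image
    (Finset.univ.filter fun B : Finset V => NS G B ∧ A ⊆ B) Finset.card
    ⟨A, by simp [hA]⟩
  simp only [Finset.mem_filter, Finset.mem_univ, true_and] at hB hmax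
  refine ⟨B, ⟨hB.1, h2.trans (Finset.card_le_card hB.2), fun B' hB' hBB' => ?_⟩, hB.2⟩
  exact (Finset.eq_of_subset_of_card_le hBB' (hmax B' ⟨hB', hB.2.trans hBB'⟩)).symm

/-- Two attachment vertices would give an ear and contradict the maximality of `B`. The tree
structure of the blocks rests on this. -/
theorem IsBlock.attach_unique {B K : Finset V} (hB : IsBlock G B) (hK : Conn G K)
    (hd : Disjoint K B) {b₁ b₂ k₁ k₂ : V} (hb₁ : b₁ ∈ B) (hb₂ : b₂ ∈ B) (hk₁ : k₁ ∈ K)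
    (hk₂ : k₂ ∈ K) (h₁ : G.Adj b₁ k₁) (h₂ : G.Adj b₂ k₂) : b₁ = b₂ := by
  by_contra hne
  obtain ⟨K', ⟨k, hk⟩, hdis, hns⟩ := exists_ear hB.1 _ K rfl hK hd
    ⟨b₁, hb₁, b₂, hb₂, hne, ⟨k₁, hk₁, h₁⟩, k₂, hk₂, h₂⟩
  have := hB.2.2 _ hns Finset.subset_union_left
  exact Finset.disjoint_left.1 hdis hk (this ▸ Finset.mem_union_right _ hk)

theorem IsBlock.eq_of_two {B C : Finset V} (hB : IsBlock G B) (hC : IsBlock G C) {a b : V}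
    (hab : a ≠ b) (haB : a ∈ B) (haC : a ∈ C) (hbB : b ∈ B) (hbC : b ∈ C) : B = C := by
  have h := hB.1.union hC.1 hab haB haC hbB hbC
  rw [← hB.2.2 _ h Finset.subset_union_left, hC.2.2 _ h Finset.subset_union_right]

theorem IsBlock.exists_adj {B : Finset V} (hB : IsBlock G B) {c : V} (hc : c ∈ B) :
    ∃ b ∈ B, G.Adj c b := by
  by_contra hcon
  push Not at hcon
  have := hB.1.1 {c} (Finset.singleton_subset_iff.2 hc) ⟨c, by simp⟩ (by
    intro a ha b hb hab
    rw [Finset.mem_singleton] at ha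
    exact absurd (ha ▸ hab) (hcon b hb))
  have h2 := hB.2.1
  rw [← this, Finset.card_singleton] at h2
  omega

variable [Fintype V]

/-- The vertices reachable from the vertex `c` of the block `B` without using another vertex
of `B`. -/
noncomputable def branch (G : SimpleGraph V) (B : Finset V) (c : V) : Finset V :=
  comp G (insert c (Finset.univ \ B)) c

theorem self_mem_branch (B : Finset V) (c : V) : c ∈ branch G B c :=
  self_mem_comp (Finset.mem_insert_self _ _)

theorem conn_branch (B : Finset V) (c : V) : Conn G (branch G B c) := conn_comp _ _

theorem eq_of_mem_branch {B : Finset V} {c w : V} (hw : w ∈ branch G B c) (hwB : w ∈ B) :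
    w = c := by
  have := comp_subset _ _ hw
  simp only [Finset.mem_insert, Finset.mem_sdiff, Finset.mem_univ, true_and] at this
  tauto

theorem mem_branch_of_adj {B : Finset V} {c w : V} (hw : w ∉ B) (h : G.Adj c w) :
    w ∈ branch G B c :=
  comp_closed (self_mem_branch B c) (by simp [hw]) h

theorem subset_branch {B K : Finset V} {c : V} (hK : Conn G K) (hc : c ∈ K)
    (hKB : ∀ k ∈ K, k ∈ B → k = c) : K ⊆ branch G B c := by
  refine subset_comp (fun k hk => ?_) hK hc
  simp only [Finset.mem_insert, Finset.mem_sdiff, Finset.mem_univ, true_and]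
  by_cases h : k ∈ B
  · exact Or.inl (hKB k hk h)
  · exact Or.inr h

/-- Without a neighbour of `c` in the component of `w` outside `B`, the connected branch could not
leave that component, yet it contains `c`. -/
theorem branch_attach {B : Finset V} {c w : V} (hcB : c ∈ B) (hw : w ∈ branch G B c)
    (hwB : w ∉ B) : ∃ k ∈ comp G (Finset.univ \ B) w, G.Adj c k := by
  by_contra hcon
  push Not at hcon
  have : branch G B c ⊆ comp G (Finset.univ \ B) w := by
    refine (conn_branch B c).subset ⟨w, ?_⟩ ?_
    · exact Finset.mem_inter.2 ⟨hw, self_mem_comp (by simp [hwB])⟩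
    · intro a ha haK b hb hab
      by_cases hbB : b ∈ B
      · rw [eq_of_mem_branch hb hbB] at hab
        exact absurd hab.symm (hcon a haK)
      · exact comp_closed haK (by simp [hbB]) hab
  have := comp_subset _ _ (this (self_mem_branch B c))
  simp [hcB] at this

/-- An edge leading back into `B` ends at the only attachment vertex of the component of `w` outside
`B`, which is `c`. -/
theorem IsBlock.branch_closed {B : Finset V} (hB : IsBlock G B) {c w w' : V} (hc : c ∈ B)
    (hw : w ∈ branch G B c) (hwc : w ≠ c) (h : G.Adj w w') : w' ∈ branch G B c := by
  have hwB : w ∉ B := fun h => hwc (eq_of_mem_branch hw h)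
  by_cases hw' : w' ∈ B
  · obtain ⟨k, hk, hck⟩ := branch_attach hc hw hwB
    have hd : Disjoint (comp G (Finset.univ \ B) w) B :=
      Finset.disjoint_left.2 fun x hx => (Finset.mem_sdiff.1 (comp_subset _ _ hx)).2
    rw [hB.attach_unique (conn_comp _ _) hd hw' hc (self_mem_comp (by simp [hwB])) hk h.symm hck]
    exact self_mem_branch B c
  · exact comp_closed hw (by simp [hw']) h

theorem IsBlock.branch_unique {B : Finset V} (hB : IsBlock G B) {c c' w : V} (hc : c ∈ B)
    (hc' : c' ∈ B) (hw : w ∈ branch G B c) (hw' : w ∈ branch G B c') : c = c' := by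
  by_cases hwB : w ∈ B
  · rw [← eq_of_mem_branch hw hwB, ← eq_of_mem_branch hw' hwB]
  · obtain ⟨k, hk, hck⟩ := branch_attach hc hw hwB
    obtain ⟨k', hk', hck'⟩ := branch_attach hc' hw' hwB
    have hd : Disjoint (comp G (Finset.univ \ B) w) B :=
      Finset.disjoint_left.2 fun x hx => (Finset.mem_sdiff.1 (comp_subset _ _ hx)).2
    exact hB.attach_unique (conn_comp _ _) hd hc hc' hk hk' hck hck'

/-- A connected set that meets the branch at `c` and avoids `c` stays in that branch. -/
theorem IsBlock.subset_branch_of_meets {B K : Finset V} (hB : IsBlock G B) {c w : V} (hc : c ∈ B)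
    (hK : Conn G K) (hcK : c ∉ K) (hwK : w ∈ K) (hw : w ∈ branch G B c) : K ⊆ branch G B c :=
  hK.subset ⟨w, Finset.mem_inter.2 ⟨hwK, hw⟩⟩ fun _ haK ha _ _ hab =>
    hB.branch_closed hc ha (fun h => hcK (h ▸ haK)) hab

/-- A block meeting `B` in `c` only lies in the branch at `c`. -/
theorem IsBlock.block_subset_branch {B C : Finset V} (hB : IsBlock G B) (hC : IsBlock G C) {c : V}
    (hne : C ≠ B) (hcB : c ∈ B) (hcC : c ∈ C) : C ⊆ branch G B c :=
  subset_branch hC.1.1 hcC fun k hk hkB => by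
    by_contra h
    exact hne (hC.eq_of_two hB h hk hkB hcC hcB)

/-- A vertex of `B` all of whose neighbours are in `B`. -/
def Interior (G : SimpleGraph V) (B : Finset V) (u : V) : Prop :=
  u ∈ B ∧ ∀ w, G.Adj u w → w ∈ B

/-- A block with an interior vertex. -/
def IsProper (G : SimpleGraph V) (B : Finset V) : Prop :=
  IsBlock G B ∧ ∃ u, Interior G B u

theorem exists_of_not_interior {B : Finset V} {v : V} (hv : v ∈ B) (h : ¬ Interior G B v) :
    ∃ w ∈ branch G B v, w ≠ v := by
  simp only [Interior, hv, true_and, not_forall] at h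
  obtain ⟨w, hvw, hw⟩ := h
  exact ⟨w, mem_branch_of_adj hw hvw, fun h => hw (h ▸ hv)⟩

theorem not_interior_of_branch {B : Finset V} {u w : V} 
    (hw : w ∈ branch G B u) (hwu : w ≠ u) : ¬ Interior G B u := by
  intro hu
  have : branch G B u ⊆ {u} := (conn_branch B u).subset
    ⟨u, by simp [self_mem_branch]⟩ (by
      intro a ha hau b hb hab
      rw [Finset.mem_singleton] at hau ⊢
      exact eq_of_mem_branch hb (hu.2 b (hau ▸ hab)))
  exact hwu (Finset.mem_singleton.1 (this hw))

/-- Different branches of one block are disjoint. For different blocks, the branch of `B'` at `v'`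
lies in the branch of `B` at `z`, which is disjoint from the one at `v`. -/
theorem fan_disjoint {z v v' : V} {B B' : Finset V} (hB : IsBlock G B) (hB' : IsBlock G B')
    (hzB : z ∈ B) (hzB' : z ∈ B') (hvB : v ∈ B) (hvB' : v' ∈ B') (hzv : G.Adj z v)
    (hzv' : G.Adj z v') (hne : v ≠ v') : Disjoint (branch G B v) (branch G B' v') := by
  rw [Finset.disjoint_left]
  intro w hw hw'
  by_cases hBB : B = B'
  · subst hBB
    exact hne (hB.branch_unique hvB hvB' hw hw')
  have hv'B : v' ∉ B := fun h => hBB (hB.eq_of_two hB' hzv'.ne hzB hzB' h hvB')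
  have hz : z ∉ branch G B' v' := fun h => hzv'.ne (eq_of_mem_branch h hzB')
  have := hB.subset_branch_of_meets hzB (conn_branch B' v') hz (self_mem_branch B' v')
    (mem_branch_of_adj hv'B hzv')
  exact hzv.ne (hB.branch_unique hzB hvB (this hw') hw)

end Connectivity

/-! ### Counting with representatives of branches -/

section Counting

variable {V : Type*} [DecidableEq V] [Fintype V] {G : SimpleGraph V} [DecidableRel G.Adj]

/-- The degree conditions under which proper partitions are constructed. -/
structure OreClass (G : SimpleGraph V) [DecidableRel G.Adj] (δ D : ℕ) : Prop where
  min_le : ∀ v, δ ≤ G.degree v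
  ore : ∀ u v, u ≠ v → ¬ G.Adj u v → δ + D ≤ G.degree u + G.degree v
  le : δ ≤ D
  card_le : Fintype.card V ≤ δ * (D + 1)

theorem degree_lt_card {S : Finset V} {r : V} (hr : r ∈ S) (h : ∀ w, G.Adj r w → w ∈ S) :
    G.degree r + 1 ≤ S.card := by
  rw [← G.card_neighborFinset_eq_degree,
    ← Finset.card_insert_of_notMem (G.notMem_neighborFinset_self r)]
  refine Finset.card_le_card (Finset.insert_subset hr fun w hw => h w ?_)
  simpa using hw

/-- At most one vertex of an independent set has degree below σ/2, and any other vertex makes up for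
its deficit. -/
theorem card_mul_le_two_mul_sum {σ : ℕ}
    (ore : ∀ u v, u ≠ v → ¬ G.Adj u v → σ ≤ G.degree u + G.degree v) {U : Finset V}
    (hU : ∀ u ∈ U, ∀ v ∈ U, ¬ G.Adj u v) (h2 : 2 ≤ U.card) :
    U.card * σ ≤ 2 * ∑ u ∈ U, G.degree u := by
  by_cases hlow : ∃ u ∈ U, 2 * G.degree u < σ
  · obtain ⟨u, hu, hlt⟩ := hlow
    have h1 : ∑ v ∈ U.erase u, (σ - G.degree u) ≤ ∑ v ∈ U.erase u, G.degree v := by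
      refine Finset.sum_le_sum fun v hv => ?_
      rw [Finset.mem_erase] at hv
      have := ore u v hv.1.symm (hU u hu v hv.2)
      omega
    rw [Finset.sum_const, smul_eq_mul, Finset.card_erase_of_mem hu] at h1
    rw [← Finset.add_sum_erase _ _ hu]
    obtain ⟨k, hk⟩ := Nat.exists_eq_add_of_le h2
    obtain ⟨e, he⟩ := Nat.exists_eq_add_of_lt hlt
    rw [hk] at h1 ⊢
    have e1 : σ - G.degree u = G.degree u + e + 1 := by omega
    have e2 : 2 + k - 1 = k + 1 := by omega
    rw [e1, e2] at h1
    rw [he]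
    nlinarith
  · push Not at hlow
    have := Finset.sum_le_sum hlow
    rwa [Finset.sum_const, smul_eq_mul, ← Finset.mul_sum] at this

/-- The vertices of an independent set that dominates the degree of a vertex `z`, and has no
neighbour of `z`, have closed neighbourhoods of total size at least `|V|`. -/
theorem OreClass.card_le_sum {δ D : ℕ} (h : OreClass G δ D) (hδ : 2 ≤ δ) {z : V} {U : Finset V}
    (hU : ∀ u ∈ U, ∀ v ∈ U, ¬ G.Adj u v) (hz : ∀ u ∈ U, z ≠ u ∧ ¬ G.Adj z u)
    (hc : G.degree z ≤ U.card) : Fintype.card V ≤ ∑ u ∈ U, (G.degree u + 1) := by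
  refine h.card_le.trans ?_
  have hd := h.min_le z
  have hle := h.le
  -- Let d = deg z and σ = δ + D. If d ≤ σ/2, the vertices of `U` have degree at least σ - d, and
  -- d(σ - d + 1) ≥ δ(D + 1) for δ ≤ d ≤ D. If d > σ/2, the sum is at least |U|(σ/2 + 1) with |U| ≥
  -- (σ + 1)/2.
  by_cases hlow : 2 * G.degree z ≤ δ + D
  · obtain ⟨i, hi⟩ := Nat.exists_eq_add_of_le hd
    obtain ⟨j, hj⟩ := Nat.exists_eq_add_of_le (show G.degree z ≤ D by omega)
    have h1 : ∑ u ∈ U, (δ + j + 1) ≤ ∑ u ∈ U, (G.degree u + 1) := by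
      refine Finset.sum_le_sum fun u hu => ?_
      have := h.ore z u (hz u hu).1 (hz u hu).2
      omega
    rw [Finset.sum_const, smul_eq_mul] at h1
    have h2 := Nat.mul_le_mul_right (δ + j + 1) hc
    rw [hj, hi]
    rw [hi] at h2
    nlinarith
  · have h1 := card_mul_le_two_mul_sum h.ore hU (by omega)
    rw [Finset.sum_add_distrib, Finset.sum_const, smul_eq_mul, mul_one]
    obtain ⟨i, rfl⟩ := Nat.exists_eq_add_of_le hle
    have h2 : 2 * δ + i + 1 ≤ 2 * U.card := by omega
    nlinarith

variable {δ D : ℕ}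

/-- A block has fewer vertices with outside neighbours than the degree of an interior vertex. -/
theorem OreClass.card_lt_degree (h : OreClass G δ D) (hδ : 2 ≤ δ) {B : Finset V}
    (hB : IsBlock G B) {u : V} (hu : Interior G B u) {J : Finset V} (hJ : J ⊆ B)
    (hJI : ∀ v ∈ J, ¬ Interior G B v) : J.card < G.degree u := by
  by_contra hcon
  push Not at hcon
  have hch : ∀ v, ∃ w, v ∈ J → w ∈ branch G B v ∧ w ≠ v := by
    intro v
    by_cases hv : v ∈ J
    · obtain ⟨w, hw⟩ := exists_of_not_interior (hJ hv) (hJI v hv)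
      exact ⟨w, fun _ => hw⟩
    · exact ⟨v, fun h => absurd h hv⟩
  choose r hr using hch
  have hclosed : ∀ v ∈ J, ∀ w, G.Adj (r v) w → w ∈ branch G B v := fun v hv w hw =>
    hB.branch_closed (hJ hv) (hr v hv).1 (hr v hv).2 hw
  have hinj : Set.InjOn r J := fun v hv w hw hvw =>
    hB.branch_unique (hJ hv) (hJ hw) (hr v hv).1 (hvw ▸ (hr w hw).1)
  have huJ : ∀ v ∈ J, u ∉ branch G B v := fun v hv hmem =>
    hJI v hv (eq_of_mem_branch hmem hu.1 ▸ hu)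
  -- The representatives are numerous enough for their closed neighbourhoods to have total size at
  -- least |V|, although these lie in disjoint branches that miss `u`.
  have hsum := h.card_le_sum hδ (z := u) (U := J.image r) (by
      simp only [Finset.mem_image]
      rintro _ ⟨v, hv, rfl⟩ _ ⟨w, hw, rfl⟩ hadj
      have := hB.branch_unique (hJ hv) (hJ hw) (hclosed v hv _ hadj) (hr w hw).1
      subst this
      exact hadj.ne rfl) (by
      simp only [Finset.mem_image]
      rintro _ ⟨v, hv, rfl⟩
      exact ⟨fun h => huJ v hv (h ▸ (hr v hv).1), fun h => huJ v hv (hclosed v hv _ h.symm)⟩)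
      (by rwa [Finset.card_image_of_injOn hinj])
  rw [Finset.sum_image hinj] at hsum
  have h1 : ∑ v ∈ J, (G.degree (r v) + 1) ≤ ∑ v ∈ J, (branch G B v).card :=
    Finset.sum_le_sum fun v hv => degree_lt_card (hr v hv).1 (hclosed v hv)
  rw [← Finset.card_biUnion (fun v hv w hw hvw => Finset.disjoint_left.2 fun x hx hx' =>
    hvw (hB.branch_unique (hJ hv) (hJ hw) hx hx'))] at h1
  have h2 : (J.biUnion (branch G B)).card < Fintype.card V :=
    Finset.card_lt_univ_of_notMem (x := u) (by
      simp only [Finset.mem_biUnion, not_exists, not_and]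
      exact huJ)
  omega

/-- If `y` were the only interior vertex, the other |B| - 1 ≥ deg y vertices would all have outside
neighbours, against `OreClass.card_lt_degree`. -/
theorem OreClass.exists_interior_ne (h : OreClass G δ D) (hδ : 2 ≤ δ) {B : Finset V}
    (hB : IsProper G B) (y : V) : ∃ u, Interior G B u ∧ u ≠ y := by
  by_contra hcon
  push Not at hcon
  obtain ⟨u, hu⟩ := hB.2
  have := hcon u hu
  subst this
  have h1 := h.card_lt_degree hδ hB.1 hu (Finset.erase_subset u B) fun v hv hvI =>
    (Finset.mem_erase.1 hv).1 (hcon v hvI)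
  rw [Finset.card_erase_of_mem hu.1] at h1
  have := degree_lt_card hu.1 hu.2
  omega

/-- Representatives in branches at distinct neighbours of a vertex `z`. -/
theorem exists_fan {z : V} {J : Finset V} {C : V → Finset V} (hJ : ∀ v ∈ J, G.Adj z v)
    (hC : ∀ v ∈ J, IsBlock G (C v) ∧ z ∈ C v ∧ v ∈ C v ∧ ¬ Interior G (C v) v) :
    ∃ r : V → V, Set.InjOn r J ∧
      (∀ v ∈ J, r v ∈ branch G (C v) v ∧ (∀ w, G.Adj (r v) w → w ∈ branch G (C v) v)) ∧
      (∀ v ∈ J, z ∉ branch G (C v) v) ∧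
      (∀ v ∈ J, ∀ w ∈ J, v ≠ w → Disjoint (branch G (C v) v) (branch G (C w) w)) ∧
      (∀ v ∈ J, ∀ w ∈ J, ¬ G.Adj (r v) (r w)) ∧
      ∑ v ∈ J, (G.degree (r v) + 1) ≤ (J.biUnion fun v => branch G (C v) v).card := by
  have hch : ∀ v, ∃ w, v ∈ J → w ∈ branch G (C v) v ∧ w ≠ v := by
    intro v
    by_cases hv : v ∈ J
    · obtain ⟨w, hw⟩ := exists_of_not_interior (hC v hv).2.2.1 (hC v hv).2.2.2
      exact ⟨w, fun _ => hw⟩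
    · exact ⟨v, fun h => absurd h hv⟩
  choose r hr using hch
  have hcl : ∀ v ∈ J, ∀ w, G.Adj (r v) w → w ∈ branch G (C v) v := fun v hv w hw =>
    (hC v hv).1.branch_closed (hC v hv).2.2.1 (hr v hv).1 (hr v hv).2 hw
  have hd : ∀ v ∈ J, ∀ w ∈ J, v ≠ w → Disjoint (branch G (C v) v) (branch G (C w) w) :=
    fun v hv w hw hvw => fan_disjoint (hC v hv).1 (hC w hw).1 (hC v hv).2.1 (hC w hw).2.1
      (hC v hv).2.2.1 (hC w hw).2.2.1 (hJ v hv) (hJ w hw) hvw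
  refine ⟨r, ?_, fun v hv => ⟨(hr v hv).1, hcl v hv⟩, ?_, hd, ?_, ?_⟩
  · intro v hv w hw hvw
    by_contra hne
    exact Finset.disjoint_left.1 (hd v hv w hw hne) (hr v hv).1 (hvw ▸ (hr w hw).1)
  · exact fun v hv hz => (hJ v hv).ne (eq_of_mem_branch hz (hC v hv).2.1)
  · intro v hv w hw hadj
    by_cases hvw : v = w
    · subst hvw; exact hadj.ne rfl
    · exact Finset.disjoint_left.1 (hd v hv w hw hvw) (hcl v hv _ hadj) (hr w hw).1
  · rw [Finset.card_biUnion (fun v hv w hw hvw => hd v hv w hw hvw)]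
    exact Finset.sum_le_sum fun v hv => degree_lt_card (hr v hv).1 (hcl v hv)

theorem exists_block_of_adj {z v : V} (h : G.Adj z v) : ∃ B, IsBlock G B ∧ z ∈ B ∧ v ∈ B := by
  obtain ⟨B, hB, hsub⟩ := exists_block (ns_pair h) (by rw [Finset.card_pair h.ne])
  exact ⟨B, hB, hsub (by simp), hsub (by simp)⟩

/-- Every vertex lies in a block with an interior vertex. -/
theorem OreClass.exists_proper (h : OreClass G δ D) (hδ : 2 ≤ δ) (z : V) :
    ∃ B, IsProper G B ∧ z ∈ B := by
  by_contra hcon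
  push Not at hcon
  have hch : ∀ v, ∃ B, v ∈ G.neighborFinset z → 
      IsBlock G B ∧ z ∈ B ∧ v ∈ B ∧ ¬ Interior G B v := by
    intro v
    by_cases hv : v ∈ G.neighborFinset z
    · obtain ⟨B, hB, hz, hvB⟩ := exists_block_of_adj ((G.mem_neighborFinset z v).1 hv)
      exact ⟨B, fun _ => ⟨hB, hz, hvB, fun hi => hcon B ⟨hB, v, hi⟩ hz⟩⟩
    · exact ⟨∅, fun h => absurd h hv⟩
  choose C hC using hch
  -- By assumption no neighbour of `z` is interior to its block with `z`, so each one opens a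
  -- branch. The deg z disjoint branches miss `z` but would have to contain at least |V| vertices.
  obtain ⟨r, hinj, hr, hz, -, hind, hsum⟩ := exists_fan (J := G.neighborFinset z)
    (fun v hv => (G.mem_neighborFinset z v).1 hv) hC
  have h1 := h.card_le_sum hδ (z := z) (U := (G.neighborFinset z).image r) (by
      simp only [Finset.mem_image]
      rintro _ ⟨v, hv, rfl⟩ _ ⟨w, hw, rfl⟩
      exact hind v hv w hw) (by
      simp only [Finset.mem_image]
      rintro _ ⟨v, hv, rfl⟩
      exact ⟨fun h => hz v hv (h ▸ (hr v hv).1), fun h => hz v hv ((hr v hv).2 _ h.symm)⟩)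
      (by rw [Finset.card_image_of_injOn hinj, G.card_neighborFinset_eq_degree])
  rw [Finset.sum_image hinj] at h1
  have h2 : ((G.neighborFinset z).biUnion fun v => branch G (C v) v).card < Fintype.card V :=
    Finset.card_lt_univ_of_notMem (x := z) (by
      simp only [Finset.mem_biUnion, not_exists, not_and]
      exact hz)
  omega

/-- A block `B` of small order, minus one of its vertices `p` with outside neighbours, has a
non-separable subset that contains all interior vertices of `B` and onto which it retracts. -/
theorem OreClass.exists_core (h : OreClass G δ D) (hδ : 3 ≤ δ) {B : Finset V} {p : V}
    (hB : IsProper G B) (hcard : B.card < δ + D) (hp : p ∈ B) (hpI : ¬ Interior G B p) :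
    ∃ A ⊆ B.erase p, (∀ u, Interior G B u → u ∈ A) ∧ NS G A ∧ 3 ≤ A.card ∧
      ∃ π : V → V, (∀ v ∈ A, π v = v) ∧ (∀ v ∈ B.erase p, π v ∈ A) ∧
        ∀ v ∈ B.erase p, ∀ w ∈ B.erase p, v ∉ A → G.Adj v w → π v = π w := by
  classical
  -- The connected sets onto which `B - p` folds by a map `π`. A vertex outside `A` shares its image
  -- with all its neighbours in `B - p`, so it has at most one neighbour in `A`. A smallest such set
  -- turns out to be non-separable.
  let F : Finset (Finset V) := Finset.univ.filter fun A => A ⊆ B.erase p ∧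
    (∀ u, Interior G B u → u ∈ A) ∧ Conn G A ∧
      ∃ π : V → V, (∀ v ∈ A, π v = v) ∧ (∀ v ∈ B.erase p, π v ∈ A) ∧
        ∀ v ∈ B.erase p, ∀ w ∈ B.erase p, v ∉ A → G.Adj v w → π v = π w
  have hF : F.Nonempty := ⟨B.erase p, by
    simp only [F, Finset.mem_filter, Finset.mem_univ, true_and]
    refine ⟨Finset.Subset.refl _, fun u hu => Finset.mem_erase.2 ⟨fun h => hpI (h ▸ hu), hu.1⟩,
      hB.1.1.2 p, id, fun _ _ => rfl, fun v hv => hv, fun v hv _ _ hv' => absurd hv hv'⟩⟩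
  obtain ⟨A, hAF, hmin⟩ := Finset.exists_min_image F Finset.card hF
  simp only [F, Finset.mem_filter, Finset.mem_univ, true_and] at hAF hmin
  obtain ⟨hAB, hIA, hAc, π, hπA, hπ, hπe⟩ := hAF
  have hpA : p ∉ A := fun h => by simpa using hAB h
  -- common neighbours of two vertices of `A` outside `A`
  have hcommon : ∀ u ∈ A, ∀ v ∈ A, u ≠ v → ∀ w ∈ B.erase p, w ∉ A → G.Adj u w → ¬ G.Adj v w := by
    intro u hu v hv huv w hw hwA huw hvw
    have h1 := hπe w hw u (hAB hu) hwA huw.symm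
    have h2 := hπe w hw v (hAB hv) hwA hvw.symm
    rw [hπA u hu] at h1
    rw [hπA v hv] at h2
    exact huv (h1.symm.trans h2)
  have hns : NS G A := by
    refine ⟨hAc, fun y => ?_⟩
    by_cases hy : y ∈ A
    swap
    · rwa [Finset.erase_eq_of_notMem hy]
    by_contra hnc
    obtain ⟨T₁, T₂, hne₁, hne₂, hdis, hun, hadj⟩ := exists_split hnc
    -- A side `T` of the cut at `y` without interior vertices could be folded onto `y`, against
    -- minimality.
    have key : ∀ T T' : Finset V, T.Nonempty → Disjoint T T' → T ∪ T' = A.erase y →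
        (∀ a ∈ T, ∀ b ∈ T', ¬ G.Adj a b) → ∃ u ∈ T, Interior G B u := by
      intro T T' hTne hTT' hTun hTadj
      by_contra hnI
      push Not at hnI
      have hTA : T ⊆ A.erase y := hTun ▸ Finset.subset_union_left
      have hyT : y ∉ T := fun hyT => by simpa using hTA hyT
      have hlt : (A \ T).card < A.card :=
        Finset.card_lt_card (Finset.sdiff_ssubset (hTA.trans (Finset.erase_subset _ _)) hTne)
      refine absurd (hmin (A \ T) ⟨Finset.sdiff_subset.trans hAB, ?_, ?_, ?_⟩) (by omega)
      · exact fun u hu => Finset.mem_sdiff.2 ⟨hIA u hu, fun huT => hnI u huT hu⟩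
      · refine hAc.sdiff hy hTA fun a ha b hb hab => ?_
        rw [← hTun] at hb
        exact (Finset.mem_union.1 hb).resolve_right fun hbT' => hTadj a ha b hbT' hab
      · refine ⟨fun v => if π v ∈ T then y else π v, ?_, ?_, ?_⟩
        · intro v hv
          rw [Finset.mem_sdiff] at hv
          simp only [hπA v hv.1, hv.2, if_false]
        · intro v hv
          dsimp only
          split_ifs with hT
          · exact Finset.mem_sdiff.2 ⟨hy, hyT⟩
          · exact Finset.mem_sdiff.2 ⟨hπ v hv, hT⟩
        · intro v hv w hw hvA hvw
          by_cases hvA' : v ∈ A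
          · have hvT : v ∈ T := by
              by_contra hvT
              exact hvA (Finset.mem_sdiff.2 ⟨hvA', hvT⟩)
            dsimp only
            rw [if_pos (by rwa [hπA v hvA'])]
            by_cases hwA : w ∈ A
            · rw [hπA w hwA]
              split_ifs with hwT
              · rfl
              · by_contra hyw
                have : w ∈ T ∪ T' := by
                  rw [hTun]; exact Finset.mem_erase.2 ⟨Ne.symm hyw, hwA⟩
                exact hTadj v hvT w ((Finset.mem_union.1 this).resolve_left hwT) hvw
            · have := hπe w hw v hv hwA hvw.symm
              rw [this, hπA v hvA', if_pos hvT]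
          · dsimp only
            rw [hπe v hv w hw hvA' hvw]
    obtain ⟨u₁, hu₁, hI₁⟩ := key T₁ T₂ hne₁ hdis hun hadj
    obtain ⟨u₂, hu₂, hI₂⟩ := key T₂ T₁ hne₂ hdis.symm (by rw [Finset.union_comm, hun])
      fun a ha b hb hab => hadj b hb a ha hab.symm
    have hu₁A : u₁ ∈ A := hIA u₁ hI₁
    have hu₂A : u₂ ∈ A := hIA u₂ hI₂
    have hne : u₁ ≠ u₂ := fun h => Finset.disjoint_left.1 hdis hu₁ (h ▸ hu₂)
    have hu₁y : u₁ ≠ y := fun h => by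
      have := hun ▸ Finset.mem_union_left T₂ hu₁
      simp [h] at this
    have hu₂y : u₂ ≠ y := fun h => by
      have := hun ▸ Finset.mem_union_right T₁ hu₂
      simp [h] at this
    have hore := h.ore u₁ u₂ hne (hadj u₁ hu₁ u₂ hu₂)
    -- The only possible common neighbours of `u₁` and `u₂` are `p` and `y`. Counting in `B \ {p,
    -- y}` then gives deg u₁ + deg u₂ ≤ |B|, against |B| < δ + D.
    have hd : Disjoint (insert u₁ ((G.neighborFinset u₁ \ {p, y})))
        (insert u₂ (G.neighborFinset u₂ \ {p, y})) := by
      rw [Finset.disjoint_left]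
      intro w hw₁ hw₂
      simp only [Finset.mem_insert, Finset.mem_sdiff, SimpleGraph.mem_neighborFinset,
        Finset.mem_singleton, not_or] at hw₁ hw₂
      rcases hw₁ with rfl | ⟨hw₁, hwp, hwy⟩
      · rcases hw₂ with hw₂ | ⟨hw₂, -⟩
        · exact hne hw₂
        · exact hadj _ hu₁ _ hu₂ hw₂.symm
      · rcases hw₂ with rfl | ⟨hw₂, -⟩
        · exact hadj _ hu₁ _ hu₂ hw₁
        by_cases hwA : w ∈ A
        · have : w ∈ T₁ ∪ T₂ := by rw [hun]; exact Finset.mem_erase.2 ⟨hwy, hwA⟩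
          rcases Finset.mem_union.1 this with hwT | hwT
          · exact hadj w hwT u₂ hu₂ hw₂.symm
          · exact hadj u₁ hu₁ w hwT hw₁
        · exact hcommon u₁ hu₁A u₂ hu₂A hne w
            (Finset.mem_erase.2 ⟨hwp, hI₁.2 w hw₁⟩) hwA hw₁ hw₂
    have hsub : insert u₁ ((G.neighborFinset u₁ \ {p, y})) ∪
        insert u₂ (G.neighborFinset u₂ \ {p, y}) ⊆ B \ {p, y} := by
      intro w hw
      simp only [Finset.mem_union, Finset.mem_insert, Finset.mem_sdiff,
        SimpleGraph.mem_neighborFinset, Finset.mem_singleton, not_or] at hw ⊢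
      rcases hw with (rfl | ⟨hw, h1, h2⟩) | (rfl | ⟨hw, h1, h2⟩)
      · exact ⟨hI₁.1, by rintro rfl; exact hpA hu₁A, hu₁y⟩
      · exact ⟨hI₁.2 w hw, h1, h2⟩
      · exact ⟨hI₂.1, by rintro rfl; exact hpA hu₂A, hu₂y⟩
      · exact ⟨hI₂.2 w hw, h1, h2⟩
    have hle := Finset.card_le_card hsub
    have hins : ∀ u, G.degree u + 1 ≤ (insert u (G.neighborFinset u \ {p, y})).card + 2 := by
      intro u
      rw [Finset.card_insert_of_notMem (by simp)]
      have := Finset.le_card_sdiff {p, y} (G.neighborFinset u)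
      rw [G.card_neighborFinset_eq_degree] at this
      have h2 := Finset.card_le_two (a := p) (b := y)
      omega
    rw [Finset.card_union_of_disjoint hd, Finset.card_sdiff_of_subset (by
      intro w hw
      simp only [Finset.mem_insert, Finset.mem_singleton] at hw
      rcases hw with rfl | rfl
      · exact hp
      · exact (Finset.mem_erase.1 (hAB hy)).2), Finset.card_pair (a := p) (b := y) (by rintro rfl; exact hpA hy)] at hle
    have h1 := hins u₁
    have h2 := hins u₂
    have h3 : 2 ≤ B.card := hB.1.2.1
    omega
  refine ⟨A, hAB, hIA, hns, ?_, π, hπA, hπ, hπe⟩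
  -- Two interior vertices give |A| ≥ 2. If `A = {a, u}`, the neighbours of `u` and of `a` other
  -- than `a`, `u`, `p` form disjoint subsets of `B \ A` that miss `p`. As |B \ A| < deg u, this
  -- forces deg a ≤ 2.
  by_contra hA3
  obtain ⟨u, hu⟩ := hB.2
  obtain ⟨a, ha, hau⟩ := h.exists_interior_ne (by omega) hB u
  have huA := hIA u hu
  have haA := hIA a ha
  have hAeq : ({a, u} : Finset V) = A :=
    Finset.eq_of_subset_of_card_le (by
      intro x hx
      simp only [Finset.mem_insert, Finset.mem_singleton] at hx
      rcases hx with rfl | rfl <;> assumption) (by rw [Finset.card_pair hau]; omega)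
  have hlt := h.card_lt_degree (by omega) hB.1 hu (J := B \ A) Finset.sdiff_subset
    fun v hv hvI => (Finset.mem_sdiff.1 hv).2 (hIA v hvI)
  have hda := h.min_le a
  have hsub : (G.neighborFinset u \ {a, p}) ∪ (G.neighborFinset a \ {u, p}) ⊆ (B \ A).erase p := by
    intro w hw
    have hwA : w ∈ A ↔ w = a ∨ w = u := by simp [← hAeq]
    simp only [Finset.mem_union, Finset.mem_sdiff, SimpleGraph.mem_neighborFinset,
      Finset.mem_insert, Finset.mem_singleton, not_or, Finset.mem_erase, hwA] at hw ⊢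
    rcases hw with ⟨hw, h1, h2⟩ | ⟨hw, h1, h2⟩
    · exact ⟨h2, hu.2 w hw, h1, hw.ne'⟩
    · exact ⟨h2, ha.2 w hw, hw.ne', h1⟩
  have hd : Disjoint (G.neighborFinset u \ {a, p}) (G.neighborFinset a \ {u, p}) := by
    rw [Finset.disjoint_left]
    intro w hw₁ hw₂
    simp only [Finset.mem_sdiff, SimpleGraph.mem_neighborFinset,
      Finset.mem_insert, Finset.mem_singleton, not_or] at hw₁ hw₂
    refine hcommon u huA a haA hau.symm w (Finset.mem_erase.2 ⟨hw₁.2.2, hu.2 w hw₁.1⟩) ?_ hw₁.1 hw₂.1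
    rw [← hAeq]
    simp [hw₁.2.1, hw₂.2.1]
  have hle := Finset.card_le_card hsub
  rw [Finset.card_union_of_disjoint hd, Finset.card_erase_of_mem (by simp [hp, hpA])] at hle
  have h1 := Finset.le_card_sdiff {a, p} (G.neighborFinset u)
  have h2 := Finset.le_card_sdiff {u, p} (G.neighborFinset a)
  rw [G.card_neighborFinset_eq_degree] at h1 h2
  have h3 := Finset.card_le_two (a := a) (b := p)
  have h4 := Finset.card_le_two (a := u) (b := p)
  have h5 : 0 < (B \ A).card := Finset.card_pos.2 ⟨p, by simp [hp, hpA]⟩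
  omega

end Counting

/-! ### Covers along the tree of blocks when all blocks are small -/

section SmallBlocks

variable {V : Type*} [DecidableEq V] [Fintype V] {G : SimpleGraph V} [DecidableRel G.Adj]
variable {δ D : ℕ}

/-- The family `P` consists of disjoint non-separable sets of order at least three with
union `S`. -/
structure IsCover (G : SimpleGraph V) (P : Finset (Finset V)) (S : Finset V) : Prop where
  ns : ∀ A ∈ P, NS G A ∧ 3 ≤ A.card
  disj : ∀ A ∈ P, ∀ B ∈ P, A ≠ B → Disjoint A B
  mem_iff : ∀ v, v ∈ S ↔ ∃ A ∈ P, v ∈ A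

theorem IsCover.union {P Q : Finset (Finset V)} {S T : Finset V} (hP : IsCover G P S)
    (hQ : IsCover G Q T) (hd : Disjoint S T) : IsCover G (P ∪ Q) (S ∪ T) where
  ns A hA := (Finset.mem_union.1 hA).elim (hP.ns A) (hQ.ns A)
  disj A hA B hB hAB := by
    rcases Finset.mem_union.1 hA with hA | hA <;> rcases Finset.mem_union.1 hB with hB | hB
    · exact hP.disj A hA B hB hAB
    · exact hd.mono (fun v hv => (hP.mem_iff v).2 ⟨A, hA, hv⟩)
        (fun v hv => (hQ.mem_iff v).2 ⟨B, hB, hv⟩)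
    · exact hd.symm.mono (fun v hv => (hQ.mem_iff v).2 ⟨A, hA, hv⟩)
        (fun v hv => (hP.mem_iff v).2 ⟨B, hB, hv⟩)
    · exact hQ.disj A hA B hB hAB
  mem_iff v := by
    simp only [Finset.mem_union, hP.mem_iff, hQ.mem_iff, or_and_right, exists_or]

theorem isCover_empty : IsCover G ∅ (∅ : Finset V) := ⟨by simp, by simp, by simp⟩

theorem isCover_singleton {A : Finset V} (hA : NS G A) (h3 : 3 ≤ A.card) : IsCover G {A} A :=
  ⟨by simp [hA, h3], by simp, by simp⟩

/-- `S` has a cover whose parts have pairwise non-adjacent representatives in `W` with degree sum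
at most `m`. -/
def Piece (G : SimpleGraph V) [DecidableRel G.Adj] (S W : Finset V) (m : ℕ) : Prop :=
  ∃ (P : Finset (Finset V)) (U : Finset V), IsCover G P S ∧ U ⊆ W ∧ P.card ≤ U.card ∧
    (∀ u ∈ U, ∀ v ∈ U, ¬ G.Adj u v) ∧ ∑ u ∈ U, G.degree u ≤ m

theorem piece_empty : Piece G (∅ : Finset V) ∅ 0 :=
  ⟨∅, ∅, isCover_empty, by simp, by simp, by simp, by simp⟩

theorem piece_single {A : Finset V} (hA : NS G A) (h3 : 3 ≤ A.card) (u : V) :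
    Piece G A {u} (G.degree u) :=
  ⟨{A}, {u}, isCover_singleton hA h3, by simp, by simp, by simp, by simp⟩

theorem Piece.mono {S W W' : Finset V} {m m' : ℕ} (h : Piece G S W m) (hW : W ⊆ W')
    (hm : m ≤ m') : Piece G S W' m' := by
  obtain ⟨P, U, hP, hU, hc, hi, hs⟩ := h
  exact ⟨P, U, hP, hU.trans hW, hc, hi, hs.trans hm⟩

theorem Piece.union {S W S' W' : Finset V} {m m' : ℕ} (h : Piece G S W m)
    (h' : Piece G S' W' m') (hS : Disjoint S S') (hW : Disjoint W W')
    (hadj : ∀ a ∈ W, ∀ b ∈ W', ¬ G.Adj a b) : Piece G (S ∪ S') (W ∪ W') (m + m') := by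
  obtain ⟨P, U, hP, hU, hc, hi, hs⟩ := h
  obtain ⟨P', U', hP', hU', hc', hi', hs'⟩ := h'
  have hd : Disjoint U U' := hW.mono hU hU'
  refine ⟨P ∪ P', U ∪ U', hP.union hP' hS, Finset.union_subset_union hU hU', ?_, ?_, ?_⟩
  · rw [Finset.card_union_of_disjoint hd]
    exact (Finset.card_union_le _ _).trans (Nat.add_le_add hc hc')
  · intro u hu v hv
    rcases Finset.mem_union.1 hu with hu | hu <;> rcases Finset.mem_union.1 hv with hv | hv
    · exact hi u hu v hv
    · exact hadj u (hU hu) v (hU' hv)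
    · exact fun h => hadj v (hU hv) u (hU' hu) h.symm
    · exact hi' u hu v hv
  · rw [Finset.sum_union hd]
    exact Nat.add_le_add hs hs'

theorem piece_biUnion {C : Finset V} {S W : V → Finset V} {m : V → ℕ}
    (h : ∀ c ∈ C, Piece G (S c) (W c) (m c))
    (hS : ∀ c ∈ C, ∀ d ∈ C, c ≠ d → Disjoint (S c) (S d))
    (hW : ∀ c ∈ C, ∀ d ∈ C, c ≠ d → Disjoint (W c) (W d))
    (hadj : ∀ c ∈ C, ∀ d ∈ C, c ≠ d → ∀ a ∈ W c, ∀ b ∈ W d, ¬ G.Adj a b) :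
    Piece G (C.biUnion S) (C.biUnion W) (∑ c ∈ C, m c) := by
  induction C using Finset.induction_on with
  | empty => exact piece_empty
  | insert c C hc ih =>
    rw [Finset.biUnion_insert, Finset.biUnion_insert, Finset.sum_insert hc]
    have hne : ∀ d ∈ C, c ≠ d := fun d hd h => hc (h ▸ hd)
    refine (h c (Finset.mem_insert_self _ _)).union (ih ?_ ?_ ?_ ?_) ?_ ?_ ?_
    · exact fun d hd => h d (Finset.mem_insert_of_mem hd)
    · exact fun d hd e he => hS d (Finset.mem_insert_of_mem hd) e (Finset.mem_insert_of_mem he)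
    · exact fun d hd e he => hW d (Finset.mem_insert_of_mem hd) e (Finset.mem_insert_of_mem he)
    · exact fun d hd e he => hadj d (Finset.mem_insert_of_mem hd) e (Finset.mem_insert_of_mem he)
    · rw [Finset.disjoint_biUnion_right]
      exact fun d hd => hS c (Finset.mem_insert_self _ _) d (Finset.mem_insert_of_mem hd) (hne d hd)
    · rw [Finset.disjoint_biUnion_right]
      exact fun d hd => hW c (Finset.mem_insert_self _ _) d (Finset.mem_insert_of_mem hd) (hne d hd)
    · intro a ha b hb
      obtain ⟨d, hd, hbd⟩ := Finset.mem_biUnion.1 hb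
      exact hadj c (Finset.mem_insert_self _ _) d (Finset.mem_insert_of_mem hd) (hne d hd) a ha b hbd

/-- `W` is attached to the rest of the graph at `p` only, and connected through `p`. -/
structure Hang (G : SimpleGraph V) (p : V) (W : Finset V) : Prop where
  notMem : p ∉ W
  closed : ∀ a ∈ W, ∀ b, G.Adj a b → b ∈ W ∨ b = p
  conn : Conn G (insert p W)

theorem IsBlock.hang {B : Finset V} (hB : IsBlock G B) {c : V} (hc : c ∈ B) :
    Hang G c ((branch G B c).erase c) where
  notMem := Finset.notMem_erase _ _
  closed a ha b hab := by
    rw [Finset.mem_erase] at ha ⊢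
    have := hB.branch_closed hc ha.2 ha.1 hab
    tauto
  conn := by
    rw [Finset.insert_erase (self_mem_branch B c)]
    exact conn_branch B c

theorem Hang.branch_subset {p : V} {W B : Finset V} (hW : Hang G p W) (hp : p ∈ B)
    (hBW : B ⊆ insert p W) {c : V} (hc : c ∈ B) (hcp : c ≠ p) : branch G B c ⊆ W := by
  refine (conn_branch B c).subset ⟨c, ?_⟩ fun a ha haW b hb hab => ?_
  · exact Finset.mem_inter.2 ⟨self_mem_branch B c, (Finset.mem_insert.1 (hBW hc)).resolve_left hcp⟩
  · refine (hW.closed a haW b hab).resolve_right ?_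
    rintro rfl
    exact hcp (eq_of_mem_branch hb hp).symm

/-- The part of `W` that is attached at `p` but not through the block `B`. -/
noncomputable def residue (G : SimpleGraph V) (B : Finset V) (p : V) (W : Finset V) : Finset V :=
  W \ (B.erase p).biUnion (branch G B)

theorem notMem_branch_of_residue {B : Finset V} {p c w : V} {W : Finset V}
    (hw : w ∈ residue G B p W) (hc : c ∈ B) (hcp : c ≠ p) : w ∉ branch G B c := fun h =>
  (Finset.mem_sdiff.1 hw).2 (Finset.mem_biUnion.2 ⟨c, Finset.mem_erase.2 ⟨hcp, hc⟩, h⟩)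

theorem residue_not_adj {B : Finset V} {p c w x : V} {W : Finset V} (hB : IsBlock G B)
    (hW : Hang G p W) (hw : w ∈ residue G B p W) (hc : c ∈ B) (hcp : c ≠ p)
    (hx : x ∈ branch G B c) : ¬ G.Adj w x := by
  intro h
  have hwc := notMem_branch_of_residue hw hc hcp
  have hwp : w ≠ p := fun h => hW.notMem (h ▸ (Finset.mem_sdiff.1 hw).1)
  have hwB : w ∉ B := fun h => notMem_branch_of_residue hw h hwp (self_mem_branch B w)
  by_cases hxc : x = c
  · subst hxc
    exact hwc (mem_branch_of_adj hwB h.symm)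
  · exact hwc (hB.branch_closed hc hx hxc h.symm)

/-- There are no edges between the residue and the branches at `B - p`, so the residue is attached
only through `p`, as `W` is. -/
theorem Hang.hang_residue {B : Finset V} {p : V} {W : Finset V} (hB : IsBlock G B)
    (hW : Hang G p W) (hBW : B ⊆ insert p W) : Hang G p (residue G B p W) where
  notMem h := hW.notMem (Finset.mem_sdiff.1 h).1
  closed a ha b hab := by
    rcases hW.closed a (Finset.mem_sdiff.1 ha).1 b hab with h | h
    · left
      refine Finset.mem_sdiff.2 ⟨h, fun hmem => ?_⟩
      obtain ⟨c, hc, hbc⟩ := Finset.mem_biUnion.1 hmem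
      rw [Finset.mem_erase] at hc
      exact residue_not_adj hB hW ha hc.2 hc.1 hbc hab
    · exact Or.inr h
  conn := by
    intro T hT hne hcl
    have hcl' : ∀ a ∈ T, a ≠ p → ∀ b ∈ insert p W, G.Adj a b → b ∈ T := by
      intro a ha hap b hb hab
      have haR := (Finset.mem_insert.1 (hT ha)).resolve_left hap
      refine hcl a ha b ?_ hab
      rw [Finset.mem_insert] at hb ⊢
      refine hb.imp_right fun hb => Finset.mem_sdiff.2 ⟨hb, fun hmem => ?_⟩
      obtain ⟨c, hc, hbc⟩ := Finset.mem_biUnion.1 hmem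
      rw [Finset.mem_erase] at hc
      exact residue_not_adj hB hW haR hc.2 hc.1 hbc hab
    have hTW : T ⊆ insert p W := hT.trans (Finset.insert_subset_insert _ Finset.sdiff_subset)
    by_cases hpT : p ∈ T
    · have h1 : insert p W ⊆ T ∪ (B.erase p).biUnion (branch G B) := by
        refine hW.conn.subset ⟨p, by simp [hpT]⟩ fun a _ ha b hb hab => ?_
        by_cases hbU : b ∈ (B.erase p).biUnion (branch G B)
        · exact Finset.mem_union_right _ hbU
        refine Finset.mem_union_left _ ?_
        rcases Finset.mem_union.1 ha with ha | ha
        · refine hcl a ha b ?_ hab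
          rw [Finset.mem_insert] at hb ⊢
          exact hb.imp_right fun hb => Finset.mem_sdiff.2 ⟨hb, hbU⟩
        · rw [Finset.mem_insert] at hb
          rcases hb with rfl | hb
          · exact hpT
          exfalso
          obtain ⟨c, hc, hac⟩ := Finset.mem_biUnion.1 ha
          rw [Finset.mem_erase] at hc
          exact residue_not_adj hB hW (Finset.mem_sdiff.2 ⟨hb, hbU⟩) hc.2 hc.1 hac hab.symm
      refine hT.antisymm fun x hx => ?_
      rcases Finset.mem_insert.1 hx with rfl | hx
      · exact hpT
      · rw [residue, Finset.mem_sdiff] at hx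
        exact (Finset.mem_union.1 (h1 (Finset.mem_insert_of_mem hx.1))).resolve_right hx.2
    · exfalso
      have := hW.conn T hTW hne fun a ha => hcl' a ha (fun h => hpT (h ▸ ha))
      exact hpT (this ▸ Finset.mem_insert_self p W)

theorem residue_subset {B : Finset V} {p : V} {W : Finset V} : residue G B p W ⊆ W :=
  Finset.sdiff_subset

theorem residue_card_lt {B : Finset V} {p : V} {W : Finset V} (hB : IsBlock G B)
    (hBW : B ⊆ insert p W) : (residue G B p W).card < W.card := by
  obtain ⟨b, hb⟩ : (B.erase p).Nonempty := by
    rw [← Finset.card_pos]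
    have := Finset.pred_card_le_card_erase (s := B) (a := p)
    have := hB.2.1
    omega
  rw [Finset.mem_erase] at hb
  refine Finset.card_lt_card ⟨residue_subset, fun h => ?_⟩
  have hbW := (Finset.mem_insert.1 (hBW hb.2)).resolve_left hb.1
  exact notMem_branch_of_residue (h hbW) hb.2 hb.1 (self_mem_branch B b)

/-- `W` is the disjoint union of the residue and the branches at `B - p`. Each branch is counted
without its vertex in `B`, which leaves |B| - 1 to pay for the degree of an interior vertex of `B`.
-/
theorem Hang.card_eq {B : Finset V} {p : V} {W : Finset V} (hB : IsBlock G B) (hW : Hang G p W)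
    (hp : p ∈ B) (hBW : B ⊆ insert p W) :
    (∑ c ∈ B.erase p, ((branch G B c).card - 1)) + (residue G B p W).card + (B.card - 1) =
      W.card := by
  have hsub : (B.erase p).biUnion (branch G B) ⊆ W := by
    rw [Finset.biUnion_subset]
    intro c hc
    rw [Finset.mem_erase] at hc
    exact hW.branch_subset hp hBW hc.2 hc.1
  have h1 := Finset.card_sdiff_add_card_eq_card hsub
  rw [Finset.card_biUnion (fun c hc d hd hcd => Finset.disjoint_left.2 fun x hx hx' =>
    hcd (hB.branch_unique (Finset.mem_of_mem_erase hc) (Finset.mem_of_mem_erase hd) hx hx'))] at h1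
  have h2 : ∑ c ∈ B.erase p, (branch G B c).card =
      ∑ c ∈ B.erase p, ((branch G B c).card - 1) + (B.card - 1) := by
    rw [← Finset.card_erase_of_mem hp, Finset.card_eq_sum_ones, ← Finset.sum_add_distrib]
    refine Finset.sum_congr rfl fun c _ => ?_
    have : 0 < (branch G B c).card := Finset.card_pos.2 ⟨c, self_mem_branch B c⟩
    omega
  rw [h2] at h1
  rw [residue]
  omega

/-- Pieces of the branches of a block and of the residue fit together. -/
theorem Hang.assemble {B : Finset V} {p : V} {W : Finset V} (hB : IsBlock G B) (hW : Hang G p W)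
    {S : V → Finset V} (hS : ∀ c ∈ B.erase p, S c ⊆ branch G B c)
    (h : ∀ c ∈ B.erase p, Piece G (S c) ((branch G B c).erase c) ((branch G B c).card - 1))
    (hR : Piece G (residue G B p W) (residue G B p W) (residue G B p W).card) :
    Piece G ((B.erase p).biUnion S ∪ residue G B p W)
      (((B.erase p).biUnion fun c => (branch G B c).erase c) ∪ residue G B p W)
      ((∑ c ∈ B.erase p, ((branch G B c).card - 1)) + (residue G B p W).card) := by
  have hd : ∀ c ∈ B.erase p, ∀ d ∈ B.erase p, c ≠ d →
      Disjoint (branch G B c) (branch G B d) := fun c hc d hd hcd =>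
    Finset.disjoint_left.2 fun x hx hx' =>
      hcd (hB.branch_unique (Finset.mem_of_mem_erase hc) (Finset.mem_of_mem_erase hd) hx hx')
  refine (piece_biUnion h ?_ ?_ ?_).union hR ?_ ?_ ?_
  · exact fun c hc d hd' hcd => (hd c hc d hd' hcd).mono (hS c hc) (hS d hd')
  · exact fun c hc d hd' hcd => (hd c hc d hd' hcd).mono (Finset.erase_subset _ _)
      (Finset.erase_subset _ _)
  · intro c hc d hd' hcd a ha b hb hab
    rw [Finset.mem_erase] at ha hb
    exact Finset.disjoint_left.1 (hd c hc d hd' hcd)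
      (hB.branch_closed (Finset.mem_of_mem_erase hc) ha.2 ha.1 hab) hb.2
  · rw [Finset.disjoint_biUnion_left]
    intro c hc
    refine Finset.disjoint_right.2 fun x hx hxS => ?_
    rw [Finset.mem_erase] at hc
    exact notMem_branch_of_residue hx hc.2 hc.1 (hS c (Finset.mem_erase.2 hc) hxS)
  · rw [Finset.disjoint_biUnion_left]
    intro c hc
    refine Finset.disjoint_right.2 fun x hx hxS => ?_
    rw [Finset.mem_erase] at hc
    exact notMem_branch_of_residue hx hc.2 hc.1 (Finset.mem_of_mem_erase hxS)
  · intro a ha b hb hab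
    obtain ⟨c, hc, hac⟩ := Finset.mem_biUnion.1 ha
    rw [Finset.mem_erase] at hc hac
    exact residue_not_adj hB hW hb hc.2 hc.1 hac.2 hab.symm

theorem interior_not_adj_branch {B : Finset V} (hB : IsBlock G B) {u c x : V}
    (hu : Interior G B u) (hc : c ∈ B) (hx : x ∈ branch G B c) (hxc : x ≠ c) :
    u ≠ x ∧ ¬ G.Adj u x := by
  constructor
  · rintro rfl
    exact hxc (eq_of_mem_branch hx hu.1)
  · intro h
    have := hB.branch_closed hc hx hxc h.symm
    rw [← eq_of_mem_branch this hu.1] at hx hxc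
    exact not_interior_of_branch hx hxc hu

/-- The surroundings of a hanging set. -/
def Context (G : SimpleGraph V) [DecidableRel G.Adj] (p : V) (W : Finset V) : Prop :=
  (∃ q ∉ W, G.Adj p q) ∧
    ((∃ u ∉ insert p W, (∀ w, G.Adj u w → w ∉ W) ∧
        G.degree u + 1 + (insert p W).card ≤ Fintype.card V) ∨
      ∀ B, IsProper G B → B ⊆ insert p W → ∀ c ∈ B, ∀ c' ∈ B, ¬ Interior G B c →
        ¬ Interior G B c' → c = c')

theorem Context.branch {p : V} {W B : Finset V} (h : Context G p W) (hB : IsBlock G B)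
    {c : V} (hc : c ∈ B) (hsub : branch G B c ⊆ W) :
    Context G c ((branch G B c).erase c) := by
  rw [Context, Finset.insert_erase (self_mem_branch B c)]
  refine ⟨?_, h.2.imp ?_ ?_⟩
  · obtain ⟨b, hb, hcb⟩ := hB.exists_adj hc
    refine ⟨b, fun hmem => hcb.ne ?_, hcb⟩
    exact (eq_of_mem_branch (Finset.mem_of_mem_erase hmem) hb).symm
  · rintro ⟨u, hu, hadj, hcard⟩
    refine ⟨u, fun hmem => hu (Finset.mem_insert_of_mem (hsub hmem)),
      fun w hw hmem => hadj w hw (hsub (Finset.mem_of_mem_erase hmem)), le_trans ?_ hcard⟩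
    have := Finset.card_le_card (hsub.trans (Finset.subset_insert p W))
    omega
  · exact fun h B' hB' hsub' => h B' hB' ((hsub'.trans hsub).trans (Finset.subset_insert _ _))

theorem Context.mono {p : V} {W W' : Finset V} (h : Context G p W) (hsub : W' ⊆ W) :
    Context G p W' := by
  have hins := Finset.insert_subset_insert p hsub
  refine ⟨?_, h.2.imp ?_ ?_⟩
  · obtain ⟨q, hq, hpq⟩ := h.1
    exact ⟨q, fun h => hq (hsub h), hpq⟩
  · rintro ⟨u, hu, hadj, hcard⟩
    have := Finset.card_le_card hins
    exact ⟨u, fun hmem => hu (hins hmem), fun w hw hmem => hadj w hw (hsub hmem), by omega⟩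
  · exact fun h B' hB' hsub' => h B' hB' (hsub'.trans hins)

/-- A vertex outside the core lies in a second block with an interior vertex. -/
theorem OreClass.exists_proper_ne (h : OreClass G δ D) (hδ : 2 ≤ δ) {p : V} {W B A : Finset V}
    (hB : IsProper G B) (hW : Hang G p W) (hctx : Context G p W) (hp : p ∈ B)
    (hpI : ¬ Interior G B p) (hBW : B ⊆ insert p W) (hAB : A ⊆ B.erase p)
    (hIA : ∀ u, Interior G B u → u ∈ A) {π : V → V} (hπA : ∀ v ∈ A, π v = v)
    (hπe : ∀ v ∈ B.erase p, ∀ w ∈ B.erase p, v ∉ A → G.Adj v w → π v = π w)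
    {z : V} (hz : z ∈ B.erase p) (hzA : z ∉ A) : ∃ C, IsProper G C ∧ z ∈ C ∧ C ≠ B := by
  by_contra hcon
  push Not at hcon
  rw [Finset.mem_erase] at hz
  have hzI : ¬ Interior G B z := fun hi => hzA (hIA z hi)
  -- If the blocks of `W ∪ {p}` with an interior vertex have at most one vertex that is not
  -- interior, then `z` and `p` already give a contradiction. Otherwise a remote vertex `u₁` takes
  -- part in the count.
  rcases hctx.2 with ⟨u₁, hu₁, hu₁W, hu₁c⟩ | hβ
  swap
  · exact hz.1 (hβ B hB hBW z hz.2 p hp hzI hpI)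
  obtain ⟨u₀, hu₀, hu₀z⟩ := h.exists_interior_ne hδ hB (π z)
  have hu₀A := hIA u₀ hu₀
  have hu₀p : u₀ ≠ p := fun h => hpI (h ▸ hu₀)
  have hzu₀ : ¬ G.Adj z u₀ := fun hadj => by
    have := hπe z (Finset.mem_erase.2 hz) u₀ (hAB hu₀A) hzA hadj
    rw [hπA u₀ hu₀A] at this
    exact hu₀z this.symm
  -- The vertices `u₀` and `u₁` compensate for leaving out `p` and `π z`, so at least deg z
  -- representatives remain. A vertex of `J` in `B` has the image `π z`, hence is outside `A`, not
  -- interior and not adjacent to `u₀`.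
  set J := G.neighborFinset z \ {p, π z} with hJdef
  have hJ : ∀ v ∈ J, G.Adj z v ∧ v ≠ p ∧ v ≠ π z := by
    intro v hv
    simpa [hJdef] using hv
  have hJB : ∀ v ∈ J, v ∈ B → v ∉ A ∧ ¬ Interior G B v ∧ ¬ G.Adj v u₀ := by
    intro v hv hvB
    obtain ⟨hzv, hvp, hvπ⟩ := hJ v hv
    have hvB' := Finset.mem_erase.2 ⟨hvp, hvB⟩
    have hπv := hπe z (Finset.mem_erase.2 hz) v hvB' hzA hzv
    have hvA : v ∉ A := fun hvA => hvπ (by rw [hπv, hπA v hvA])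
    refine ⟨hvA, fun hi => hvA (hIA v hi), fun hadj => hu₀z ?_⟩
    have := hπe v hvB' u₀ (hAB hu₀A) hvA hadj
    rw [hπA u₀ hu₀A] at this
    rw [hπv, this]
  have hch : ∀ v, ∃ C, v ∈ J →
      (IsBlock G C ∧ z ∈ C ∧ v ∈ C ∧ ¬ Interior G C v) ∧ (v ∈ B → C = B) := by
    intro v
    by_cases hv : v ∈ J
    · by_cases hvB : v ∈ B
      · exact ⟨B, fun _ => ⟨⟨hB.1, hz.2, hvB, (hJB v hv hvB).2.1⟩, fun _ => rfl⟩⟩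
      · obtain ⟨C, hC, hzC, hvC⟩ := exists_block_of_adj (hJ v hv).1
        exact ⟨C, fun _ => ⟨⟨hC, hzC, hvC, fun hi =>
          hvB (hcon C ⟨hC, v, hi⟩ hzC ▸ hvC)⟩, fun h => absurd h hvB⟩⟩
    · exact ⟨∅, fun h => absurd h hv⟩
  choose C hC using hch
  obtain ⟨r, hinj, hr, hzr, -, hind, hsum⟩ := exists_fan (J := J) (fun v hv => (hJ v hv).1)
    (fun v hv => (hC v hv).1)
  set X : V → Finset V := fun v => branch G (C v) v with hX
  -- location of the branches
  have hXW : ∀ v ∈ J, X v ⊆ W := by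
    intro v hv
    by_cases hvB : v ∈ B
    · simp only [hX, (hC v hv).2 hvB]
      exact hW.branch_subset hp hBW hvB (hJ v hv).2.1
    · exact (hB.1.subset_branch_of_meets hz.2 (conn_branch _ v) (hzr v hv) (self_mem_branch _ v)
        (mem_branch_of_adj hvB (hJ v hv).1)).trans (hW.branch_subset hp hBW hz.2 hz.1)
  have hXB : ∀ v ∈ J, ∀ x ∈ X v, x ∈ B → x = v := by
    intro v hv x hx hxB
    by_cases hvB : v ∈ B
    · simp only [hX, (hC v hv).2 hvB] at hx
      exact eq_of_mem_branch hx hxB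
    · have := hB.1.subset_branch_of_meets hz.2 (conn_branch _ v) (hzr v hv) (self_mem_branch _ v)
        (mem_branch_of_adj hvB (hJ v hv).1) hx
      exact absurd hx (eq_of_mem_branch this hxB ▸ hzr v hv)
  have hu₀X : ∀ v ∈ J, u₀ ∉ X v := by
    intro v hv hmem
    have := hXB v hv u₀ hmem hu₀.1
    exact (hJB v hv (this ▸ hu₀.1)).1 (this ▸ hu₀A)
  have hu₁X : ∀ v ∈ J, u₁ ∉ X v := fun v hv hmem =>
    hu₁ (Finset.mem_insert_of_mem (hXW v hv hmem))
  have hru₀ : ∀ v ∈ J, r v ≠ u₀ ∧ ¬ G.Adj (r v) u₀ := fun v hv =>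
    ⟨fun h => hu₀X v hv (h ▸ (hr v hv).1), fun h => hu₀X v hv ((hr v hv).2 _ h)⟩
  have hru₁ : ∀ v ∈ J, r v ≠ u₁ ∧ ¬ G.Adj (r v) u₁ := fun v hv =>
    ⟨fun h => hu₁X v hv (h ▸ (hr v hv).1), fun h => hu₁X v hv ((hr v hv).2 _ h)⟩
  have hu₀W : u₀ ∈ W := (Finset.mem_insert.1 (hBW hu₀.1)).resolve_left hu₀p
  have hzW : z ∈ W := (Finset.mem_insert.1 (hBW hz.2)).resolve_left hz.1
  have hu₀u₁ : u₀ ≠ u₁ ∧ ¬ G.Adj u₁ u₀ :=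
    ⟨fun h => hu₁ (h ▸ Finset.mem_insert_of_mem hu₀W), fun h => hu₁W _ h hu₀W⟩
  have hzu₁ : z ≠ u₁ ∧ ¬ G.Adj u₁ z :=
    ⟨fun h => hu₁ (h ▸ Finset.mem_insert_of_mem hzW), fun h => hu₁W _ h hzW⟩
  have hni₀ : u₀ ∉ J.image r := by
    simp only [Finset.mem_image, not_exists, not_and]
    exact fun v hv => (hru₀ v hv).1
  have hni₁ : u₁ ∉ insert u₀ (J.image r) := by
    simp only [Finset.mem_insert, Finset.mem_image, not_or, not_exists, not_and]
    exact ⟨hu₀u₁.1.symm, fun v hv => (hru₁ v hv).1⟩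
  have hcount := h.card_le_sum hδ (z := z) (U := insert u₁ (insert u₀ (J.image r))) (by
      simp only [Finset.mem_insert, Finset.mem_image]
      rintro u (rfl | rfl | ⟨v, hv, rfl⟩) w (rfl | rfl | ⟨w, hw, rfl⟩)
      · exact fun h => h.ne rfl
      · exact hu₀u₁.2
      · exact fun h => (hru₁ w hw).2 h.symm
      · exact fun h => hu₀u₁.2 h.symm
      · exact fun h => h.ne rfl
      · exact fun h => (hru₀ w hw).2 h.symm
      · exact (hru₁ v hv).2
      · exact (hru₀ v hv).2
      · exact hind v hv w hw) (by
      simp only [Finset.mem_insert, Finset.mem_image]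
      rintro u (rfl | rfl | ⟨v, hv, rfl⟩)
      · exact ⟨hzu₁.1, fun h => hzu₁.2 h.symm⟩
      · exact ⟨fun h => hzA (h ▸ hu₀A), hzu₀⟩
      · exact ⟨fun h => hzr v hv (h ▸ (hr v hv).1), fun h => hzr v hv ((hr v hv).2 _ h.symm)⟩) (by
      rw [Finset.card_insert_of_notMem hni₁, Finset.card_insert_of_notMem hni₀,
        Finset.card_image_of_injOn hinj]
      have h1 := Finset.le_card_sdiff {p, π z} (G.neighborFinset z)
      rw [G.card_neighborFinset_eq_degree, ← hJdef] at h1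
      have h2 := Finset.card_le_two (a := p) (b := π z)
      omega)
  rw [Finset.sum_insert hni₁, Finset.sum_insert hni₀, Finset.sum_image hinj] at hcount
  -- the disjoint sets inside `W`
  set N := insert u₀ ((G.neighborFinset u₀).erase p) with hN
  have hNc : G.degree u₀ ≤ N.card := by
    rw [hN, Finset.card_insert_of_notMem (by simp)]
    have := Finset.pred_card_le_card_erase (s := G.neighborFinset u₀) (a := p)
    rw [G.card_neighborFinset_eq_degree] at this
    omega
  have hNB : ∀ x ∈ N, x ∈ B.erase p ∧ (x = u₀ ∨ G.Adj u₀ x) := by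
    intro x hx
    simp only [hN, Finset.mem_insert, Finset.mem_erase, SimpleGraph.mem_neighborFinset] at hx
    rcases hx with rfl | ⟨hxp, hx⟩
    · exact ⟨hAB hu₀A, Or.inl rfl⟩
    · exact ⟨Finset.mem_erase.2 ⟨hxp, hu₀.2 x hx⟩, Or.inr hx⟩
  have hdis : Disjoint (J.biUnion X) N := by
    rw [Finset.disjoint_biUnion_left]
    refine fun v hv => Finset.disjoint_left.2 fun x hx hxN => ?_
    obtain ⟨hxB, hxu⟩ := hNB x hxN
    have hxv := hXB v hv x hx (Finset.mem_of_mem_erase hxB)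
    subst hxv
    have hvB := hJB x hv (Finset.mem_of_mem_erase hxB)
    rcases hxu with rfl | hxu
    · exact hvB.1 hu₀A
    · exact hvB.2.2 hxu.symm
  have hsubW : J.biUnion X ∪ N ⊆ W.erase z := by
    refine Finset.union_subset ?_ ?_
    · rw [Finset.biUnion_subset]
      exact fun v hv x hx => Finset.mem_erase.2 ⟨fun h => hzr v hv (h ▸ hx), hXW v hv hx⟩
    · intro x hx
      obtain ⟨hxB, hxu⟩ := hNB x hx
      rw [Finset.mem_erase] at hxB
      refine Finset.mem_erase.2 ⟨?_, (Finset.mem_insert.1 (hBW hxB.2)).resolve_left hxB.1⟩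
      rintro rfl
      rcases hxu with hxu | hxu
      · exact hzA (hxu ▸ hu₀A)
      · exact hzu₀ hxu.symm
  -- The branches and the closed neighbourhood of `u₀` without `p` are disjoint in `W - z`.
  -- Restoring `p` adds at most one, and deg u₁ + 1 ≤ |V| - |W| - 1, so the total is below |V|.
  have hle := Finset.card_le_card hsubW
  rw [Finset.card_union_of_disjoint hdis, Finset.card_erase_of_mem hzW] at hle
  rw [Finset.card_insert_of_notMem hW.notMem] at hu₁c
  have : 0 < W.card := Finset.card_pos.2 ⟨z, hzW⟩
  omega

/-- Sets hanging at a vertex `p` are covered by pieces, without `p`, and also together with `p` when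
`p` lies in a block of `W ∪ {p}` that has an interior vertex. -/
theorem OreClass.piece_of_hang (h : OreClass G δ D) (hδ : 3 ≤ δ)
    (hsmall : ∀ B, IsBlock G B → B.card < δ + D) :
    ∀ (n : ℕ) (p : V) (W : Finset V), W.card = n → Hang G p W → Context G p W →
      Piece G W W W.card ∧
        ((∃ B, IsProper G B ∧ p ∈ B ∧ B ⊆ insert p W) → Piece G (insert p W) W W.card) := by
  intro n
  induction n using Nat.strong_induction_on with
  | _ n ih =>
  intro p W hn hW hctx
  have hch : ∀ B, IsBlock G B → p ∈ B → B ⊆ insert p W → ∀ c ∈ B.erase p,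
      Piece G ((branch G B c).erase c) ((branch G B c).erase c) ((branch G B c).card - 1) ∧
      ((∃ C, IsProper G C ∧ c ∈ C ∧ C ≠ B) →
        Piece G (branch G B c) ((branch G B c).erase c) ((branch G B c).card - 1)) := by
    intro B hB hp hBW c hc
    rw [Finset.mem_erase] at hc
    have hsub := hW.branch_subset hp hBW hc.2 hc.1
    have h1 := ih _ (by
      rw [← hn]
      exact (Finset.card_lt_card (Finset.erase_ssubset (self_mem_branch B c))).trans_le
        (Finset.card_le_card hsub)) c _ rfl (hB.hang hc.2) (hctx.branch hB hc.2 hsub)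
    rw [Finset.insert_erase (self_mem_branch B c),
      Finset.card_erase_of_mem (self_mem_branch B c)] at h1
    refine ⟨h1.1, fun ⟨C, hC, hcC, hne⟩ => h1.2 ⟨C, hC, hcC, ?_⟩⟩
    exact hB.block_subset_branch hC.1 hne hc.2 hcC
  have hres : ∀ B, IsBlock G B → p ∈ B → B ⊆ insert p W →
      Piece G (residue G B p W) (residue G B p W) (residue G B p W).card := fun B hB hp hBW =>
    (ih _ (hn ▸ residue_card_lt hB hBW) p _ rfl (hW.hang_residue hB hBW)
      (hctx.mono residue_subset)).1
  have hpI : ∀ B, p ∈ B → B ⊆ insert p W → ¬ Interior G B p := by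
    intro B hp hBW hi
    obtain ⟨q, hq, hpq⟩ := hctx.1
    exact hq ((Finset.mem_insert.1 (hBW (hi.2 q hpq))).resolve_left hpq.ne')
  have hcov : ∀ B, IsBlock G B → p ∈ B → B ⊆ insert p W → ∀ x, x ∈ W ↔
      (∃ c ∈ B.erase p, x ∈ branch G B c) ∨ x ∈ residue G B p W := by
    intro B hB hp hBW x
    constructor
    · intro hx
      by_cases hmem : x ∈ (B.erase p).biUnion (branch G B)
      · exact Or.inl (by simpa only [Finset.mem_biUnion] using hmem)
      · exact Or.inr (Finset.mem_sdiff.2 ⟨hx, hmem⟩)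
    · rintro (⟨c, hc, hx⟩ | hx)
      · rw [Finset.mem_erase] at hc
        exact hW.branch_subset hp hBW hc.2 hc.1 hx
      · exact residue_subset hx
  have hWsub : ∀ B, IsBlock G B → p ∈ B → B ⊆ insert p W →
      ((B.erase p).biUnion fun c => (branch G B c).erase c) ∪ residue G B p W ⊆ W := by
    intro B hB hp hBW
    refine Finset.union_subset ?_ residue_subset
    rw [Finset.biUnion_subset]
    intro c hc
    rw [Finset.mem_erase] at hc
    exact (Finset.erase_subset _ _).trans (hW.branch_subset hp hBW hc.2 hc.1)
  -- adding a part inside a proper block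
  have hadd : ∀ B, IsProper G B → p ∈ B → B ⊆ insert p W → ∀ (A : Finset V) (S : V → Finset V),
      A ⊆ B → NS G A → 3 ≤ A.card → (∀ c ∈ B.erase p, S c ⊆ branch G B c) →
      (∀ c ∈ B.erase p, c ∈ A → c ∉ S c) →
      (∀ c ∈ B.erase p, Piece G (S c) ((branch G B c).erase c) ((branch G B c).card - 1)) →
      Piece G (A ∪ ((B.erase p).biUnion S ∪ residue G B p W)) W W.card := by
    intro B hB hp hBW A S hAB hA hA3 hS hAS hP
    obtain ⟨u, hu⟩ := hB.2
    have hup : u ≠ p := fun he => hpI B hp hBW (he ▸ hu)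
    have huW : u ∈ W := (Finset.mem_insert.1 (hBW hu.1)).resolve_left hup
    have h1 := hW.assemble hB.1 hS hP (hres B hB.1 hp hBW)
    refine ((piece_single hA hA3 u).union h1 ?_ ?_ ?_).mono ?_ ?_
    · rw [Finset.disjoint_union_right, Finset.disjoint_biUnion_right]
      refine ⟨fun c hc => Finset.disjoint_left.2 fun x hxA hxS => ?_,
        Finset.disjoint_left.2 fun x hxA hxR => ?_⟩
      · have := eq_of_mem_branch (hS c hc hxS) (hAB hxA)
        subst this
        exact hAS x hc hxA hxS
      · have hxp : x ≠ p := fun he => hW.notMem (he ▸ residue_subset hxR)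
        exact notMem_branch_of_residue hxR (hAB hxA) hxp (self_mem_branch B x)
    · rw [Finset.disjoint_singleton_left, Finset.mem_union, Finset.mem_biUnion]
      rintro (⟨c, hc, hx⟩ | hx)
      · rw [Finset.mem_erase] at hx
        exact (interior_not_adj_branch hB.1 hu (Finset.mem_of_mem_erase hc) hx.2 hx.1).1 rfl
      · exact notMem_branch_of_residue hx hu.1 hup (self_mem_branch B u)
    · intro a ha b hb
      rw [Finset.mem_singleton] at ha
      subst ha
      rcases Finset.mem_union.1 hb with hb | hb
      · obtain ⟨c, hc, hx⟩ := Finset.mem_biUnion.1 hb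
        rw [Finset.mem_erase] at hx
        exact (interior_not_adj_branch hB.1 hu (Finset.mem_of_mem_erase hc) hx.2 hx.1).2
      · exact fun hab => residue_not_adj hB.1 hW hb hu.1 hup (self_mem_branch B a) hab.symm
    · exact Finset.union_subset (Finset.singleton_subset_iff.2 huW) (hWsub B hB.1 hp hBW)
    · have h2 := hW.card_eq hB.1 hp hBW
      have h3 := degree_lt_card hu.1 hu.2
      omega
  constructor
  · by_cases hWe : W = ∅
    · subst hWe; exact piece_empty
    obtain ⟨b, hbW, hpb⟩ : ∃ b ∈ W, G.Adj p b := by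
      by_contra hcon
      push Not at hcon
      have := hW.conn {p} (by simp) ⟨p, by simp⟩ (by
        intro a ha b hb hab
        rw [Finset.mem_singleton] at ha ⊢
        subst ha
        exact (Finset.mem_insert.1 hb).resolve_right fun hb => hcon b hb hab)
      refine hWe (Finset.eq_empty_of_forall_notMem fun x hx => ?_)
      have hx' : x ∈ ({p} : Finset V) := this ▸ Finset.mem_insert_of_mem hx
      rw [Finset.mem_singleton] at hx'
      exact hW.notMem (hx' ▸ hx)
    obtain ⟨B, hB, hp, hb⟩ := exists_block_of_adj hpb
    have hBW : B ⊆ insert p W := by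
      have : B.erase p ⊆ W := (hB.1.2 p).subset
        ⟨b, Finset.mem_inter.2 ⟨Finset.mem_erase.2 ⟨hpb.ne', hb⟩, hbW⟩⟩ fun a _ haW c hc hac =>
          (hW.closed a haW c hac).resolve_right (Finset.mem_erase.1 hc).1
      rw [← Finset.insert_erase hp]
      exact Finset.insert_subset_insert _ this
    -- A block with an interior vertex contributes its core; each vertex of `B - p` outside the core
    -- lies in another such block and is covered inside its own branch. A block without interior
    -- vertices contributes no part, and all vertices of `B - p` are left to their branches.
    by_cases hI : ∃ u, Interior G B u
    · obtain ⟨A, hAB, hIA, hA, hA3, π, hπA, -, hπe⟩ :=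
        h.exists_core hδ ⟨hB, hI⟩ (hsmall B hB) hp (hpI B hp hBW)
      have h1 := hadd B ⟨hB, hI⟩ hp hBW A
        (fun c => if c ∈ A then (branch G B c).erase c else branch G B c)
        (hAB.trans (Finset.erase_subset _ _)) hA hA3 (by
          intro c _
          split_ifs
          · exact Finset.erase_subset _ _
          · exact Finset.Subset.refl _) (by
          intro c _ hcA
          rw [if_pos hcA]
          exact Finset.notMem_erase _ _) (by
          intro c hc
          split_ifs with hcA
          · exact (hch B hB hp hBW c hc).1
          · exact (hch B hB hp hBW c hc).2 (h.exists_proper_ne (by omega) ⟨hB, hI⟩ hW hctx hp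
              (hpI B hp hBW) hBW hAB hIA hπA hπe hc hcA))
      convert h1 using 1
      ext x
      rw [hcov B hB hp hBW]
      simp only [Finset.mem_union, Finset.mem_biUnion]
      constructor
      · rintro (⟨c, hc, hx⟩ | hx)
        · by_cases hxA : x ∈ A
          · exact Or.inl hxA
          · refine Or.inr (Or.inl ⟨c, hc, ?_⟩)
            split_ifs with hcA
            · exact Finset.mem_erase.2 ⟨fun he => hxA (he ▸ hcA), hx⟩
            · exact hx
        · exact Or.inr (Or.inr hx)
      · rintro (hx | ⟨c, hc, hx⟩ | hx)
        · exact Or.inl ⟨x, hAB hx, self_mem_branch B x⟩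
        · refine Or.inl ⟨c, hc, ?_⟩
          split_ifs at hx
          · exact Finset.mem_of_mem_erase hx
          · exact hx
        · exact Or.inr hx
    · have h1 := hW.assemble hB (S := branch G B) (fun c _ => Finset.Subset.refl _) (by
        intro c hc
        obtain ⟨C, hC, hcC⟩ := h.exists_proper (by omega) c
        exact (hch B hB hp hBW c hc).2 ⟨C, hC, hcC, fun he => hI (he ▸ hC.2)⟩)
        (hres B hB hp hBW)
      have h2 := h1.mono (hWsub B hB hp hBW) (m' := W.card) (by
        have := hW.card_eq hB hp hBW
        omega)
      convert h2 using 1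
      ext x
      rw [hcov B hB hp hBW]
      simp only [Finset.mem_union, Finset.mem_biUnion]
  -- With `p` included, the whole block is a part, and every branch is covered without its vertex in
  -- `B`.
  · rintro ⟨B, hB, hp, hBW⟩
    have hB3 : 3 ≤ B.card := by
      obtain ⟨u, hu⟩ := hB.2
      have := degree_lt_card hu.1 hu.2
      have := h.min_le u
      omega
    have h1 := hadd B hB hp hBW B (fun c => (branch G B c).erase c) (Finset.Subset.refl _)
      hB.1.1 hB3 (fun c _ => Finset.erase_subset _ _) (fun c _ _ => Finset.notMem_erase _ _)
      fun c hc => (hch B hB.1 hp hBW c hc).1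
    convert h1 using 1
    ext x
    rw [Finset.mem_insert, hcov B hB.1 hp hBW]
    simp only [Finset.mem_union, Finset.mem_biUnion]
    constructor
    · rintro (rfl | ⟨c, hc, hx⟩ | hx)
      · exact Or.inl hp
      · by_cases hxc : x = c
        · exact Or.inl (hxc ▸ Finset.mem_of_mem_erase hc)
        · exact Or.inr (Or.inl ⟨c, hc, Finset.mem_erase.2 ⟨hxc, hx⟩⟩)
      · exact Or.inr (Or.inr hx)
    · rintro (hx | ⟨c, hc, hx⟩ | hx)
      · by_cases hxp : x = p
        · exact Or.inl hxp
        · exact Or.inr (Or.inl ⟨x, Finset.mem_erase.2 ⟨hxp, hx⟩, self_mem_branch B x⟩)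
      · exact Or.inr (Or.inl ⟨c, hc, Finset.mem_of_mem_erase hx⟩)
      · exact Or.inr (Or.inr hx)

/-- A connected component is covered by pieces. -/
theorem OreClass.piece_component (h : OreClass G δ D) (hδ : 3 ≤ δ)
    (hsmall : ∀ B, IsBlock G B → B.card < δ + D) {C : Finset V} (hC : Conn G C)
    (hcl : ∀ a ∈ C, ∀ b, G.Adj a b → b ∈ C) (hne : C.Nonempty) : Piece G C C (C.card - 1) := by
  -- a block with an interior vertex, with two non-interior vertices if possible
  obtain ⟨R, hR, hRC, hmax⟩ : ∃ R, IsProper G R ∧ R ⊆ C ∧ 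
      ((∃ c ∈ R, ∃ c' ∈ R, c ≠ c' ∧ ¬ Interior G R c ∧ ¬ Interior G R c') ∨
      ∀ B, IsProper G B → B ⊆ C → ∀ c ∈ B, ∀ c' ∈ B, ¬ Interior G B c →
        ¬ Interior G B c' → c = c') := by
    by_cases hex : ∃ R, IsProper G R ∧ R ⊆ C ∧
        ∃ c ∈ R, ∃ c' ∈ R, c ≠ c' ∧ ¬ Interior G R c ∧ ¬ Interior G R c'
    · obtain ⟨R, h1, h2, h3⟩ := hex
      exact ⟨R, h1, h2, Or.inl h3⟩
    · push Not at hex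
      obtain ⟨r, hr⟩ := hne
      obtain ⟨R, hR, hrR⟩ := h.exists_proper (by omega) r
      refine ⟨R, hR, hR.1.1.1.subset ⟨r, by simp [hr, hrR]⟩ fun a _ ha b _ hab => hcl a ha b hab,
        Or.inr fun B hB hBC c hc c' hc' hcI hc'I => ?_⟩
      by_contra hcc
      exact hc'I (hex B hB hBC c hc c' hc' hcc hcI)
  obtain ⟨u, hu⟩ := hR.2
  have hW : Hang G u (C.erase u) := by
    refine ⟨Finset.notMem_erase _ _, fun a ha b hab => ?_, ?_⟩
    · have := hcl a (Finset.mem_of_mem_erase ha) b hab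
      rw [Finset.mem_erase]
      tauto
    · rwa [Finset.insert_erase (hRC hu.1)]
  have hRW : R ⊆ insert u (C.erase u) := by rwa [Finset.insert_erase (hRC hu.1)]
  have hR3 : 3 ≤ R.card := by
    have := degree_lt_card hu.1 hu.2
    have := h.min_le u
    omega
  have hres : residue G R u (C.erase u) = ∅ := by
    by_contra hne
    obtain ⟨x, hx⟩ := Finset.nonempty_iff_ne_empty.2 hne
    have hH := hW.hang_residue hR.1 hRW
    have := hH.conn {u} (by simp) ⟨u, by simp⟩ (by
      intro a ha b hb hab
      rw [Finset.mem_singleton] at ha ⊢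
      subst ha
      refine (Finset.mem_insert.1 hb).resolve_right fun hb => ?_
      exact notMem_branch_of_residue hb (hu.2 b hab) hab.ne' (self_mem_branch R b))
    have hx' : x ∈ ({u} : Finset V) := this ▸ Finset.mem_insert_of_mem hx
    rw [Finset.mem_singleton] at hx'
    exact hH.notMem (hx' ▸ hx)
  have hP : ∀ c ∈ R.erase u, Piece G ((branch G R c).erase c) ((branch G R c).erase c)
      ((branch G R c).card - 1) := by
    intro c hc
    rw [Finset.mem_erase] at hc
    have hsub : branch G R c ⊆ C :=
      (hW.branch_subset hu.1 hRW hc.2 hc.1).trans (Finset.erase_subset _ _)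
    by_cases hcI : Interior G R c
    · have : (branch G R c).erase c = ∅ := by
        by_contra hne
        obtain ⟨x, hx⟩ := Finset.nonempty_iff_ne_empty.2 hne
        rw [Finset.mem_erase] at hx
        exact not_interior_of_branch hx.2 hx.1 hcI
      rw [this]
      exact piece_empty.mono (Finset.Subset.refl _) (Nat.zero_le _)
    rw [← Finset.card_erase_of_mem (self_mem_branch R c)]
    refine (h.piece_of_hang hδ hsmall _ c _ rfl (hR.1.hang hc.2) ?_).1
    rw [Context, Finset.insert_erase (self_mem_branch R c)]
    refine ⟨?_, ?_⟩
    · obtain ⟨b, hb, hcb⟩ := hR.1.exists_adj hc.2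
      refine ⟨b, fun hmem => hcb.ne ?_, hcb⟩
      exact (eq_of_mem_branch (Finset.mem_of_mem_erase hmem) hb).symm
    -- A second vertex `d` of `R` that is not interior supplies the remote vertex required by
    -- `Context`: any vertex other than `d` in the branch at `d`.
    rcases hmax with ⟨c₁, hc₁, c₂, hc₂, hne, hI₁, hI₂⟩ | hβ
    · left
      obtain ⟨d, hd, hdc, hdI⟩ : ∃ d ∈ R, d ≠ c ∧ ¬ Interior G R d := by
        by_cases hcc : c₁ = c
        · exact ⟨c₂, hc₂, fun he => hne (hcc.trans he.symm), hI₂⟩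
        · exact ⟨c₁, hc₁, hcc, hI₁⟩
      obtain ⟨w, hw, hwd⟩ := exists_of_not_interior hd hdI
      have hdis : Disjoint (branch G R d) (branch G R c) :=
        Finset.disjoint_left.2 fun x hx hx' => hdc (hR.1.branch_unique hd hc.2 hx hx')
      have hwcl : ∀ x, G.Adj w x → x ∈ branch G R d := fun x hx =>
        hR.1.branch_closed hd hw hwd hx
      refine ⟨w, Finset.disjoint_left.1 hdis hw, fun x hx hmem =>
        Finset.disjoint_left.1 hdis (hwcl x hx) (Finset.mem_of_mem_erase hmem), ?_⟩
      have h1 := degree_lt_card hw hwcl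
      have h2 := Finset.card_le_univ (branch G R d ∪ branch G R c)
      rw [Finset.card_union_of_disjoint hdis] at h2
      omega
    · exact Or.inr fun B hB hBsub => hβ B hB (hBsub.trans hsub)
  have h1 := hW.assemble hR.1 (S := fun c => (branch G R c).erase c)
    (fun c _ => Finset.erase_subset _ _) hP (by rw [hres]; exact piece_empty)
  have hcard := hW.card_eq hR.1 hu.1 hRW
  rw [hres, Finset.union_empty, Finset.card_empty, Nat.add_zero] at h1
  rw [hres, Finset.card_empty, Nat.add_zero, Finset.card_erase_of_mem (hRC hu.1)] at hcard
  have h2 := ((piece_single hR.1.1 hR3 u).union h1 (by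
    rw [Finset.disjoint_biUnion_right]
    refine fun c hc => Finset.disjoint_left.2 fun x hxR hx => ?_
    rw [Finset.mem_erase] at hx
    exact hx.1 (eq_of_mem_branch hx.2 hxR)) (by
    rw [Finset.disjoint_singleton_left, Finset.mem_biUnion]
    rintro ⟨c, hc, hx⟩
    rw [Finset.mem_erase] at hx
    exact (interior_not_adj_branch hR.1 hu (Finset.mem_of_mem_erase hc) hx.2 hx.1).1 rfl) (by
    intro a ha b hb
    rw [Finset.mem_singleton] at ha
    subst ha
    obtain ⟨c, hc, hx⟩ := Finset.mem_biUnion.1 hb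
    rw [Finset.mem_erase] at hx
    exact (interior_not_adj_branch hR.1 hu (Finset.mem_of_mem_erase hc) hx.2 hx.1).2)).mono
    (W' := C) (m' := C.card - 1) ?_ ?_
  · convert h2 using 1
    ext x
    simp only [Finset.mem_union, Finset.mem_biUnion]
    constructor
    · intro hx
      by_cases hxu : x = u
      · exact Or.inl (hxu ▸ hu.1)
      have : x ∈ (R.erase u).biUnion (branch G R) := by
        by_contra hmem
        have : x ∈ residue G R u (C.erase u) :=
          Finset.mem_sdiff.2 ⟨Finset.mem_erase.2 ⟨hxu, hx⟩, hmem⟩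
        rw [hres] at this
        simp at this
      obtain ⟨c, hc, hxc⟩ := Finset.mem_biUnion.1 this
      by_cases hxc' : x = c
      · exact Or.inl (hxc' ▸ Finset.mem_of_mem_erase hc)
      · exact Or.inr ⟨c, hc, Finset.mem_erase.2 ⟨hxc', hxc⟩⟩
    · rintro (hx | ⟨c, hc, hx⟩)
      · exact hRC hx
      · rw [Finset.mem_erase] at hc hx
        exact Finset.mem_of_mem_erase (hW.branch_subset hu.1 hRW hc.2 hc.1 hx.2)
  · refine Finset.union_subset (Finset.singleton_subset_iff.2 (hRC hu.1)) ?_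
    rw [Finset.biUnion_subset]
    intro c hc x hx
    rw [Finset.mem_erase] at hc hx
    exact Finset.mem_of_mem_erase (hW.branch_subset hu.1 hRW hc.2 hc.1 hx.2)
  · have := degree_lt_card hu.1 hu.2
    omega

theorem OreClass.piece_closed (h : OreClass G δ D) (hδ : 3 ≤ δ)
    (hsmall : ∀ B, IsBlock G B → B.card < δ + D) :
    ∀ (n : ℕ) (S : Finset V), S.card = n → (∀ a ∈ S, ∀ b, G.Adj a b → b ∈ S) →
      Piece G S S (S.card - 1) := by
  intro n
  induction n using Nat.strong_induction_on with
  | _ n ih =>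
  intro S hn hcl
  by_cases hne : S.Nonempty
  swap
  · rw [Finset.not_nonempty_iff_eq_empty] at hne
    subst hne
    exact piece_empty
  obtain ⟨r, hr⟩ := hne
  have hCS := comp_subset (G := G) S r
  have hrC := self_mem_comp (G := G) hr
  have hCcl : ∀ a ∈ comp G S r, ∀ b, G.Adj a b → b ∈ comp G S r := fun a ha b hab =>
    comp_closed ha (hcl a (hCS ha) b hab) hab
  have h1 := h.piece_component hδ hsmall (conn_comp S r) hCcl ⟨r, hrC⟩
  have hadj : ∀ a ∈ comp G S r, ∀ b ∈ S \ comp G S r, ¬ G.Adj a b := fun a ha b hb hab =>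
    (Finset.mem_sdiff.1 hb).2 (hCcl a ha b hab)
  have h2 := ih (S \ comp G S r).card
    (hn ▸ Finset.card_lt_card (Finset.sdiff_ssubset hCS ⟨r, hrC⟩)) _ rfl (by
      intro a ha b hab
      rw [Finset.mem_sdiff] at ha
      refine Finset.mem_sdiff.2 ⟨hcl a ha.1 b hab, fun hb => ?_⟩
      exact ha.2 (hCcl b hb a hab.symm))
  have h3 := h1.union h2 Finset.disjoint_sdiff Finset.disjoint_sdiff hadj
  rw [Finset.union_sdiff_of_subset hCS] at h3
  refine h3.mono (Finset.Subset.refl _) ?_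
  have h4 := Finset.card_sdiff_add_card_eq_card hCS
  have : 0 < (comp G S r).card := Finset.card_pos.2 ⟨r, hrC⟩
  omega

/-- `G` has a partition into non-separable sets, with the bound on their number given by a degree
sum `σ`. -/
def Good (G : SimpleGraph V) (σ : ℕ) : Prop :=
  ∃ P, IsCover G P Finset.univ ∧ (P.card ≤ 1 ∨ P.card * σ ≤ 2 * (Fintype.card V - 1))

theorem OreClass.good_of_small_blocks (h : OreClass G δ D) (hδ : 3 ≤ δ)
    (hsmall : ∀ B, IsBlock G B → B.card < δ + D) : Good G (δ + D) := by
  obtain ⟨P, U, hP, -, hc, hi, hs⟩ := h.piece_closed hδ hsmall _ Finset.univ rfl (by simp)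
  refine ⟨P, hP, ?_⟩
  by_cases h1 : P.card ≤ 1
  · exact Or.inl h1
  · right
    have h2 := card_mul_le_two_mul_sum h.ore hi (by omega)
    have h3 := Nat.mul_le_mul_right (δ + D) hc
    rw [Finset.card_univ] at hs
    omega

end SmallBlocks

/-! ### Graphs with a vertex of degree two -/

section DegreeTwo

variable {V : Type*} [DecidableEq V] [Fintype V] {G : SimpleGraph V} [DecidableRel G.Adj]
variable {D : ℕ}

/-- `f` identifies `G` with the graph given by the adjacency table `E`, up to the pairs marked as
optional by the table `O`. -/
def Models (G : SimpleGraph V) {ι : Type*} (E O : ι → ι → Bool) : Prop :=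
  ∃ f : ι → V, Function.Bijective f ∧
    ∀ i j, O i j = false → (G.Adj (f i) (f j) ↔ E i j = true)

/-- The adjacency table of `F5`. -/
def tableF5 (i j : Fin 5) : Bool :=
  (i = 0 && j != 0) || (j = 0 && i != 0) || (i = 1 && j = 2) || (i = 2 && j = 1) ||
    (i = 3 && j = 4) || (i = 4 && j = 3)

/-- The adjacency table of `H s t`. -/
def tableH (s t : ℕ) : HVertex s t → HVertex s t → Bool
  | Sum.inl i, Sum.inl j => (i = 0 && (j = 2 || j = 3)) || (j = 0 && (i = 2 || i = 3)) ||
      (i = 2 && j = 3) || (i = 3 && j = 2)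
  | Sum.inl i, Sum.inr _ => i = 0 || i = 1
  | Sum.inr _, Sum.inl i => i = 0 || i = 1
  | Sum.inr (Sum.inl i), Sum.inr (Sum.inl j) => i != j
  | Sum.inr (Sum.inr i), Sum.inr (Sum.inr j) => i != j
  | Sum.inr (Sum.inl _), Sum.inr (Sum.inr _) => false
  | Sum.inr (Sum.inr _), Sum.inr (Sum.inl _) => false

/-- The pair of vertices on which `H s t` and `HMinus s t` differ. -/
def optionalH (s t : ℕ) : HVertex s t → HVertex s t → Bool
  | Sum.inl i, Sum.inl j => (i = 0 && j = 1) || (i = 1 && j = 0)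
  | _, _ => false

/-- If `S - c` split into `T₁` and `T₂`, a vertex of `Tᵢ` would have at most |Tᵢ| neighbours in `S`,
or at most |Tᵢ| - 1 if `c ∉ S`. Either way two vertices from different sides have degree sum below
|S|. -/
theorem ns_of_ore {S : Finset V} (h : ∀ u ∈ S, ∀ w ∈ S, u ≠ w → ¬ G.Adj u w →
    S.card ≤ (G.neighborFinset u ∩ S).card + (G.neighborFinset w ∩ S).card) : NS G S := by
  have key : ∀ c, Conn G (S.erase c) := by
    intro c
    by_contra hc
    obtain ⟨T₁, T₂, ⟨u, hu⟩, ⟨w, hw⟩, hdis, hun, hadj⟩ := exists_split hc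
    have hsub : ∀ a ∈ T₁ ∪ T₂, a ∈ S := fun a ha => Finset.mem_of_mem_erase (hun ▸ ha)
    have hne : u ≠ w := fun h => Finset.disjoint_left.1 hdis hu (h ▸ hw)
    have h1 := h u (hsub u (Finset.mem_union_left _ hu)) w (hsub w (Finset.mem_union_right _ hw))
      hne (hadj u hu w hw)
    have hcard := congrArg Finset.card hun
    rw [Finset.card_union_of_disjoint hdis] at hcard
    have hside : ∀ T T' : Finset V, T ∪ T' = S.erase c → (∀ a ∈ T, ∀ b ∈ T', ¬ G.Adj a b) →
        ∀ a ∈ T, G.neighborFinset a ∩ S ⊆ (insert c T).erase a ∧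
          (c ∉ S → G.neighborFinset a ∩ S ⊆ T.erase a) := by
      intro T T' hTun hTadj a ha
      have hmem : ∀ b ∈ G.neighborFinset a ∩ S, b = c ∧ c ∈ S ∨ b ∈ T := by
        intro b hb
        rw [Finset.mem_inter, SimpleGraph.mem_neighborFinset] at hb
        by_cases hbc : b = c
        · exact Or.inl ⟨hbc, hbc ▸ hb.2⟩
        have : b ∈ T ∪ T' := hTun ▸ Finset.mem_erase.2 ⟨hbc, hb.2⟩
        exact Or.inr ((Finset.mem_union.1 this).resolve_right fun h => hTadj a ha b h hb.1)
      constructor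
      · intro b hb
        have hab := (SimpleGraph.mem_neighborFinset _ _ _).1 (Finset.mem_inter.1 hb).1
        rw [Finset.mem_erase, Finset.mem_insert]
        exact ⟨hab.ne', (hmem b hb).imp And.left id⟩
      · intro hcS b hb
        have hab := (SimpleGraph.mem_neighborFinset _ _ _).1 (Finset.mem_inter.1 hb).1
        rw [Finset.mem_erase]
        exact ⟨hab.ne', (hmem b hb).resolve_left fun h => hcS h.2⟩
    have h2 := hside T₁ T₂ hun hadj u hu
    have h3 := hside T₂ T₁ (by rw [Finset.union_comm, hun]) (fun a ha b hb hab =>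
      hadj b hb a ha hab.symm) w hw
    by_cases hcS : c ∈ S
    · have h4 := Finset.card_le_card h2.1
      have h5 := Finset.card_le_card h3.1
      rw [Finset.card_erase_of_mem (Finset.mem_insert_of_mem hu)] at h4
      rw [Finset.card_erase_of_mem (Finset.mem_insert_of_mem hw)] at h5
      have h6 := Finset.card_insert_le c T₁
      have h7 := Finset.card_insert_le c T₂
      rw [Finset.card_erase_of_mem hcS] at hcard
      have : 0 < S.card := Finset.card_pos.2 ⟨c, hcS⟩
      omega
    · have h4 := Finset.card_le_card (h2.2 hcS)
      have h5 := Finset.card_le_card (h3.2 hcS)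
      rw [Finset.card_erase_of_mem hu] at h4
      rw [Finset.card_erase_of_mem hw] at h5
      rw [Finset.erase_eq_of_notMem hcS] at hcard
      have : 0 < T₁.card := Finset.card_pos.2 ⟨u, hu⟩
      omega
  refine ⟨?_, key⟩
  by_contra hS
  obtain ⟨T₁, T₂, ⟨u, hu⟩, ⟨w, hw⟩, hdis, hun, hadj⟩ := exists_split hS
  have hne : u ≠ w := fun h => Finset.disjoint_left.1 hdis hu (h ▸ hw)
  have h1 := h u (hun ▸ Finset.mem_union_left _ hu) w (hun ▸ Finset.mem_union_right _ hw)
      hne (hadj u hu w hw)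
  have h2 : G.neighborFinset u ∩ S ⊆ T₁.erase u := by
    intro b hb
    rw [Finset.mem_inter, SimpleGraph.mem_neighborFinset, ← hun] at hb
    exact Finset.mem_erase.2 ⟨hb.1.ne',
      (Finset.mem_union.1 hb.2).resolve_right fun h => hadj u hu b h hb.1⟩
  have h3 : G.neighborFinset w ∩ S ⊆ T₂.erase w := by
    intro b hb
    rw [Finset.mem_inter, SimpleGraph.mem_neighborFinset, ← hun] at hb
    exact Finset.mem_erase.2 ⟨hb.1.ne',
      (Finset.mem_union.1 hb.2).resolve_left fun h => hadj b h w hw hb.1.symm⟩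
  have h4 := Finset.card_le_card h2
  have h5 := Finset.card_le_card h3
  rw [Finset.card_erase_of_mem hu] at h4
  rw [Finset.card_erase_of_mem hw] at h5
  rw [← hun, Finset.card_union_of_disjoint hdis, hun] at h1
  have : 0 < T₁.card := Finset.card_pos.2 ⟨u, hu⟩
  omega

theorem ns_of_complete {S : Finset V} (h : ∀ u ∈ S, ∀ w ∈ S, u ≠ w → G.Adj u w) : NS G S :=
  ns_of_ore fun u hu w hw hne hadj => absurd (h u hu w hw hne) hadj

theorem good_one {σ : ℕ} (h : NS G Finset.univ) (h3 : 3 ≤ Fintype.card V) : Good G σ :=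
  ⟨{Finset.univ}, isCover_singleton h h3, Or.inl (by simp)⟩

/-- Two parts meet the bound 2σ ≤ 2(|V| - 1) as soon as σ < |V|. -/
theorem good_two {σ : ℕ} {A B : Finset V} (hA : NS G A) (hA3 : 3 ≤ A.card) (hB : NS G B)
    (hB3 : 3 ≤ B.card) (hd : Disjoint A B) (hun : ∀ w, w ∈ A ∨ w ∈ B)
    (hσ : σ + 1 ≤ Fintype.card V) : Good G σ := by
  refine ⟨{A} ∪ {B}, ?_, Or.inr ?_⟩
  · convert (isCover_singleton hA hA3).union (isCover_singleton hB hB3) hd using 1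
    ext w
    simpa using hun w
  · have := Finset.card_union_le {A} {B}
    rw [Finset.card_singleton, Finset.card_singleton] at this
    have := Nat.mul_le_mul_right σ this
    omega

/-- `G - x` is split into the sets `S` and `T`, with no edges between them. -/
structure Cut (G : SimpleGraph V) (x : V) (S T : Finset V) : Prop where
  left : x ∉ S
  right : x ∉ T
  disj : Disjoint S T
  cover : ∀ w, w = x ∨ w ∈ S ∨ w ∈ T
  not_adj : ∀ a ∈ S, ∀ b ∈ T, ¬ G.Adj a b

theorem Cut.symm {x : V} {S T : Finset V} (h : Cut G x S T) : Cut G x T S :=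
  ⟨h.right, h.left, h.disj.symm, fun w => (h.cover w).imp_right Or.symm,
    fun a ha b hb hab => h.not_adj b hb a ha hab.symm⟩

theorem Cut.card {x : V} {S T : Finset V} (h : Cut G x S T) :
    S.card + T.card + 1 = Fintype.card V := by
  rw [← Finset.card_union_of_disjoint h.disj, ← Finset.card_insert_of_notMem (a := x),
    ← Finset.card_univ]
  · congr 1
    ext w
    simpa using h.cover w
  · simp [h.left, h.right]

theorem Cut.mem {x u w : V} {S T : Finset V} (h : Cut G x S T) (hu : u ∈ S) (huw : G.Adj u w) :
    w = x ∨ w ∈ S :=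
  (h.cover w).imp_right fun hw => hw.resolve_right fun hw => h.not_adj u hu w hw huw

theorem Cut.degree_le {x u : V} {S T : Finset V} (h : Cut G x S T) (hu : u ∈ S) :
    G.degree u ≤ S.card := by
  have := degree_lt_card (G := G) (S := insert x S) (Finset.mem_insert_of_mem hu)
    fun w hw => Finset.mem_insert.2 (h.mem hu hw)
  rw [Finset.card_insert_of_notMem h.left] at this
  omega

theorem Cut.degree_lt {x u : V} {S T : Finset V} (h : Cut G x S T) (hu : u ∈ S)
    (hux : ¬ G.Adj u x) : G.degree u + 1 ≤ S.card :=
  degree_lt_card hu fun _ hw => (h.mem hu hw).resolve_left fun he => hux (he ▸ hw)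

theorem Cut.degree_le_inner {x u : V} {S T : Finset V} (h : Cut G x S T) (hu : u ∈ S) :
    G.degree u ≤ (G.neighborFinset u ∩ S).card + 1 ∧
      (¬ G.Adj u x → G.degree u ≤ (G.neighborFinset u ∩ S).card) := by
  rw [← G.card_neighborFinset_eq_degree]
  constructor
  · refine le_trans (Finset.card_le_card (t := insert x (G.neighborFinset u ∩ S)) ?_)
      (Finset.card_insert_le _ _)
    intro w hw
    have := h.mem hu ((G.mem_neighborFinset u w).1 hw)
    simp only [Finset.mem_insert, Finset.mem_inter]
    tauto
  · refine fun hux => Finset.card_le_card fun w hw => Finset.mem_inter.2 ⟨hw, ?_⟩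
    rw [G.mem_neighborFinset] at hw
    exact (h.mem hu hw).resolve_left fun he => hux (he ▸ hw)

theorem Cut.exists_adj {x : V} {S T : Finset V} (h : Cut G x S T) (hc : Conn G Finset.univ)
    (hS : S.Nonempty) : ∃ y ∈ S, G.Adj y x := by
  by_contra hcon
  push Not at hcon
  have := hc S (Finset.subset_univ _) hS fun a ha b _ hab =>
    (h.mem ha hab).resolve_left fun he => hcon a ha (he ▸ hab)
  exact h.left (this ▸ Finset.mem_univ x)

theorem exists_cut (h : ¬ NS G Finset.univ) (hc : Conn G Finset.univ) :
    ∃ x S T, Cut G x S T ∧ S.Nonempty ∧ T.Nonempty := by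
  simp only [NS, hc, true_and, not_forall] at h
  obtain ⟨x, hx⟩ := h
  obtain ⟨T₁, T₂, h1, h2, hdis, hun, hadj⟩ := exists_split hx
  refine ⟨x, T₁, T₂, ⟨fun h => ?_, fun h => ?_, hdis, fun w => ?_, hadj⟩, h1, h2⟩
  · have h' := Finset.mem_union_left T₂ h
    rw [hun] at h'
    simp at h'
  · have h' := Finset.mem_union_right T₁ h
    rw [hun] at h'
    simp at h'
  · by_cases hw : w = x
    · exact Or.inl hw
    · right
      rw [← Finset.mem_union, hun]
      simp [hw]

/-- One side of a cut together with the cut vertex is non-separable. -/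
theorem Cut.ns_insert {σ : ℕ} (ore : ∀ u v, u ≠ v → ¬ G.Adj u v → σ ≤ G.degree u + G.degree v)
    {x : V} {S T : Finset V} (h : Cut G x S T) (hcard : S.card < σ) {y y' : V} (hy : y ∈ S)
    (hy' : y' ∈ S) (hyy : y ≠ y') (hyx : G.Adj y x) (hyx' : G.Adj y' x) : NS G (insert x S) := by
  have hside : ∀ (c : V) (A B : Finset V), A ∪ B = (insert x S).erase c →
      (∀ a ∈ A, ∀ b ∈ B, ¬ G.Adj a b) → ∀ a ∈ A, a ≠ x →
        (∀ w, G.Adj a w → w ∈ insert c A) := by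
    intro c A B hun hadj a ha hax w haw
    have haS : a ∈ S := by
      have := hun ▸ Finset.mem_union_left B ha
      rw [Finset.mem_erase, Finset.mem_insert] at this
      exact this.2.resolve_left hax
    by_cases hwc : w = c
    · exact hwc ▸ Finset.mem_insert_self _ _
    have : w ∈ A ∪ B := by
      rw [hun, Finset.mem_erase, Finset.mem_insert]
      exact ⟨hwc, h.mem haS haw⟩
    exact Finset.mem_insert_of_mem
      ((Finset.mem_union.1 this).resolve_right fun hw => hadj a ha w hw haw)
  -- Vertices other than `x` on different sides of a split have all their neighbours on their own
  -- side or equal to `c`, so their degree sum is at most |S| < σ. Hence one side of every split is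
  -- `{x}`, which the two neighbours of `x` in `S` rule out for `c ≠ x`.
  have hfin : ∀ (c : V) (A B : Finset V), c ∈ insert x S → Disjoint A B →
      A ∪ B = (insert x S).erase c → (∀ a ∈ A, ∀ b ∈ B, ¬ G.Adj a b) → ∀ a ∈ A, a ≠ x →
        ∀ b ∈ B, b ≠ x → False := by
    intro c A B hc hd hun hadj a ha hax b hb hbx
    have h1 := degree_lt_card (Finset.mem_insert_of_mem ha) (hside c A B hun hadj a ha hax)
    have h2 := degree_lt_card (Finset.mem_insert_of_mem hb)
      (hside c B A (by rw [Finset.union_comm, hun]) (fun b hb a ha hab =>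
        hadj a ha b hb hab.symm) b hb hbx)
    have h3 := Finset.card_insert_le c A
    have h4 := Finset.card_insert_le c B
    have h5 := ore a b (fun he => Finset.disjoint_left.1 hd ha (he ▸ hb)) (hadj a ha b hb)
    have h6 := congrArg Finset.card hun
    rw [Finset.card_union_of_disjoint hd, Finset.card_erase_of_mem hc,
      Finset.card_insert_of_notMem h.left] at h6
    omega
  have hxc : Conn G S := by
    by_contra hc
    obtain ⟨A, B, ⟨a, ha⟩, ⟨b, hb⟩, hd, hun, hadj⟩ := exists_split hc
    have hun' : A ∪ B = (insert x S).erase x := by rw [Finset.erase_insert h.left, hun]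
    exact hfin x A B (Finset.mem_insert_self _ _) hd hun' hadj a ha
      (fun he => h.left (hun ▸ he ▸ Finset.mem_union_left B ha)) b hb
      (fun he => h.left (hun ▸ he ▸ Finset.mem_union_right A hb))
  refine ⟨hxc.insert_adj hy hyx, fun c => ?_⟩
  by_cases hcx : c = x
  · rwa [hcx, Finset.erase_insert h.left]
  by_cases hcS : c ∈ S
  swap
  · rw [Finset.erase_eq_of_notMem (by simp [hcx, hcS])]
    exact hxc.insert_adj hy hyx
  obtain ⟨z, hz, hzc, hzx⟩ : ∃ z ∈ S, z ≠ c ∧ G.Adj z x := by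
    by_cases hyc : y = c
    · exact ⟨y', hy', fun he => hyy (hyc.trans he.symm), hyx'⟩
    · exact ⟨y, hy, hyc, hyx⟩
  by_contra hc
  obtain ⟨A, B, ⟨a, ha⟩, ⟨b, hb⟩, hd, hun, hadj⟩ := exists_split hc
  have hzAB : z ∈ A ∪ B := by rw [hun]; simp [hzc, hz]
  have hxAB : x ∈ A ∪ B := by rw [hun]; simp [Ne.symm hcx]
  have hzx' : z ≠ x := hzx.ne
  have hcI : c ∈ insert x S := Finset.mem_insert_of_mem hcS
  rcases Finset.mem_union.1 hxAB with hx | hx <;> rcases Finset.mem_union.1 hzAB with hz | hz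
  · exact hfin c A B hcI hd hun hadj z hz hzx' b hb
      (fun he => Finset.disjoint_left.1 hd hx (he ▸ hb))
  · exact hadj x hx z hz hzx.symm
  · exact hadj z hz x hx hzx
  · exact hfin c A B hcI hd hun hadj a ha
      (fun he => Finset.disjoint_left.1 hd ha (he ▸ hx)) z hz hzx'

/-- The exceptional graphs with a vertex of degree two. -/
def ExcTwo (G : SimpleGraph V) (D : ℕ) : Prop :=
  (D = 2 ∧ Models G tableF5 fun _ _ => false) ∨
    ((D = 2 ∨ D = 3) ∧ Models G (tableH D D) (optionalH D D))

theorem OreClass.le_degree (h : OreClass G 2 D) {v u : V} (hv : G.degree v = 2) (hne : v ≠ u)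
    (hadj : ¬ G.Adj v u) : D ≤ G.degree u := by
  have := h.ore v u hne hadj
  omega

/-- A cut vertex of degree two has one neighbour on each side. That neighbour has a further
neighbour, which is not adjacent to `x` and so has degree at least D. Both sides then have at least
D + 1 vertices, against n ≤ 2D + 2. -/
theorem OreClass.cut_degree_ne (h : OreClass G 2 D) (hc : Conn G Finset.univ) {x : V}
    {S T : Finset V} (hcut : Cut G x S T) (hS : S.Nonempty) (hT : T.Nonempty) :
    G.degree x ≠ 2 := by
  intro hx
  have key : ∀ S T : Finset V, Cut G x S T → S.Nonempty → T.Nonempty → D + 1 ≤ S.card := by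
    intro S T hcut hS hT
    obtain ⟨y, hy, hyx⟩ := hcut.exists_adj hc hS
    obtain ⟨t, ht, htx⟩ := hcut.symm.exists_adj hc hT
    have hyt : y ≠ t := fun he => Finset.disjoint_left.1 hcut.disj hy (he ▸ ht)
    have hN : ({y, t} : Finset V) = G.neighborFinset x :=
      Finset.eq_of_subset_of_card_le (by
        intro w hw
        rw [G.mem_neighborFinset]
        simp only [Finset.mem_insert, Finset.mem_singleton] at hw
        rcases hw with rfl | rfl
        · exact hyx.symm
        · exact htx.symm) (by
        rw [G.card_neighborFinset_eq_degree, hx, Finset.card_pair hyt])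
    obtain ⟨w, hw, hwx⟩ : ∃ w ∈ G.neighborFinset y, w ≠ x := by
      by_contra hcon
      push Not at hcon
      have h1 := Finset.card_le_card (s := G.neighborFinset y) (t := {x}) fun w hw =>
        Finset.mem_singleton.2 (hcon w hw)
      rw [G.card_neighborFinset_eq_degree, Finset.card_singleton] at h1
      have := h.min_le y
      omega
    rw [G.mem_neighborFinset] at hw
    have hwS := (hcut.mem hy hw).resolve_left hwx
    have hwadj : ¬ G.Adj x w := by
      rw [← G.mem_neighborFinset, ← hN]
      simp only [Finset.mem_insert, Finset.mem_singleton, not_or]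
      exact ⟨hw.ne', fun he => Finset.disjoint_left.1 hcut.disj hwS (he ▸ ht)⟩
    have h1 := h.le_degree hx hwx.symm hwadj
    have h2 := hcut.degree_lt hwS fun h => hwadj h.symm
    omega
  have h1 := key S T hcut hS hT
  have h2 := key T S hcut.symm hT hS
  have h3 := hcut.card
  have h4 := h.card_le
  omega

theorem neighborFinset_eq_of_card_le {u : V} {S : Finset V} (hu : u ∈ S)
    (h : ∀ w, G.Adj u w → w ∈ S) (hc : S.card ≤ G.degree u + 1) {w : V} (hw : w ∈ S)
    (hwu : u ≠ w) : G.Adj u w := by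
  have : G.neighborFinset u = S.erase u := by
    refine Finset.eq_of_subset_of_card_le (fun x hx => ?_) ?_
    · rw [G.mem_neighborFinset] at hx
      exact Finset.mem_erase.2 ⟨hx.ne', h x hx⟩
    · rw [G.card_neighborFinset_eq_degree, Finset.card_erase_of_mem hu]
      omega
  rw [← G.mem_neighborFinset, this]
  exact Finset.mem_erase.2 ⟨hwu.symm, hw⟩

/-- Here n = 2D + 2 and |S| = 2, so `S ∪ {x}` is a triangle. If `T` is separated by `y`, degrees of
at least D force two sides of D - 1 vertices, both complete and completely joined to `x` and `y`:
the graph is H_{D,D} up to the edge ab. -/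
theorem OreClass.cut_large (h : OreClass G 2 D) {x v : V}
    {S T : Finset V} (hcut : Cut G x S T) (hv : v ∈ S) (hv2 : G.degree v = 2)
    (hT : T.card = 2 * D - 1) : Good G (2 + D) ∨ ExcTwo G D := by
  have hD := h.le
  have hcard := hcut.card
  have hn := h.card_le
  have hvS := hcut.degree_le hv
  have hS2 : S.card = 2 := by omega
  have hSadj : ∀ a ∈ insert x S, ∀ b ∈ insert x S, a ≠ b → G.Adj a b := by
    have key : ∀ a ∈ S, ∀ b ∈ insert x S, a ≠ b → G.Adj a b := fun a ha b hb hab =>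
      neighborFinset_eq_of_card_le (S := insert x S) (Finset.mem_insert_of_mem ha)
        (fun w hw => Finset.mem_insert.2 (hcut.mem ha hw)) (by
          rw [Finset.card_insert_of_notMem hcut.left, hS2]
          have := h.min_le a
          omega) hb hab
    intro a ha b hb hab
    rcases Finset.mem_insert.1 ha with rfl | ha
    · rcases Finset.mem_insert.1 hb with rfl | hb
      · exact absurd rfl hab
      · exact (key b hb a (Finset.mem_insert_self _ _) hab.symm).symm
    · exact key a ha b hb hab
  have hSns := ns_of_complete hSadj
  have hS3 : (insert x S).card = 3 := by rw [Finset.card_insert_of_notMem hcut.left, hS2]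
  have hTdeg : ∀ t ∈ T, D ≤ G.degree t := fun t ht =>
    h.le_degree hv2 (fun he => Finset.disjoint_left.1 hcut.disj hv (he ▸ ht))
      (hcut.not_adj v hv t ht)
  by_cases hTns : NS G T
  · left
    refine good_two hSns hS3.ge hTns (by omega) ?_ (fun w => ?_) (by omega)
    · rw [Finset.disjoint_insert_left]
      exact ⟨hcut.right, hcut.disj⟩
    · have := hcut.cover w
      rw [Finset.mem_insert]
      tauto
  have hTc : Conn G T := by
    by_contra hTc
    obtain ⟨A, B, ⟨a, ha⟩, ⟨b, hb⟩, hd, hun, hadj⟩ := exists_split hTc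
    have key : ∀ A B : Finset V, A ∪ B = T → (∀ a ∈ A, ∀ b ∈ B, ¬ G.Adj a b) → ∀ a ∈ A,
        D ≤ A.card := by
      intro A B hun hadj a ha
      have haT : a ∈ T := hun ▸ Finset.mem_union_left B ha
      have h1 := degree_lt_card (G := G) (S := insert x A) (Finset.mem_insert_of_mem ha)
        fun w hw => by
          rw [Finset.mem_insert]
          refine (hcut.symm.mem haT hw).imp_right fun hwT => ?_
          rw [← hun] at hwT
          exact (Finset.mem_union.1 hwT).resolve_right fun hwB => hadj a ha w hwB hw
      have h2 := Finset.card_insert_le x A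
      have h3 := hTdeg a haT
      omega
    have h1 := key A B hun hadj a ha
    have h2 := key B A (by rw [Finset.union_comm, hun])
      (fun b hb a ha hab => hadj a ha b hb hab.symm) b hb
    rw [← hun, Finset.card_union_of_disjoint hd] at hT
    omega
  simp only [NS, hTc, true_and, not_forall] at hTns
  obtain ⟨y, hy⟩ := hTns
  have hyT : y ∈ T := by
    by_contra hyT
    rw [Finset.erase_eq_of_notMem hyT] at hy
    exact hy hTc
  obtain ⟨A, B, ⟨a₀, ha₀⟩, ⟨b₀, hb₀⟩, hd, hun, hadj⟩ := exists_split hy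
  have hmem : ∀ w, w ∈ A ∨ w ∈ B ↔ w ≠ y ∧ w ∈ T := by
    intro w
    rw [← Finset.mem_union, hun, Finset.mem_erase]
  have hclosed : ∀ A B : Finset V, A ∪ B = T.erase y → (∀ a ∈ A, ∀ b ∈ B, ¬ G.Adj a b) →
      ∀ a ∈ A, ∀ w, G.Adj a w → w ∈ insert x (insert y A) := by
    intro A B hun hadj a ha w hw
    have haT : a ∈ T := Finset.mem_of_mem_erase (hun ▸ Finset.mem_union_left B ha)
    simp only [Finset.mem_insert]
    refine (hcut.symm.mem haT hw).imp_right fun hwT => ?_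
    by_cases hwy : w = y
    · exact Or.inl hwy
    have : w ∈ A ∪ B := by rw [hun]; exact Finset.mem_erase.2 ⟨hwy, hwT⟩
    exact Or.inr ((Finset.mem_union.1 this).resolve_right fun hwB => hadj a ha w hwB hw)
  have hle : ∀ A B : Finset V, A ∪ B = T.erase y → (∀ a ∈ A, ∀ b ∈ B, ¬ G.Adj a b) →
      ∀ a ∈ A, D ≤ A.card + 1 := by
    intro A B hun hadj a ha
    have haT : a ∈ T := Finset.mem_of_mem_erase (hun ▸ Finset.mem_union_left B ha)
    have h1 := degree_lt_card (G := G) (S := insert x (insert y A)) (by simp [ha])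
      (hclosed A B hun hadj a ha)
    have h2 := Finset.card_insert_le x (insert y A)
    have h3 := Finset.card_insert_le y A
    have h4 := hTdeg a haT
    omega
  have hun' : B ∪ A = T.erase y := by rw [Finset.union_comm, hun]
  have hadj' : ∀ b ∈ B, ∀ a ∈ A, ¬ G.Adj b a := fun b hb a ha hab => hadj a ha b hb hab.symm
  have hA := hle A B hun hadj a₀ ha₀
  have hB := hle B A hun' hadj' b₀ hb₀
  have hAB := congrArg Finset.card hun
  rw [Finset.card_union_of_disjoint hd, Finset.card_erase_of_mem hyT, hT] at hAB
  have hAc : A.card = D - 1 := by omega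
  have hBc : B.card = D - 1 := by omega
  have hAadj : ∀ A B : Finset V, A ∪ B = T.erase y → (∀ a ∈ A, ∀ b ∈ B, ¬ G.Adj a b) →
      A.card = D - 1 → ∀ a ∈ A, ∀ w, (w = x ∨ w = y ∨ w ∈ A) → a ≠ w → G.Adj a w := by
    intro A B hun hadj hAc a ha w hw haw
    have haT : a ∈ T := Finset.mem_of_mem_erase (hun ▸ Finset.mem_union_left B ha)
    refine neighborFinset_eq_of_card_le (S := insert x (insert y A)) (by simp [ha])
      (hclosed A B hun hadj a ha) ?_ (by simpa using hw) haw
    have h2 := Finset.card_insert_le x (insert y A)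
    have h3 := Finset.card_insert_le y A
    have h4 := hTdeg a haT
    omega
  have hA' := hAadj A B hun hadj hAc
  have hB' := hAadj B A hun' hadj' hBc
  have hAT : ∀ a ∈ A, a ≠ y ∧ a ∈ T := fun a ha => (hmem a).1 (Or.inl ha)
  have hBT : ∀ a ∈ B, a ≠ y ∧ a ∈ T := fun a ha => (hmem a).1 (Or.inr ha)
  have hyA : y ∉ A := fun hyA => (hAT y hyA).1 rfl
  have hxT := hcut.right
  -- The three parts are the triangle, `A ∪ {y}` and `B`. They need D - 1 ≥ 3 and 3(D + 2) ≤ 2(2D +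
  -- 1), and each of these says D ≥ 4.
  by_cases hD4 : 4 ≤ D
  · left
    refine ⟨{insert x S} ∪ ({insert y A} ∪ {B}), ?_, Or.inr ?_⟩
    · have hcA : NS G (insert y A) := ns_of_complete (by
        intro a ha b hb hab
        rw [Finset.mem_insert] at ha hb
        rcases ha with rfl | ha
        · exact (hA' b (hb.resolve_left hab.symm) a (Or.inr (Or.inl rfl)) hab.symm).symm
        · exact hA' a ha b (Or.inr hb) hab)
      have hcB : NS G B := ns_of_complete fun a ha b hb hab => hB' a ha b (Or.inr (Or.inr hb)) hab
      have hdyB : Disjoint (insert y A) B := by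
        rw [Finset.disjoint_insert_left]
        exact ⟨fun hyB => (hBT y hyB).1 rfl, hd⟩
      have hcov := (isCover_singleton hcA (by rw [Finset.card_insert_of_notMem hyA]; omega)).union
        (isCover_singleton hcB (by omega)) hdyB
      have hTeq : insert y A ∪ B = T := by
        rw [Finset.insert_union, hun, Finset.insert_erase hyT]
      rw [hTeq] at hcov
      convert (isCover_singleton hSns hS3.ge).union hcov ?_ using 1
      · ext w
        have := hcut.cover w
        simp only [Finset.mem_univ, Finset.mem_union, Finset.mem_insert, true_iff]
        tauto
      · rw [Finset.disjoint_insert_left]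
        exact ⟨hcut.right, hcut.disj⟩
    · have h1 := Finset.card_union_le {insert x S} ({insert y A} ∪ {B})
      have h2 := Finset.card_union_le {insert y A} {B}
      simp only [Finset.card_singleton] at h1 h2
      have h3 := Nat.mul_le_mul_right (2 + D) (h1.trans (Nat.add_le_add_left h2 1))
      omega
  right
  right
  refine ⟨by omega, ?_⟩
  obtain ⟨c, hcS, hvc⟩ : ∃ c ∈ S, c ≠ v :=
    Finset.exists_mem_ne (by omega) v
  have hSeq : ({v, c} : Finset V) = S := Finset.eq_of_subset_of_card_le (by
    intro w hw
    simp only [Finset.mem_insert, Finset.mem_singleton] at hw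
    rcases hw with rfl | rfl <;> assumption) (by rw [hS2, Finset.card_pair hvc.symm])
  let eA := A.equivFinOfCardEq hAc
  let eB := B.equivFinOfCardEq hBc
  have hxS : x ∈ insert x S := Finset.mem_insert_self _ _
  have hvI : v ∈ insert x S := Finset.mem_insert_of_mem hv
  have hcI : c ∈ insert x S := Finset.mem_insert_of_mem hcS
  have hxv : x ≠ v := fun he => hcut.left (he ▸ hv)
  have hxc : x ≠ c := fun he => hcut.left (he ▸ hcS)
  have e1 := hSadj x hxS v hvI hxv
  have e2 := hSadj x hxS c hcI hxc
  have e3 := hSadj v hvI c hcI hvc.symm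
  have hST : ∀ s ∈ S, ∀ t ∈ T, ¬ G.Adj s t ∧ s ≠ t := fun s hs t ht =>
    ⟨hcut.not_adj s hs t ht, fun he => Finset.disjoint_left.1 hcut.disj hs (he ▸ ht)⟩
  have hxy : x ≠ y := fun he => hxT (he ▸ hyT)
  have hAx : ∀ i, x ≠ (eA.symm i : V) := fun i he => hxT (he ▸ (hAT _ (eA.symm i).2).2)
  have hBx : ∀ i, x ≠ (eB.symm i : V) := fun i he => hxT (he ▸ (hBT _ (eB.symm i).2).2)
  have hAy : ∀ i, y ≠ (eA.symm i : V) := fun i he => (hAT _ (eA.symm i).2).1 he.symm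
  have hBy : ∀ i, y ≠ (eB.symm i : V) := fun i he => (hBT _ (eB.symm i).2).1 he.symm
  refine ⟨Sum.elim ![x, y, v, c] (Sum.elim (fun i => (eA.symm i : V)) (fun i => (eB.symm i : V))),
    (Fintype.bijective_iff_surjective_and_card _).2 ⟨?_, ?_⟩, ?_⟩
  · intro w
    rcases hcut.cover w with rfl | hw | hw
    · exact ⟨Sum.inl 0, rfl⟩
    · rw [← hSeq, Finset.mem_insert, Finset.mem_singleton] at hw
      rcases hw with rfl | rfl
      · exact ⟨Sum.inl 2, rfl⟩
      · exact ⟨Sum.inl 3, rfl⟩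
    · by_cases hwy : w = y
      · subst hwy; exact ⟨Sum.inl 1, rfl⟩
      rcases (hmem w).2 ⟨hwy, hw⟩ with hw | hw
      · exact ⟨Sum.inr (Sum.inl (eA ⟨w, hw⟩)), by simp⟩
      · exact ⟨Sum.inr (Sum.inr (eB ⟨w, hw⟩)), by simp⟩
  · simp only [Fintype.card_sum, Fintype.card_fin]
    omega
  · have n1 := (hST v hv y hyT).1
    have n2 := (hST c hcS y hyT).1
    have hAadj0 : ∀ i, G.Adj x (eA.symm i : V) ∧ G.Adj y (eA.symm i : V) ∧
        ¬ G.Adj v (eA.symm i : V) ∧ ¬ G.Adj c (eA.symm i : V) := fun i =>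
      have hi := (eA.symm i).2
      ⟨(hA' _ hi x (Or.inl rfl) (hAx i).symm).symm, (hA' _ hi y (by simp) (hAy i).symm).symm,
        (hST v hv _ (hAT _ hi).2).1, (hST c hcS _ (hAT _ hi).2).1⟩
    have hBadj0 : ∀ i, G.Adj x (eB.symm i : V) ∧ G.Adj y (eB.symm i : V) ∧
        ¬ G.Adj v (eB.symm i : V) ∧ ¬ G.Adj c (eB.symm i : V) := fun i =>
      have hi := (eB.symm i).2
      ⟨(hB' _ hi x (Or.inl rfl) (hBx i).symm).symm, (hB' _ hi y (by simp) (hBy i).symm).symm,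
        (hST v hv _ (hBT _ hi).2).1, (hST c hcS _ (hBT _ hi).2).1⟩
    have hAA : ∀ i j, G.Adj (eA.symm i : V) (eA.symm j : V) ↔ i ≠ j := fun i j =>
      ⟨fun hij he => hij.ne (by rw [he]), fun hij => hA' _ (eA.symm i).2 _
        (Or.inr (Or.inr (eA.symm j).2)) fun he => hij (eA.symm.injective (Subtype.ext he))⟩
    have hBB : ∀ i j, G.Adj (eB.symm i : V) (eB.symm j : V) ↔ i ≠ j := fun i j =>
      ⟨fun hij he => hij.ne (by rw [he]), fun hij => hB' _ (eB.symm i).2 _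
        (Or.inr (Or.inr (eB.symm j).2)) fun he => hij (eB.symm.injective (Subtype.ext he))⟩
    have hAB' : ∀ i j, ¬ G.Adj (eA.symm i : V) (eB.symm j : V) := fun i j =>
      hadj _ (eA.symm i).2 _ (eB.symm j).2
    rintro (i | i | i) (j | j | j) hO
    · fin_cases i <;> fin_cases j <;>
        simp [tableH, optionalH, e1, e2, e3, e1.symm, e2.symm, e3.symm, n1, n2,
          G.adj_comm y] at hO ⊢
    · have := hAadj0 j
      fin_cases i <;> simp [tableH, this]
    · have := hBadj0 j
      fin_cases i <;> simp [tableH, this]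
    · have := hAadj0 i
      fin_cases j <;> simp [tableH, this, G.adj_comm (eA.symm i : V)]
    · simp [tableH, hAA]
    · simp [tableH, hAB']
    · have := hBadj0 i
      fin_cases j <;> simp [tableH, this, G.adj_comm (eB.symm i : V)]
    · simp [tableH, G.adj_comm (eB.symm i : V), hAB']
    · simp [tableH, hBB]

/-- All non-neighbours of `v` have degree at least D, in particular those beyond a cut vertex `x`.
The two parts are the sides of the cut, with `x` added to the side of `v` if it has two neighbours
there and to the other side if not. -/
theorem OreClass.good_or_excTwo (h : OreClass G 2 D) {v : V} (hv2 : G.degree v = 2) :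
    Good G (2 + D) ∨ ExcTwo G D := by
  have hD := h.le
  have hn := h.card_le
  by_cases hns : NS G Finset.univ
  · left
    refine good_one hns ?_
    have := degree_lt_card (G := G) (Finset.mem_univ v) fun w _ => Finset.mem_univ w
    rw [Finset.card_univ] at this
    omega
  by_cases hc : Conn G Finset.univ
  swap
  · left
    obtain ⟨S, T, hSne, hTne, hd, hun, hadj⟩ := exists_split hc
    have hadj' : ∀ b ∈ T, ∀ a ∈ S, ¬ G.Adj b a := fun b hb a ha hab => hadj a ha b hb hab.symm
    have key : ∀ S T : Finset V, Disjoint S T → S ∪ T = Finset.univ → 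
        (∀ a ∈ S, ∀ b ∈ T, ¬ G.Adj a b) → v ∈ S → T.Nonempty → Good G (2 + D) := by
      intro S T hd hun hadj hv ⟨t₀, ht₀⟩
      have hadj' : ∀ b ∈ T, ∀ a ∈ S, ¬ G.Adj b a := fun b hb a ha hab => hadj a ha b hb hab.symm
      have hmem : ∀ w, w ∈ S ∨ w ∈ T := fun w => by
        rw [← Finset.mem_union, hun]; exact Finset.mem_univ w
      have hcl : ∀ a ∈ S, ∀ w, G.Adj a w → w ∈ S := fun a ha w hw =>
        (hmem w).resolve_right fun hwT => hadj a ha w hwT hw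
      have hcl' : ∀ a ∈ T, ∀ w, G.Adj a w → w ∈ T := fun a ha w hw =>
        (hmem w).resolve_left fun hwS => hadj' a ha w hwS hw
      have hS : ∀ a ∈ S, G.neighborFinset a ∩ S = G.neighborFinset a := fun a ha =>
        Finset.inter_eq_left.2 fun w hw => hcl a ha w ((G.mem_neighborFinset a w).1 hw)
      have hT : ∀ a ∈ T, G.neighborFinset a ∩ T = G.neighborFinset a := fun a ha =>
        Finset.inter_eq_left.2 fun w hw => hcl' a ha w ((G.mem_neighborFinset a w).1 hw)
      have hTd : ∀ t ∈ T, D ≤ G.degree t := fun t ht =>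
        h.le_degree hv2 (fun he => Finset.disjoint_left.1 hd hv (he ▸ ht)) (hadj v hv t ht)
      have hS3 := degree_lt_card hv (hcl v hv)
      have hT3 := degree_lt_card ht₀ (hcl' t₀ ht₀)
      have ht₀d := hTd t₀ ht₀
      have hcard := congrArg Finset.card hun
      rw [Finset.card_union_of_disjoint hd, Finset.card_univ] at hcard
      refine good_two (A := S) (B := T) (ns_of_ore ?_) (by omega) (ns_of_ore ?_) (by omega) hd
        hmem (by omega)
      · intro a ha b hb hab hnadj
        rw [hS a ha, hS b hb, G.card_neighborFinset_eq_degree, G.card_neighborFinset_eq_degree]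
        have := h.ore a b hab hnadj
        omega
      · intro a ha b hb hab hnadj
        rw [hT a ha, hT b hb, G.card_neighborFinset_eq_degree, G.card_neighborFinset_eq_degree]
        have := hTd a ha
        have := hTd b hb
        omega
    have hv : v ∈ S ∪ T := hun ▸ Finset.mem_univ v
    rcases Finset.mem_union.1 hv with hv | hv
    · exact key S T hd hun hadj hv hTne
    · exact key T S hd.symm (by rw [Finset.union_comm, hun]) hadj' hv hSne
  obtain ⟨x, S, T, hcut, hSne, hTne, hv⟩ : ∃ x S T, Cut G x S T ∧ S.Nonempty ∧ T.Nonempty ∧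
      v ∈ S := by
    obtain ⟨x, S, T, hcut, hSne, hTne⟩ := exists_cut hns hc
    rcases hcut.cover v with rfl | hv | hv
    · exact absurd hv2 (h.cut_degree_ne hc hcut hSne hTne)
    · exact ⟨x, S, T, hcut, hSne, hTne, hv⟩
    · exact ⟨x, T, S, hcut.symm, hTne, hSne, hv⟩
  have hcard := hcut.card
  have hvS := hcut.degree_le hv
  have hTdeg : ∀ t ∈ T, D ≤ G.degree t := fun t ht =>
    h.le_degree hv2 (fun he => Finset.disjoint_left.1 hcut.disj hv (he ▸ ht))
      (hcut.not_adj v hv t ht)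
  have hTD : D ≤ T.card := by
    obtain ⟨t, ht⟩ := hTne
    exact (hTdeg t ht).trans (hcut.symm.degree_le ht)
  by_cases hlarge : T.card = 2 * D - 1
  · exact h.cut_large hcut hv hv2 hlarge
  -- As |S| ≥ deg v = 2, now |T| ≤ 2D - 2, while degrees inside `T` are at least D - 1.
  have hTns : NS G T := ns_of_ore (by
    intro a ha b hb hab hnadj
    have h1 := (hcut.symm.degree_le_inner ha).1
    have h2 := (hcut.symm.degree_le_inner hb).1
    have h3 := hTdeg a ha
    have h4 := hTdeg b hb
    omega)
  obtain ⟨y, hy, hyx⟩ := hcut.exists_adj hc hSne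
  obtain ⟨t, ht, htx⟩ := hcut.symm.exists_adj hc hTne
  by_cases hT3 : 3 ≤ T.card
  · left
    by_cases h2 : ∃ y' ∈ S, y ≠ y' ∧ G.Adj y' x
    · obtain ⟨y', hy', hyy, hyx'⟩ := h2
      refine good_two (hcut.ns_insert h.ore (by omega) hy hy' hyy hyx hyx') ?_ hTns hT3 ?_ ?_
        (by omega)
      · rw [Finset.card_insert_of_notMem hcut.left]
        omega
      · rw [Finset.disjoint_insert_left]
        exact ⟨hcut.right, hcut.disj⟩
      · intro w
        have := hcut.cover w
        rw [Finset.mem_insert]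
        tauto
    · push Not at h2
      have hSns : NS G S := ns_of_ore (by
        intro a ha b hb hab hnadj
        have h1 := hcut.degree_le_inner ha
        have h3 := hcut.degree_le_inner hb
        have h4 := h.ore a b hab hnadj
        by_cases hay : y = a
        · have := h3.2 (h2 b hb (fun he => hab (hay.symm.trans he)))
          omega
        · have := h1.2 (h2 a ha hay)
          omega)
      have hS3 : 3 ≤ S.card := by
        by_cases hyv : y = v
        · obtain ⟨w, hw, hwx⟩ : ∃ w ∈ G.neighborFinset v, w ≠ x :=
            Finset.exists_mem_ne (by rw [G.card_neighborFinset_eq_degree]; omega) x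
          rw [G.mem_neighborFinset] at hw
          have hwS := (hcut.mem hv hw).resolve_left hwx
          have h3 := hcut.degree_lt hwS (h2 w hwS fun he => hw.ne (hyv.symm.trans he))
          have := h.min_le w
          omega
        · have := hcut.degree_lt hv (h2 v hv hyv)
          omega
      obtain ⟨t', ht', htt, htx'⟩ : ∃ t' ∈ T, t ≠ t' ∧ G.Adj t' x := by
        by_contra hcon
        push Not at hcon
        refine h.cut_degree_ne hc hcut hSne hTne (le_antisymm ?_ (h.min_le x))
        rw [← G.card_neighborFinset_eq_degree]
        refine (Finset.card_le_card (t := {y, t}) fun w hw => ?_).trans Finset.card_le_two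
        rw [G.mem_neighborFinset] at hw
        rw [Finset.mem_insert, Finset.mem_singleton]
        rcases hcut.cover w with rfl | hwS | hwT
        · exact absurd rfl hw.ne
        · left
          by_contra hne
          exact h2 w hwS (Ne.symm hne) hw.symm
        · right
          by_contra hne
          exact hcon w hwT (Ne.symm hne) hw.symm
      refine good_two hSns hS3 (hTns.insert htt ht ht' htx htx') ?_ ?_ ?_ (by omega)
      · rw [Finset.card_insert_of_notMem hcut.right]
        omega
      · rw [Finset.disjoint_insert_right]
        exact ⟨hcut.left, hcut.disj⟩
      · intro w
        have := hcut.cover w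
        rw [Finset.mem_insert]
        tauto
  -- D ≤ |T| ≤ 2, so n ≤ 6. Either |S| = 3 = 2D - 1, and the two sides exchange their roles, or both
  -- sides have two vertices and the graph is F₅.
  · have hD2 : D = 2 := by omega
    subst hD2
    by_cases hS3 : S.card = 3
    · refine h.cut_large hcut.symm ht ?_ hS3
      have := hTdeg t ht
      have := hcut.symm.degree_le ht
      omega
    right
    left
    refine ⟨rfl, ?_⟩
    have key : ∀ S T : Finset V, Cut G x S T → S.card ≤ 2 → S.Nonempty → ∃ a b, a ∈ S ∧ b ∈ S ∧
        G.Adj x a ∧ G.Adj x b ∧ G.Adj a b ∧ ∀ w ∈ S, w = a ∨ w = b := by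
      intro S T hcut hS2 ⟨a, ha⟩
      have hdeg := hcut.degree_le ha
      have hmin := h.min_le a
      have hS2' : S.card = 2 := by omega
      obtain ⟨b, hb, hba⟩ := Finset.exists_mem_ne (s := S) (by omega) a
      have hadj : ∀ a ∈ S, ∀ w ∈ insert x S, a ≠ w → G.Adj a w := fun a ha w hw haw =>
        neighborFinset_eq_of_card_le (S := insert x S) (Finset.mem_insert_of_mem ha)
          (fun w hw => Finset.mem_insert.2 (hcut.mem ha hw)) (by
            rw [Finset.card_insert_of_notMem hcut.left, hS2']
            have := h.min_le a
            omega) hw haw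
      have hSeq : ({a, b} : Finset V) = S := Finset.eq_of_subset_of_card_le (by
        intro w hw
        simp only [Finset.mem_insert, Finset.mem_singleton] at hw
        rcases hw with rfl | rfl <;> assumption) (by rw [hS2', Finset.card_pair hba.symm])
      refine ⟨a, b, ha, hb, (hadj a ha x (by simp) fun he => hcut.left (he ▸ ha)).symm,
        (hadj b hb x (by simp) fun he => hcut.left (he ▸ hb)).symm,
        hadj a ha b (by simp [hb]) hba.symm, fun w hw => ?_⟩
      simpa [← hSeq] using hw
    obtain ⟨a, b, ha, hb, hxa, hxb, hab, hSab⟩ := key S T hcut (by omega) hSne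
    obtain ⟨c, d, hc, hd, hxc, hxd, hcd, hTcd⟩ := key T S hcut.symm (by omega) hTne
    have hac := hcut.not_adj a ha c hc
    have had := hcut.not_adj a ha d hd
    have hbc := hcut.not_adj b hb c hc
    have hbd := hcut.not_adj b hb d hd
    refine ⟨![x, a, b, c, d], (Fintype.bijective_iff_surjective_and_card _).2 ⟨?_, ?_⟩, ?_⟩
    · intro w
      rcases hcut.cover w with rfl | hw | hw
      · exact ⟨0, rfl⟩
      · rcases hSab w hw with rfl | rfl
        · exact ⟨1, rfl⟩
        · exact ⟨2, rfl⟩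
      · rcases hTcd w hw with rfl | rfl
        · exact ⟨3, rfl⟩
        · exact ⟨4, rfl⟩
    · rw [Fintype.card_fin]
      have := hcut.degree_le ha
      have := hcut.symm.degree_le hc
      have := h.min_le a
      have := h.min_le c
      omega
    · intro i j _
      fin_cases i <;> fin_cases j <;>
        simp [tableF5, hxa, hxb, hab, hxc, hxd, hcd, hxa.symm, hxb.symm, hab.symm, hxc.symm,
          hxd.symm, hcd.symm, hac, had, hbc, hbd, G.adj_comm c, G.adj_comm d]

end DegreeTwo

/-! ### Exceptional induced subgraphs and their attachment to a block -/

section Induction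

universe u

variable {V : Type u} [DecidableEq V] [Fintype V] {G : SimpleGraph V} [DecidableRel G.Adj]
variable {δ D : ℕ}

/-- The subgraph induced by a finite set. -/
abbrev sub (G : SimpleGraph V) (S : Finset V) : SimpleGraph {x // x ∈ S} :=
  G.comap Subtype.val

theorem sub_degree {S : Finset V} (v : {x // x ∈ S}) :
    (sub G S).degree v = (G.neighborFinset v ∩ S).card := by
  rw [← SimpleGraph.card_neighborFinset_eq_degree,
    ← Finset.card_map (Function.Embedding.subtype (· ∈ S))]
  congr 1
  ext w
  simp only [Finset.mem_map, SimpleGraph.mem_neighborFinset, SimpleGraph.comap_adj,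
    Function.Embedding.coe_subtype, Subtype.exists, exists_and_left, Finset.mem_inter]
  constructor
  · rintro ⟨a, ha, hS, rfl⟩
    exact ⟨ha, hS⟩
  · rintro ⟨ha, hS⟩
    exact ⟨w, ha, hS, rfl⟩

theorem conn_map {S : Finset V} {T : Finset {x // x ∈ S}} (h : Conn (sub G S) T) :
    Conn G (T.map (Function.Embedding.subtype (· ∈ S))) := by
  intro X hX hne hcl
  have h1 : T ⊆ T.filter fun t => (t : V) ∈ X := by
    refine h.subset ?_ fun a ha haX b hb hab => ?_
    · obtain ⟨x, hx⟩ := hne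
      obtain ⟨t, ht, rfl⟩ := Finset.mem_map.1 (hX hx)
      exact ⟨t, Finset.mem_inter.2 ⟨ht, Finset.mem_filter.2 ⟨ht, hx⟩⟩⟩
    · exact Finset.mem_filter.2 ⟨hb, hcl a (Finset.mem_filter.1 haX).2 b
        (Finset.mem_map_of_mem _ hb) hab⟩
  refine hX.antisymm fun x hx => ?_
  obtain ⟨t, ht, rfl⟩ := Finset.mem_map.1 hx
  exact (Finset.mem_filter.1 (h1 ht)).2

theorem ns_map {S : Finset V} {T : Finset {x // x ∈ S}} (h : NS (sub G S) T) :
    NS G (T.map (Function.Embedding.subtype (· ∈ S))) := by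
  refine ⟨conn_map h.1, fun c => ?_⟩
  by_cases hc : c ∈ S
  · have := conn_map (h.2 ⟨c, hc⟩)
    rwa [Finset.map_erase] at this
  · rw [Finset.erase_eq_of_notMem]
    · exact conn_map h.1
    · simp [hc]

theorem IsCover.of_sub {S : Finset V} {P : Finset (Finset {x // x ∈ S})}
    (h : IsCover (sub G S) P Finset.univ) : ∃ Q, IsCover G Q S ∧ Q.card ≤ P.card := by
  refine ⟨P.image fun A => A.map (Function.Embedding.subtype (· ∈ S)), ⟨?_, ?_, ?_⟩,
    Finset.card_image_le⟩
  · intro A hA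
    obtain ⟨A', hA', rfl⟩ := Finset.mem_image.1 hA
    rw [Finset.card_map]
    exact ⟨ns_map (h.ns A' hA').1, (h.ns A' hA').2⟩
  · intro A hA B hB hAB
    obtain ⟨A', hA', rfl⟩ := Finset.mem_image.1 hA
    obtain ⟨B', hB', rfl⟩ := Finset.mem_image.1 hB
    rw [Finset.disjoint_map]
    exact h.disj A' hA' B' hB' fun he => hAB (by rw [he])
  · intro v
    constructor
    · intro hv
      obtain ⟨A, hA, hvA⟩ := (h.mem_iff ⟨v, hv⟩).1 (Finset.mem_univ _)
      exact ⟨_, Finset.mem_image_of_mem _ hA, Finset.mem_map_of_mem _ hvA⟩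
    · rintro ⟨A, hA, hvA⟩
      obtain ⟨A', -, rfl⟩ := Finset.mem_image.1 hA
      obtain ⟨w, -, rfl⟩ := Finset.mem_map.1 hvA
      exact w.2

/-- `f` identifies the subgraph induced by `S` with the graph given by the table `E`, up to optional
pairs. -/
structure ModelsOn (G : SimpleGraph V) (S : Finset V) {ι : Type*} (E O : ι → ι → Bool)
    (f : ι → V) : Prop where
  inj : Function.Injective f
  mem_iff : ∀ w, w ∈ S ↔ ∃ i, f i = w
  adj : ∀ i j, O i j = false → (G.Adj (f i) (f j) ↔ E i j = true)

theorem Models.of_sub {S : Finset V} {ι : Type*} {E O : ι → ι → Bool} (h : Models (sub G S) E O) :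
    ∃ f, ModelsOn G S E O f := by
  obtain ⟨f, hf, hadj⟩ := h
  refine ⟨fun i => f i, Subtype.val_injective.comp hf.1, fun w => ⟨fun hw => ?_, ?_⟩, hadj⟩
  · obtain ⟨i, hi⟩ := hf.2 ⟨w, hw⟩
    exact ⟨i, by rw [hi]⟩
  · rintro ⟨i, rfl⟩
    exact (f i).2

theorem ModelsOn.card_eq {S : Finset V} {ι : Type*} [Fintype ι] {E O : ι → ι → Bool} {f : ι → V}
    (h : ModelsOn G S E O f) : S.card = Fintype.card ι := by
  rw [← Finset.card_univ, ← Finset.card_image_of_injective _ h.inj]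
  congr 1
  ext w
  rw [h.mem_iff]
  simp

/-- The table of a vertex joined to two graphs. -/
def joinTable {ι κ : Type*} (E₁ : ι → ι → Bool) (E₂ : κ → κ → Bool) (l₁ : ι → Bool)
    (l₂ : κ → Bool) : Option (ι ⊕ κ) → Option (ι ⊕ κ) → Bool
  | none, none => false
  | none, some (Sum.inl i) => l₁ i
  | none, some (Sum.inr i) => l₂ i
  | some (Sum.inl i), none => l₁ i
  | some (Sum.inr i), none => l₂ i
  | some (Sum.inl i), some (Sum.inl j) => E₁ i j
  | some (Sum.inr i), some (Sum.inr j) => E₂ i j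
  | some (Sum.inl _), some (Sum.inr _) => false
  | some (Sum.inr _), some (Sum.inl _) => false

/-- The vertices of degree two of `F5`. -/
def lowF5 (i : Fin 5) : Bool := i != 0

/-- The vertices of `H s t` other than `a` and `b`. -/
def lowH (s t : ℕ) : HVertex s t → Bool
  | Sum.inl i => i = 2 || i = 3
  | Sum.inr _ => true

/-- The low vertices of a join. -/
def lowJoin {ι κ : Type*} (l₁ : ι → Bool) (l₂ : κ → Bool) : Option (ι ⊕ κ) → Bool
  | none => false
  | some (Sum.inl i) => l₁ i
  | some (Sum.inr i) => l₂ i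

/-- Only the low vertices are known to be adjacent to `x`; the pairs of `x` with the other vertices
become optional. -/
theorem ModelsOn.join {S T : Finset V} {x : V} (hcut : Cut G x S T) {ι κ : Type*}
    {E₁ O₁ : ι → ι → Bool} {E₂ O₂ : κ → κ → Bool} {l₁ : ι → Bool} {l₂ : κ → Bool} {f : ι → V}
    {g : κ → V} (hf : ModelsOn G S E₁ O₁ f) (hg : ModelsOn G T E₂ O₂ g)
    (hl₁ : ∀ i, l₁ i = true → G.Adj (f i) x) (hl₂ : ∀ i, l₂ i = true → G.Adj (g i) x) :
    let F : Option (ι ⊕ κ) → V := fun o => o.elim x (Sum.elim f g)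
    Function.Bijective F ∧ ∀ p q, joinTable O₁ O₂ (fun i => !l₁ i) (fun i => !l₂ i) p q = false →
      (G.Adj (F p) (F q) ↔ joinTable E₁ E₂ l₁ l₂ p q = true) := by
  intro F
  have hfS : ∀ i, f i ∈ S := fun i => (hf.mem_iff _).2 ⟨i, rfl⟩
  have hgT : ∀ i, g i ∈ T := fun i => (hg.mem_iff _).2 ⟨i, rfl⟩
  have hxf : ∀ i, x ≠ f i := fun i he => hcut.left (he ▸ hfS i)
  have hxg : ∀ i, x ≠ g i := fun i he => hcut.right (he ▸ hgT i)
  have hfg : ∀ i j, f i ≠ g j := fun i j he =>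
    Finset.disjoint_left.1 hcut.disj (hfS i) (he ▸ hgT j)
  refine ⟨⟨?_, ?_⟩, ?_⟩
  · rintro (_ | i | i) (_ | j | j) h
    · rfl
    · exact absurd h (hxf j)
    · exact absurd h (hxg j)
    · exact absurd h.symm (hxf i)
    · rw [hf.inj h]
    · exact absurd h (hfg i j)
    · exact absurd h.symm (hxg i)
    · exact absurd h.symm (hfg j i)
    · rw [hg.inj h]
  · intro w
    rcases hcut.cover w with rfl | hw | hw
    · exact ⟨none, rfl⟩
    · obtain ⟨i, rfl⟩ := (hf.mem_iff w).1 hw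
      exact ⟨some (Sum.inl i), rfl⟩
    · obtain ⟨i, rfl⟩ := (hg.mem_iff w).1 hw
      exact ⟨some (Sum.inr i), rfl⟩
  · rintro (_ | i | i) (_ | j | j) h
    · exact iff_of_false (G.loopless.irrefl x) (by simp [joinTable])
    · have hl : l₁ j = true := by simpa [joinTable] using h
      exact iff_of_true (hl₁ j hl).symm hl
    · have hl : l₂ j = true := by simpa [joinTable] using h
      exact iff_of_true (hl₂ j hl).symm hl
    · have hl : l₁ i = true := by simpa [joinTable] using h
      exact iff_of_true (hl₁ i hl) hl
    · exact hf.adj i j h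
    · exact iff_of_false (hcut.not_adj _ (hfS i) _ (hgT j)) (by simp [joinTable])
    · have hl : l₂ i = true := by simpa [joinTable] using h
      exact iff_of_true (hl₂ i hl) hl
    · exact iff_of_false (hcut.symm.not_adj _ (hgT i) _ (hfS j)) (by simp [joinTable])
    · exact hg.adj i j h

/-- The adjacency table of the members of `F11`. -/
abbrev table11 := joinTable tableF5 tableF5 lowF5 lowF5

/-- The pairs on which the members of `F11` may differ. -/
abbrev optional11 : Option (Fin 5 ⊕ Fin 5) → Option (Fin 5 ⊕ Fin 5) → Bool :=
  joinTable (fun _ _ => false) (fun _ _ => false) (fun i => !lowF5 i) (fun i => !lowF5 i)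

/-- The adjacency table of the members of `F12`. -/
abbrev table12 := joinTable tableF5 (tableH 2 2) lowF5 (lowH 2 2)

/-- The pairs on which the members of `F12` may differ. -/
abbrev optional12 : Option (Fin 5 ⊕ HVertex 2 2) → Option (Fin 5 ⊕ HVertex 2 2) → Bool :=
  joinTable (fun _ _ => false) (optionalH 2 2) (fun i => !lowF5 i) (fun i => !lowH 2 2 i)

/-- `G` is a member of `F12`, in terms of its adjacency table. -/
def Models12 (G : SimpleGraph V) : Prop :=
  ∃ F : Option (Fin 5 ⊕ HVertex 2 2) → V, Function.Bijective F ∧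
    (∀ p q, optional12 p q = false → (G.Adj (F p) (F q) ↔ table12 p q = true)) ∧
    (G.Adj (F none) (F (some (Sum.inr (Sum.inl 1)))) ∨
      G.Adj (F (some (Sum.inr (Sum.inl 0)))) (F (some (Sum.inr (Sum.inl 1)))))

/-- The exceptional graphs in the class given by `δ` and `D`. -/
def Exc (G : SimpleGraph V) (δ D : ℕ) : Prop :=
  (δ = 2 ∧ ExcTwo G D) ∨ (δ = 3 ∧ D = 3 ∧ (Models G table11 optional11 ∨ Models12 G))

/-- Conditions on an adjacency table under which the vertices marked by `l` have a common outside
neighbour when the graph is induced in a graph of minimum degree `δ` and degree sum `σ`. -/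
structure Rigid {ι : Type*} [Fintype ι] (E O : ι → ι → Bool) (l : ι → Bool) (δ σ : ℕ) :
    Prop where
  hub : ∃ h, ∀ i, i = h ∨ (O i h = false ∧ E i h = true) ∨
    ∃ j, (O i j = false ∧ E i j = true) ∧ (O j h = false ∧ E j h = true)
  low_opt : ∀ i, l i = true → ∀ j, O i j = false
  low_deg : ∀ i, l i = true → (Finset.univ.filter fun j => E i j = true).card < δ ∨
    ∃ c, l c = true ∧ i ≠ c ∧ E i c = false ∧
      (Finset.univ.filter fun j => E i j = true).card +
        (Finset.univ.filter fun j => E c j = true).card + 1 < σ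
  dom : ∀ i, l i = false → ∃ j k, j ≠ k ∧ l j = true ∧ l k = true ∧ E j i = true ∧ E k i = true
  low_exists : ∃ i, l i = true

theorem ModelsOn.inner_degree {S : Finset V} {ι : Type*} [Fintype ι] {E O : ι → ι → Bool}
    {f : ι → V} (h : ModelsOn G S E O f) {i : ι} (hi : ∀ j, O i j = false) :
    (G.neighborFinset (f i) ∩ S).card = (Finset.univ.filter fun j => E i j = true).card := by
  rw [← Finset.card_image_of_injective _ h.inj]
  congr 1
  ext w
  simp only [Finset.mem_inter, SimpleGraph.mem_neighborFinset, Finset.mem_image,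
    Finset.mem_filter, Finset.mem_univ, true_and]
  constructor
  · rintro ⟨hadj, hw⟩
    obtain ⟨j, rfl⟩ := (h.mem_iff w).1 hw
    exact ⟨j, (h.adj i j (hi j)).1 hadj, rfl⟩
  · rintro ⟨j, hj, rfl⟩
    exact ⟨(h.adj i j (hi j)).2 hj, (h.mem_iff _).2 ⟨j, rfl⟩⟩

theorem card_inter_add_sdiff (S : Finset V) (v : V) :
    (G.neighborFinset v ∩ S).card + (G.neighborFinset v \ S).card = G.degree v := by
  rw [Finset.card_inter_add_card_sdiff, G.card_neighborFinset_eq_degree]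

/-- Removing a block costs every other vertex at most one neighbour, by `IsBlock.attach_unique` for
a singleton. -/
theorem IsBlock.card_sdiff_le {B : Finset V} (hB : IsBlock G B) {v : V} (hv : v ∉ B) :
    (G.neighborFinset v \ (Finset.univ \ B)).card ≤ 1 := by
  rw [Finset.card_le_one]
  intro a ha b hb
  simp only [Finset.mem_sdiff, SimpleGraph.mem_neighborFinset, Finset.mem_univ, true_and,
    not_not] at ha hb
  exact hB.attach_unique (conn_singleton v) (Finset.disjoint_singleton_left.2 hv) ha.2 hb.2
    (Finset.mem_singleton_self v) (Finset.mem_singleton_self v) ha.1.symm hb.1.symm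

/-- A rigid graph outside a block is attached to a single vertex of the block. -/
theorem OreClass.exists_attach (h : OreClass G δ D) {B : Finset V} (hB : IsBlock G B)
    {ι : Type*} [Fintype ι] {E O : ι → ι → Bool} {l : ι → Bool} {f : ι → V}
    (hf : ModelsOn G (Finset.univ \ B) E O f) (hr : Rigid E O l δ (δ + D)) :
    ∃ x ∈ B, (∀ i, l i = true → G.Adj (f i) x) ∧ Cut G x (Finset.univ \ B) (B.erase x) ∧
      NS G (insert x (Finset.univ \ B)) := by
  set S := Finset.univ \ B with hS
  have hfS : ∀ i, f i ∈ S := fun i => (hf.mem_iff _).2 ⟨i, rfl⟩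
  have hSB : ∀ w, w ∈ S ↔ w ∉ B := fun w => by simp [hS]
  have hconn : Conn G S := by
    obtain ⟨c, hc⟩ := hr.hub
    refine conn_of_base (f c) fun w hw => ?_
    obtain ⟨i, rfl⟩ := (hf.mem_iff w).1 hw
    rcases hc i with rfl | ⟨h1, h2⟩ | ⟨j, ⟨h1, h2⟩, h3, h4⟩
    · exact ⟨{f i}, by simpa using hfS i, conn_singleton _, by simp, by simp⟩
    · refine ⟨{f i, f c}, ?_, conn_pair ((hf.adj i c h1).2 h2), by simp, by simp⟩
      simp [Finset.insert_subset_iff, hfS]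
    · refine ⟨insert (f i) {f j, f c}, ?_, (conn_pair ((hf.adj j c h3).2 h4)).insert_adj
        (a := f j) (by simp) ((hf.adj i j h1).2 h2).symm, by simp, by simp⟩
      simp [Finset.insert_subset_iff, hfS]
  have hdS : Disjoint S B := Finset.sdiff_disjoint
  have hatt : ∀ s ∈ S, ∀ t ∈ S, ∀ a ∈ B, ∀ b ∈ B, G.Adj s a → G.Adj t b → a = b :=
    fun s hs t ht a ha b hb hsa htb =>
      hB.attach_unique hconn hdS ha hb hs ht hsa.symm htb.symm
  have hout : ∀ i, l i = true → ∃ b ∈ B, G.Adj (f i) b := by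
    intro i hi
    by_contra hcon
    push Not at hcon
    have h0 : (G.neighborFinset (f i) \ S).card = 0 := by
      rw [Finset.card_eq_zero, Finset.sdiff_eq_empty_iff_subset]
      intro w hw
      rw [hSB]
      exact fun hwB => hcon w hwB ((G.mem_neighborFinset _ _).1 hw)
    have h1 := card_inter_add_sdiff (G := G) S (f i)
    have h2 := hf.inner_degree (hr.low_opt i hi)
    rcases hr.low_deg i hi with h3 | ⟨c, hc, hic, hE, h3⟩
    · have := h.min_le (f i)
      omega
    · have h4 := card_inter_add_sdiff (G := G) S (f c)
      have h5 := hf.inner_degree (hr.low_opt c hc)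
      have h6 := hB.card_sdiff_le ((hSB _).1 (hfS c))
      rw [← hS] at h6
      have h7 := h.ore (f i) (f c) (hf.inj.ne hic) (by
        rw [hf.adj i c (hr.low_opt i hi c), hE]
        simp)
      omega
  obtain ⟨i₀, hi₀⟩ := hr.low_exists
  obtain ⟨x, hx, hix⟩ := hout i₀ hi₀
  have hlow : ∀ i, l i = true → G.Adj (f i) x := by
    intro i hi
    obtain ⟨b, hb, hib⟩ := hout i hi
    rwa [← hatt _ (hfS i) _ (hfS i₀) b hb x hx hib hix]
  have hxS : x ∉ S := fun h => (hSB x).1 h hx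
  refine ⟨x, hx, hlow, ⟨hxS, Finset.notMem_erase _ _, hdS.mono_right (Finset.erase_subset _ _),
    fun w => ?_, fun s hs b hb hsb => ?_⟩, hconn.insert_adj (hfS i₀) hix, fun c => ?_⟩
  · rw [hSB, Finset.mem_erase]
    tauto
  · rw [Finset.mem_erase] at hb
    exact hb.1 (hatt s hs _ (hfS i₀) b hb.2 x hx hsb hix)
  · by_cases hcx : c = x
    · rwa [hcx, Finset.erase_insert hxS]
    refine conn_of_base x fun w hw => ?_
    rw [Finset.mem_erase, Finset.mem_insert] at hw
    have hxm : x ∈ (insert x S).erase c := by simp [Ne.symm hcx]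
    rcases hw.2 with rfl | hwS
    · exact ⟨{w}, by simpa using hw.1, conn_singleton _, by simp, by simp⟩
    obtain ⟨i, rfl⟩ := (hf.mem_iff w).1 hwS
    have him : f i ∈ (insert x S).erase c := by simp [hw.1, hfS]
    by_cases hi : l i = true
    · refine ⟨{f i, x}, ?_, conn_pair (hlow i hi), by simp, by simp⟩
      exact Finset.insert_subset him (Finset.singleton_subset_iff.2 hxm)
    · rw [Bool.not_eq_true] at hi
      -- A vertex that is not low has two low neighbours, and one of them survives the deletion of
      -- `c` and leads to `x`.
      obtain ⟨j, k, hjk, hj, hk, hji, hki⟩ := hr.dom i hi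
      obtain ⟨m, hm, hmi, hmc⟩ : ∃ m, l m = true ∧ E m i = true ∧ f m ≠ c := by
        by_cases hjc : f j = c
        · exact ⟨k, hk, hki, fun he => hjk (hf.inj (hjc.trans he.symm))⟩
        · exact ⟨j, hj, hji, hjc⟩
      refine ⟨insert (f i) {f m, x}, ?_, (conn_pair (hlow m hm)).insert_adj (a := f m) (by simp)
        ((hf.adj m i (hr.low_opt m hm i)).2 hmi), by simp, by simp⟩
      refine Finset.insert_subset him (Finset.insert_subset ?_ (Finset.singleton_subset_iff.2 hxm))
      simp [hmc, hfS]

theorem rigid_F5 : Rigid tableF5 (fun _ _ => false) lowF5 3 6 :=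
  ⟨by decide, by decide, by decide, by decide, by decide⟩

theorem rigid_H2 : Rigid (tableH 2 2) (optionalH 2 2) (lowH 2 2) 3 6 :=
  ⟨by decide, by decide, by decide, by decide, by decide⟩

/-- The vertices of `S₁` and `S₂` already have degree 3, so the minimum degree does not force an
outside neighbour. The degree sum with c₁ does: 3 + 2 + 1 < 7. -/
theorem rigid_H3 : Rigid (tableH 3 3) (optionalH 3 3) (lowH 3 3) 3 7 :=
  ⟨by decide, by decide, by decide, by decide, by decide⟩

theorem rigid_11 : Rigid table11 optional11 (lowJoin lowF5 lowF5) 4 8 :=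
  ⟨by decide, by decide, by decide, by decide, by decide⟩

set_option synthInstance.maxHeartbeats 400000 in
set_option synthInstance.maxSize 1000 in
theorem rigid_12 : Rigid table12 optional12 (lowJoin lowF5 (lowH 2 2)) 4 8 :=
  ⟨by decide, by decide, by decide, by decide, by decide⟩

end Induction

/-! ### The inductive step -/

section Step

universe u

variable {V : Type u} [DecidableEq V] [Fintype V] {G : SimpleGraph V} [DecidableRel G.Adj]
variable {δ D : ℕ}

theorem OreClass.sub_class (h : OreClass G (δ + 1) (D + 1)) {S : Finset V}
    (hout : ∀ v ∈ S, (G.neighborFinset v \ S).card ≤ 1) (hc : S.card ≤ δ * (D + 1)) :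
    OreClass (sub G S) δ D := by
  have hdeg : ∀ v : {x // x ∈ S}, G.degree v ≤ (sub G S).degree v + 1 := by
    intro v
    rw [sub_degree, ← card_inter_add_sdiff S]
    exact Nat.add_le_add_left (hout v v.2) _
  refine ⟨fun v => ?_, fun v w hne hadj => ?_, by have := h.le; omega, by simpa using hc⟩
  · have := h.min_le v
    have := hdeg v
    omega
  · have := h.ore v w (fun he => hne (Subtype.ext he)) hadj
    have := hdeg v
    have := hdeg w
    omega

theorem Good.of_sub {σ : ℕ} {S : Finset V} (h : Good (sub G S) σ) :
    ∃ Q, IsCover G Q S ∧ (Q.card ≤ 1 ∨ Q.card * σ ≤ 2 * (S.card - 1)) := by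
  obtain ⟨P, hP, hc⟩ := h
  obtain ⟨Q, hQ, hle⟩ := hP.of_sub
  rw [Fintype.card_coe] at hc
  exact ⟨Q, hQ, hc.imp hle.trans (Nat.mul_le_mul_right σ hle).trans⟩

theorem Good.mono {σ τ : ℕ} (h : Good G σ) (hle : τ ≤ σ) : Good G τ := by
  obtain ⟨P, hP, hc⟩ := h
  exact ⟨P, hP, hc.imp_right (Nat.mul_le_mul_left _ hle).trans⟩

/-- Adding one part to a cover of the complement. -/
theorem good_of_insert {A S : Finset V} {Q : Finset (Finset V)} {σ : ℕ} (hA : NS G A)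
    (h3 : 3 ≤ A.card) (hQ : IsCover G Q S) (hd : Disjoint A S) (hun : ∀ w, w ∈ A ∨ w ∈ S)
    (hc : (Q.card + 1) * σ ≤ 2 * (Fintype.card V - 1)) : Good G σ := by
  refine ⟨{A} ∪ Q, ?_, Or.inr ?_⟩
  · convert (isCover_singleton hA h3).union hQ hd using 1
    ext w
    simpa using hun w
  · have := Finset.card_union_le {A} Q
    rw [Finset.card_singleton] at this
    exact (Nat.mul_le_mul_right σ (by omega)).trans hc

/-- With σ = δ + D, passing from |Q| parts and σ to |Q| + 1 parts and σ + 2 costs 2|Q| + σ + 2,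
while `B` adds 2|B| ≥ 2(σ + 2) to the available amount. So 2|Q| ≤ σ + 2 suffices. -/
theorem OreClass.good_of_block (h : OreClass G (δ + 1) (D + 1)) (hδ : 2 ≤ δ) {B : Finset V}
    (hB : IsBlock G B) (hc : δ + D + 2 ≤ B.card)
    (hS : (Finset.univ \ B).card ≤ δ * (D + 1)) (hne : 0 < (Finset.univ \ B).card)
    (hG : Good (sub G (Finset.univ \ B)) (δ + D)) : Good G (δ + D + 2) := by
  obtain ⟨Q, hQ, hk⟩ := hG.of_sub
  have hle := h.le
  refine good_of_insert hB.1 (by omega) hQ Finset.disjoint_sdiff (fun w => by simp; tauto) ?_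
  have hn : (Finset.univ \ B).card + B.card = Fintype.card V := by
    rw [Finset.card_sdiff_add_card_eq_card (Finset.subset_univ _), Finset.card_univ]
  rcases hk with hk | hk
  · have := Nat.mul_le_mul_right (δ + D + 2) (Nat.add_le_add_right hk 1)
    omega
  · have h1 : 2 * Q.card ≤ δ + D + 2 := by
      -- Otherwise |Q|σ ≤ 2δ(D + 1) - 2 contradicts (δ + D)² ≥ 4δD and δ ≤ D.
      by_contra hcon
      have h2 : Q.card * (δ + D) + 2 ≤ 2 * (δ * (D + 1)) := by omega
      have h3 : δ + D + 3 ≤ 2 * Q.card := by omega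
      obtain ⟨e, rfl⟩ : ∃ e, D = δ + e := ⟨D - δ, by omega⟩
      have h4 := Nat.mul_le_mul_right (δ + (δ + e)) h3
      nlinarith
    have h2 : (Q.card + 1) * (δ + D + 2) = Q.card * (δ + D) + 2 * Q.card + (δ + D + 2) := by ring
    omega

/-- One side of a cut, together with the cut vertex, is taken as a part. -/
theorem OreClass.good_of_attach (h : OreClass G (δ + 1) (D + 1)) (hδ : 2 ≤ δ) {x : V}
    {S T : Finset V} (hcut : Cut G x S T) (hns : NS G (insert x S)) (hS : 2 ≤ S.card)
    (hT : T.card ≤ δ * (D + 1)) (h1 : 2 * T.card < 3 * (δ + D) + 2)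
    (h2 : 3 * (δ + D + 2) ≤ 2 * (Fintype.card V - 1))
    (ih : OreClass (sub G T) δ D → Good (sub G T) (δ + D) ∨ Exc (sub G T) δ D) :
    Good G (δ + D + 2) ∨ Exc (sub G T) δ D := by
  have hcls : OreClass (sub G T) δ D := by
    refine h.sub_class (fun v hv => ?_) hT
    rw [← Finset.card_singleton x]
    refine Finset.card_le_card fun w hw => ?_
    rw [Finset.mem_sdiff, SimpleGraph.mem_neighborFinset] at hw
    exact Finset.mem_singleton.2 ((hcut.symm.mem hv hw.1).resolve_right hw.2)
  refine (ih hcls).imp_left fun hG => ?_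
  obtain ⟨Q, hQ, hk⟩ := hG.of_sub
  refine good_of_insert hns ?_ hQ ?_ (fun w => ?_) ?_
  · rw [Finset.card_insert_of_notMem hcut.left]
    omega
  · exact Finset.disjoint_insert_left.2 ⟨hcut.right, hcut.disj⟩
  · rw [Finset.mem_insert]
    have := hcut.cover w
    tauto
  · have hk2 : Q.card ≤ 2 := by
      by_contra hcon
      have := Nat.mul_le_mul_right (δ + D) (show 3 ≤ Q.card by omega)
      omega
    exact (Nat.mul_le_mul_right _ (show Q.card + 1 ≤ 3 by omega)).trans h2

theorem Cut.adj_of_low {x : V} {S T : Finset V} (hcut : Cut G x S T) (hmin : ∀ v, 3 ≤ G.degree v)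
    {ι : Type*} [Fintype ι] {E O : ι → ι → Bool} {g : ι → V} (hg : ModelsOn G S E O g) {i : ι}
    (hO : ∀ j, O i j = false) (hd : (Finset.univ.filter fun j => E i j = true).card < 3) :
    G.Adj (g i) x := by
  by_contra hcon
  have h1 := (hcut.degree_le_inner ((hg.mem_iff _).2 ⟨i, rfl⟩)).2 hcon
  have h2 := hg.inner_degree hO
  have := hmin (g i)
  omega

theorem lowF5_card : ∀ i, lowF5 i = true →
    (Finset.univ.filter fun j => tableF5 i j = true).card < 3 := by decide

theorem lowH_card : ∀ i, lowH 2 2 i = true →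
    (Finset.univ.filter fun j => tableH 2 2 i j = true).card < 3 := by decide

theorem optionalH_b : ∀ j, optionalH 2 2 (Sum.inl 1) j = true → j = Sum.inl 0 := by decide

theorem tableH_b :
    (Finset.univ.filter fun j => tableH 2 2 (Sum.inl 1) j = true).card = 2 := by decide

/-- The vertex b of H_{2,2} has only two certain neighbours, so minimum degree three forces an
optional edge from b to `x` or to a. This is the condition that L meets {ac₉, b₂c₉}. -/
theorem models12_of_cut {x : V} {S T : Finset V} (hcut : Cut G x S T)
    (hmin : ∀ v, 3 ≤ G.degree v) {f : Fin 5 → V} {g : HVertex 2 2 → V}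
    (hf : ModelsOn G S tableF5 (fun _ _ => false) f)
    (hg : ModelsOn G T (tableH 2 2) (optionalH 2 2) g) : Models12 G := by
  obtain ⟨h1, h2⟩ := hf.join (l₁ := lowF5) (l₂ := lowH 2 2) hcut hg
    (fun i hi => hcut.adj_of_low hmin hf (rigid_F5.low_opt i hi) (lowF5_card i hi))
    (fun i hi => hcut.symm.adj_of_low hmin hg (rigid_H2.low_opt i hi) (lowH_card i hi))
  refine ⟨_, h1, h2, ?_⟩
  by_contra hcon
  push Not at hcon
  have hb : g (Sum.inl 1) ∈ T := (hg.mem_iff _).2 ⟨_, rfl⟩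
  have h3 := (hcut.symm.degree_le_inner hb).2 fun hadj => hcon.1 hadj.symm
  have h4 : G.neighborFinset (g (Sum.inl 1)) ∩ T ⊆
      (Finset.univ.filter fun j => tableH 2 2 (Sum.inl 1) j = true).image g := by
    intro w hw
    rw [Finset.mem_inter, SimpleGraph.mem_neighborFinset] at hw
    obtain ⟨j, rfl⟩ := (hg.mem_iff w).1 hw.2
    refine Finset.mem_image_of_mem g (Finset.mem_filter.2 ⟨Finset.mem_univ _, ?_⟩)
    refine (hg.adj _ j ?_).1 hw.1
    by_contra hO
    rw [Bool.not_eq_false] at hO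
    rw [optionalH_b j hO] at hw
    exact hcon.2 hw.1.symm
  have h5 := (Finset.card_le_card h4).trans Finset.card_image_le
  rw [tableH_b] at h5
  have := hmin (g (Sum.inl 1))
  omega

theorem models11_of_cut {x : V} {S T : Finset V} (hcut : Cut G x S T)
    (hmin : ∀ v, 3 ≤ G.degree v) {f g : Fin 5 → V}
    (hf : ModelsOn G S tableF5 (fun _ _ => false) f)
    (hg : ModelsOn G T tableF5 (fun _ _ => false) g) : Models G table11 optional11 := by
  obtain ⟨h1, h2⟩ := hf.join (l₁ := lowF5) (l₂ := lowF5) hcut hg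
    (fun i hi => hcut.adj_of_low hmin hf (rigid_F5.low_opt i hi) (lowF5_card i hi))
    (fun i hi => hcut.symm.adj_of_low hmin hg (rigid_F5.low_opt i hi) (lowF5_card i hi))
  exact ⟨_, h1, h2⟩

theorem excTwo_sub {S : Finset V} (h : Exc (sub G S) 2 2) :
    (∃ f, ModelsOn G S tableF5 (fun _ _ => false) f) ∨
      ∃ f, ModelsOn G S (tableH 2 2) (optionalH 2 2) f := by
  rcases h with ⟨-, ⟨-, h⟩ | ⟨-, h⟩⟩ | ⟨h, -⟩
  · exact Or.inl h.of_sub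
  · exact Or.inr h.of_sub
  · omega

/-- The orders alone decide which pairs of exceptional sides can occur in the inductive step. -/
theorem Exc.card_mem (h : Exc G δ D) :
    (δ = 2 ∧ D = 2 ∧ (Fintype.card V = 5 ∨ Fintype.card V = 6)) ∨
      (δ = 2 ∧ D = 3 ∧ Fintype.card V = 8) ∨
      (δ = 3 ∧ D = 3 ∧ (Fintype.card V = 11 ∨ Fintype.card V = 12)) := by
  rcases h with ⟨h1, ⟨rfl, f, hf, -⟩ | ⟨rfl | rfl, f, hf, -⟩⟩ | ⟨h1, h2, ⟨f, hf, -⟩ | ⟨f, hf, -⟩⟩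
  all_goals
    have := Fintype.card_of_bijective hf
    simp at this
    omega

/-- The inductive step: passing from the class of `δ` and `D` to the next one. -/
theorem OreClass.step (h : OreClass G (δ + 1) (D + 1)) (hδ : 2 ≤ δ)
    (ih : ∀ S : Finset V, S.card < Fintype.card V → OreClass (sub G S) δ D →
      Good (sub G S) (δ + D) ∨ Exc (sub G S) δ D) :
    Good G (δ + 1 + (D + 1)) ∨ Exc G (δ + 1) (D + 1) := by
  have hσ : δ + 1 + (D + 1) = δ + D + 2 := by omega
  have hle := h.le
  by_cases hsmall : ∀ B, IsBlock G B → B.card < δ + 1 + (D + 1)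
  · exact Or.inl (h.good_of_small_blocks (by omega) hsmall)
  push Not at hsmall
  obtain ⟨B, hB, hBc⟩ := hsmall
  rw [hσ] at hBc ⊢
  have hn : (Finset.univ \ B).card + B.card = Fintype.card V := by
    rw [Finset.card_sdiff_add_card_eq_card (Finset.subset_univ _), Finset.card_univ]
  have hcard := h.card_le
  rcases Nat.eq_zero_or_pos (Finset.univ \ B).card with hS0 | hS0
  · have : B = Finset.univ := by
      rw [Finset.card_eq_zero, Finset.sdiff_eq_empty_iff_subset] at hS0
      exact Finset.univ_subset_iff.1 hS0
    exact Or.inl (good_one (this ▸ hB.1) (by omega))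
  have hSc : (Finset.univ \ B).card ≤ δ * (D + 1) := by
    have : (δ + 1) * (D + 1 + 1) = δ * (D + 1) + (δ + D + 2) := by ring
    omega
  have hcls := h.sub_class (S := Finset.univ \ B) (fun v hv => hB.card_sdiff_le (by
    simpa using hv)) hSc
  rcases ih _ (by omega) hcls with hG | hE
  · exact Or.inl (h.good_of_block hδ hB hBc hSc hS0 hG)
  -- The order of the exceptional side together with |V| ≤ (δ + 1)(D + 2) bounds |B - x| from above,
  -- and `B - x` can be exceptional too only for δ = D = 2.
  have hkey : ∀ x ∈ B, Cut G x (Finset.univ \ B) (B.erase x) → NS G (insert x (Finset.univ \ B)) →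
      Good G (δ + D + 2) ∨ (δ = 2 ∧ D = 2 ∧ Exc (sub G (B.erase x)) 2 2) := by
    intro x hx hcut hns
    have hTc := Finset.card_erase_of_mem hx
    have hE' := hE.card_mem
    rw [Fintype.card_coe] at hE'
    have hlt : (B.erase x).card < Fintype.card V := by omega
    rcases hE' with ⟨rfl, rfl, hc⟩ | ⟨rfl, rfl, hc⟩ | ⟨rfl, rfl, hc⟩ <;>
      rcases h.good_of_attach hδ hcut hns (by omega) (by omega) (by omega) (by omega)
        (ih _ hlt) with h1 | h1
    · exact Or.inl h1
    · exact Or.inr ⟨rfl, rfl, h1⟩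
    · exact Or.inl h1
    · have := h1.card_mem
      rw [Fintype.card_coe] at this
      omega
    · exact Or.inl h1
    · have := h1.card_mem
      rw [Fintype.card_coe] at this
      omega
  have hattach : ∃ x ∈ B, Cut G x (Finset.univ \ B) (B.erase x) ∧
      NS G (insert x (Finset.univ \ B)) := by
    rcases hE with ⟨rfl, ⟨rfl, h1⟩ | ⟨rfl | rfl, h1⟩⟩ | ⟨rfl, rfl, h1 | ⟨f, h1, h2, -⟩⟩
    · obtain ⟨f, hf⟩ := h1.of_sub
      obtain ⟨x, hx, -, h2⟩ := h.exists_attach hB hf rigid_F5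
      exact ⟨x, hx, h2⟩
    · obtain ⟨f, hf⟩ := h1.of_sub
      obtain ⟨x, hx, -, h2⟩ := h.exists_attach hB hf rigid_H2
      exact ⟨x, hx, h2⟩
    · obtain ⟨f, hf⟩ := h1.of_sub
      obtain ⟨x, hx, -, h2⟩ := h.exists_attach hB hf rigid_H3
      exact ⟨x, hx, h2⟩
    · obtain ⟨f, hf⟩ := h1.of_sub
      obtain ⟨x, hx, -, h2⟩ := h.exists_attach hB hf rigid_11
      exact ⟨x, hx, h2⟩
    · obtain ⟨f, hf⟩ := Models.of_sub ⟨f, h1, h2⟩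
      obtain ⟨x, hx, -, h2⟩ := h.exists_attach hB hf rigid_12
      exact ⟨x, hx, h2⟩
  obtain ⟨x, hx, hcut, hns⟩ := hattach
  rcases hkey x hx hcut hns with h1 | ⟨rfl, rfl, hE2⟩
  · exact Or.inl h1
  refine Or.inr (Or.inr ⟨rfl, rfl, ?_⟩)
  rcases excTwo_sub hE with ⟨f, hf⟩ | ⟨f, hf⟩ <;> rcases excTwo_sub hE2 with ⟨g, hg⟩ | ⟨g, hg⟩
  · exact Or.inl (models11_of_cut hcut h.min_le hf hg)
  · exact Or.inr (models12_of_cut hcut h.min_le hf hg)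
  · exact Or.inr (models12_of_cut hcut.symm h.min_le hg hf)
  -- Two sides of order 6 and `x` make 13 vertices, more than the 3 · 4 allowed.
  · have h1 := hf.card_eq
    have h2 := hg.card_eq
    have h3 := hcut.card
    simp at h1 h2
    omega

end Step

/-! ### The induction on the order -/

section Main

universe u

theorem OreClass.good_or_exc (n : ℕ) : ∀ (V : Type u) [DecidableEq V] [Fintype V]
    (G : SimpleGraph V) [DecidableRel G.Adj] (δ D : ℕ), Fintype.card V = n → 2 ≤ δ →
    OreClass G δ D → Good G (δ + D) ∨ Exc G δ D := by
  induction n using Nat.strong_induction_on with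
  | _ n ih =>
    intro V _ _ G _ δ D hV hδ h
    have ih' : ∀ δ' D', 2 ≤ δ' → ∀ S : Finset V, S.card < Fintype.card V →
        OreClass (sub G S) δ' D' → Good (sub G S) (δ' + D') ∨ Exc (sub G S) δ' D' :=
      fun δ' D' hδ' S hS hcls => ih S.card (hV ▸ hS) _ _ δ' D' (Fintype.card_coe S) hδ' hcls
    obtain ⟨D, rfl⟩ : ∃ D', D = D' + 1 := ⟨D - 1, by have := h.le; omega⟩
    obtain rfl | hδ3 := hδ.eq_or_lt
    · by_cases hv : ∃ v, G.degree v = 2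
      · obtain ⟨v, hv⟩ := hv
        exact (h.good_or_excTwo hv).imp_right fun hE => Or.inl ⟨rfl, hE⟩
      push Not at hv
      have hmin : ∀ v, 3 ≤ G.degree v := fun v => by
        have := h.min_le v
        have := hv v
        omega
      have hcard := h.card_le
      -- The original second parameter is now written D + 1, and 2 + (D + 1) = 3 + D. The new one is
      -- max(3, D); where this exceeds D, the degree sum 6 comes from the minimum degree alone.
      have hcls : OreClass G (2 + 1) (max 2 (D - 1) + 1) := by
        refine ⟨hmin, fun u v hne hadj => ?_, by omega, by omega⟩
        have := h.ore u v hne hadj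
        have := hmin u
        have := hmin v
        omega
      rcases hcls.step le_rfl (ih' _ _ le_rfl) with hG | hE
      · exact Or.inl (hG.mono (by omega))
      -- An exception with δ = 3 has at least 11 vertices and occurs only for D ≤ 3, where |V| ≤ 2(D
      -- + 2) ≤ 10.
      · have := hE.card_mem
        omega
    · obtain ⟨δ, rfl⟩ : ∃ δ', δ = δ' + 1 := ⟨δ - 1, by omega⟩
      exact h.step (by omega) (ih' _ _ (by omega))

end Main

/-! ### Translation to connected subgraphs, partitions and isomorphisms -/

section Conversion

variable {V : Type*} [DecidableEq V] [Fintype V] {G : SimpleGraph V}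

theorem Conn.induce_connected {A T : Finset V} (hT : Conn G T) (hne : T.Nonempty)
    (hTA : T ⊆ A) {S : Set (A : Set V)} (hS : ∀ v : (A : Set V), (v : V) ∈ T ↔ v ∉ S) :
    ((G.induce (A : Set V)).induce Sᶜ).Connected := by
  classical
  have hmem : ∀ v (hv : v ∈ T), (⟨v, hTA hv⟩ : (A : Set V)) ∈ Sᶜ := fun v hv => (hS ⟨v, hTA hv⟩).1 hv
  obtain ⟨t, ht⟩ := hne
  have : Nonempty (Sᶜ : Set (A : Set V)) := ⟨⟨_, hmem t ht⟩⟩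
  refine ⟨fun u w => ?_⟩
  have h := hT (T.filter fun v => ∀ hv : v ∈ T,
      ((G.induce (A : Set V)).induce Sᶜ).Reachable u ⟨⟨v, hTA hv⟩, hmem v hv⟩)
    (Finset.filter_subset _ _) ?_ ?_
  · have hw : (w : V) ∈ T := (hS w).2 w.2
    have hw' := hw
    rw [← h] at hw'
    exact (Finset.mem_filter.1 hw').2 hw
  · refine ⟨u, Finset.mem_filter.2 ⟨(hS u).2 u.2, fun hv => ?_⟩⟩
    exact SimpleGraph.Reachable.refl _
  · intro a ha b hb hab
    rw [Finset.mem_filter] at ha ⊢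
    refine ⟨hb, fun hv => (ha.2 ha.1).trans (SimpleGraph.Adj.reachable ?_)⟩
    exact hab

theorem NS.isKConnected {A : Finset V} (hA : NS G A) (h3 : 3 ≤ A.card) :
    IsKConnected 2 (G.induce (A : Set V)) := by
  refine ⟨?_, fun S hS => ?_⟩
  · rw [ENat.card_coe_set_eq, Set.encard_coe_eq_coe_finsetCard]
    exact_mod_cast h3
  · have hS1 : S.encard ≤ 1 := by
      rw [← ENat.lt_add_one_iff (by simp)]
      exact hS
    rcases Set.encard_le_one_iff_eq.1 hS1 with rfl | ⟨c, rfl⟩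
    · exact hA.1.induce_connected (Finset.card_pos.1 (by omega)) subset_rfl (fun v => by simp)
    · refine (hA.2 c).induce_connected (Finset.card_pos.1 ?_) (Finset.erase_subset _ _)
        (fun v => by
          rw [Finset.mem_erase, Set.mem_singleton_iff, Ne, Subtype.ext_iff]
          exact and_iff_left v.2)
      have := Finset.pred_card_le_card_erase (s := A) (a := (c : V))
      omega

theorem IsCover.exists_partition {P : Finset (Finset V)} (h : IsCover G P Finset.univ) :
    ∃ Q : Finpartition (Finset.univ : Finset V), IsProperPartition 2 G Q ∧ Q.parts = P := by
  refine ⟨Finpartition.ofExistsUnique P (fun _ _ => Finset.subset_univ _) (fun v hv => ?_) ?_,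
    fun A hA => (h.ns A hA).1.isKConnected (h.ns A hA).2, rfl⟩
  · obtain ⟨A, hA, hvA⟩ := (h.mem_iff v).1 hv
    refine ⟨A, ⟨hA, hvA⟩, fun B hB => ?_⟩
    by_contra hne
    exact Finset.disjoint_left.1 (h.disj B hB.1 A hA hne) hB.2 hvA
  · intro he
    have := (h.ns _ he).2
    simp at this

theorem nonempty_iso_of_comap_eq {W : Type*} {K : SimpleGraph W} {f : W → V}
    (hf : Function.Bijective f) (h : G.comap f = K) : Nonempty (G ≃g K) := by
  subst h
  exact ⟨(SimpleGraph.Iso.comap (Equiv.ofBijective f hf) G).symm⟩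

/-- A graph that is known up to a set of optional edges. -/
theorem eq_fromEdgeSet {W : Type*} {K : SimpleGraph W} {E₀ L : Set (Sym2 W)} {E O : W → W → Bool}
    (h1 : ∀ p q, O p q = false → (K.Adj p q ↔ E p q = true))
    (h2 : ∀ p q, (s(p, q) ∈ E₀ ∧ p ≠ q) ↔ E p q = true)
    (h3 : ∀ p q, O p q = true → s(p, q) ∈ L ∧ E p q = false) :
    K = SimpleGraph.fromEdgeSet (E₀ ∪ (L ∩ K.edgeSet)) := by
  ext p q
  rw [SimpleGraph.fromEdgeSet_adj, Set.mem_union, Set.mem_inter_iff, SimpleGraph.mem_edgeSet]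
  cases hO : O p q
  · have := h1 p q hO
    have := h2 p q
    have : K.Adj p q → p ≠ q := fun h => h.ne
    tauto
  · have h4 := h3 p q hO
    have h5 := h2 p q
    have : K.Adj p q → p ≠ q := fun h => h.ne
    rw [h4.2] at h5
    simp only [Bool.false_eq_true, iff_false] at h5
    tauto

theorem F5_adj (p q : Fin 5) : F5.Adj p q ↔ tableF5 p q = true := by
  rw [F5, SimpleGraph.fromEdgeSet_adj]
  simp only [Set.mem_insert_iff, Set.mem_singleton_iff]
  revert p q
  decide

theorem Models.iso_F5 (h : Models G tableF5 fun _ _ => false) : Nonempty (G ≃g F5) := by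
  obtain ⟨f, hf, hadj⟩ := h
  refine nonempty_iso_of_comap_eq hf ?_
  ext p q
  rw [F5_adj]
  exact hadj p q rfl

theorem H_adj {s t : ℕ} (p q : HVertex s t) :
    (H s t).Adj p q ↔ tableH s t p q = true ∨ optionalH s t p q = true := by
  rw [H, SimpleGraph.fromEdgeSet_adj]
  rcases p with i | i | i <;> rcases q with j | j | j <;>
    simp [tableH, optionalH]
  · revert i j
    decide
  · exact fun h => ⟨i, j, h, Or.inl ⟨rfl, rfl⟩⟩
  · exact fun h => ⟨i, j, h, Or.inl ⟨rfl, rfl⟩⟩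

theorem optionalH_iff {s t : ℕ} (p q : HVertex s t) :
    optionalH s t p q = true ↔ s(p, q) = s(Sum.inl 0, Sum.inl 1) := by
  rcases p with i | i | i <;> rcases q with j | j | j <;> simp [optionalH]

theorem Models.isHEq {s : ℕ} (h : Models G (tableH s s) (optionalH s s)) (hs : 2 ≤ s) :
    IsHEq (2 * s + 2) G := by
  obtain ⟨f, hf, hadj⟩ := h
  refine ⟨s, hs, rfl, ?_⟩
  by_cases hab : G.Adj (f (Sum.inl 0)) (f (Sum.inl 1))
  · refine Or.inl (nonempty_iso_of_comap_eq hf ?_)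
    ext p q
    rw [H_adj]
    cases hO : optionalH s s p q
    · simpa using hadj p q hO
    · rw [optionalH_iff, Sym2.eq_iff] at hO
      rcases hO with ⟨rfl, rfl⟩ | ⟨rfl, rfl⟩
      · simpa using hab
      · simpa using hab.symm
  · refine Or.inr (nonempty_iso_of_comap_eq hf ?_)
    ext p q
    rw [HMinus, SimpleGraph.deleteEdges_adj, H_adj, Set.mem_singleton_iff, ← optionalH_iff]
    cases hO : optionalH s s p q
    · simpa using hadj p q hO
    · rw [optionalH_iff, Sym2.eq_iff] at hO
      rcases hO with ⟨rfl, rfl⟩ | ⟨rfl, rfl⟩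
      · simpa using hab
      · simpa using fun h : G.Adj _ _ => hab h.symm

/-- The vertices of the members of `F11`, as vertices of two copies of `F5` and one more vertex. -/
def toJoin11 : FVertex 8 → Option (Fin 5 ⊕ Fin 5) :=
  Sum.elim ![none, some (Sum.inl 0), some (Sum.inr 0)]
    ![some (Sum.inl 1), some (Sum.inl 2), some (Sum.inl 3), some (Sum.inl 4),
      some (Sum.inr 1), some (Sum.inr 2), some (Sum.inr 3), some (Sum.inr 4)]

theorem toJoin11_bijective : Function.Bijective toJoin11 :=
  (Fintype.bijective_iff_injective_and_card _).2 ⟨by decide, by simp⟩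

theorem toJoin11_optional : ∀ p q, optional11 (toJoin11 p) (toJoin11 q) = true →
    s(p, q) ∈ ({s(va, vb1), s(va, vb2)} : Set (Sym2 (FVertex 8))) ∧
      table11 (toJoin11 p) (toJoin11 q) = false := by
  simp only [Set.mem_insert_iff, Set.mem_singleton_iff]
  decide

theorem toJoin11_table (p q : FVertex 8) :
    (s(p, q) ∈ ({e | ∃ i : Fin 8, e = s(va, vc i)} ∪
     {e | ∃ i : Fin 8, (i : ℕ) < 4 ∧ e = s(vb1, vc i)} ∪
     {e | ∃ i : Fin 8, 4 ≤ (i : ℕ) ∧ e = s(vb2, vc i)} ∪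
     {s(vc 0, vc 1), s(vc 2, vc 3), s(vc 4, vc 5), s(vc 6, vc 7)} : Set (Sym2 (FVertex 8))) ∧
      p ≠ q) ↔ table11 (toJoin11 p) (toJoin11 q) = true := by
  simp only [Set.mem_union, Set.mem_ofPred_eq, Set.mem_insert_iff, Set.mem_singleton_iff]
  revert p q
  decide

theorem Models.isF11 (h : Models G table11 optional11) : IsF11 G := by
  obtain ⟨f, hf, hadj⟩ := h
  refine ⟨_, Set.inter_subset_left, nonempty_iso_of_comap_eq (hf.comp toJoin11_bijective)
    (eq_fromEdgeSet (E := fun p q => table11 (toJoin11 p) (toJoin11 q))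
      (O := fun p q => optional11 (toJoin11 p) (toJoin11 q)) (fun p q => ?_) toJoin11_table
      toJoin11_optional)⟩
  exact hadj (toJoin11 p) (toJoin11 q)

/-- The vertices of the members of `F12`, as vertices of `F5` and `H 2 2` and one more vertex. -/
def toJoin12 : FVertex 9 → Option (Fin 5 ⊕ HVertex 2 2) :=
  Sum.elim ![none, some (Sum.inl 0), some (Sum.inr (Sum.inl 0))]
    ![some (Sum.inl 1), some (Sum.inl 2), some (Sum.inl 3), some (Sum.inl 4),
      some (Sum.inr (Sum.inl 2)), some (Sum.inr (Sum.inl 3)),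
      some (Sum.inr (Sum.inr (Sum.inl 0))), some (Sum.inr (Sum.inr (Sum.inr 0))),
      some (Sum.inr (Sum.inl 1))]

theorem toJoin12_bijective : Function.Bijective toJoin12 :=
  (Fintype.bijective_iff_injective_and_card _).2 ⟨by decide, by simp⟩

theorem toJoin12_optional : ∀ p q, optional12 (toJoin12 p) (toJoin12 q) = true →
    s(p, q) ∈ ({s(va, vb1), s(va, vb2), s(va, vc 8), s(vb2, vc 8)} : Set (Sym2 (FVertex 9))) ∧
      table12 (toJoin12 p) (toJoin12 q) = false := by
  simp only [Set.mem_insert_iff, Set.mem_singleton_iff]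
  decide

theorem toJoin12_table (p q : FVertex 9) :
    (s(p, q) ∈ ({e | ∃ i : Fin 9, (i : ℕ) < 8 ∧ e = s(va, vc i)} ∪
     {e | ∃ i : Fin 9, (i : ℕ) < 4 ∧ e = s(vb1, vc i)} ∪
     {e | ∃ i : Fin 9, 4 ≤ (i : ℕ) ∧ (i : ℕ) < 8 ∧ e = s(vb2, vc i)} ∪
     {s(vc 0, vc 1), s(vc 2, vc 3), s(vc 4, vc 5), s(vc 6, vc 8), s(vc 7, vc 8)} :
       Set (Sym2 (FVertex 9))) ∧
      p ≠ q) ↔ table12 (toJoin12 p) (toJoin12 q) = true := by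
  simp only [Set.mem_union, Set.mem_ofPred_eq, Set.mem_insert_iff, Set.mem_singleton_iff]
  revert p q
  decide

theorem Models12.isF12 (h : Models12 G) : IsF12 G := by
  obtain ⟨f, hf, hadj, hor⟩ := h
  refine ⟨_, Set.inter_subset_left, ?_, nonempty_iso_of_comap_eq (hf.comp toJoin12_bijective)
    (eq_fromEdgeSet (E := fun p q => table12 (toJoin12 p) (toJoin12 q))
      (O := fun p q => optional12 (toJoin12 p) (toJoin12 q)) (fun p q => ?_) toJoin12_table
      toJoin12_optional)⟩
  · rcases hor with h | h
    · exact ⟨s(va, vc 8), ⟨by simp, h⟩, by simp⟩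
    · exact ⟨s(vb2, vc 8), ⟨by simp, h⟩, by simp⟩
  · exact hadj (toJoin12 p) (toJoin12 q)

theorem Exc.exists_iso [DecidableRel G.Adj] {δ D : ℕ} (h : Exc G δ D) :
    Nonempty (G ≃g F5) ∨ IsF11 G ∨ IsF12 G ∨ IsHEq 6 G ∨ IsHEq 8 G := by
  rcases h with ⟨-, ⟨-, h⟩ | ⟨rfl | rfl, h⟩⟩ | ⟨-, -, h | h⟩
  · exact Or.inl h.iso_F5
  · exact Or.inr (Or.inr (Or.inr (Or.inl (h.isHEq le_rfl))))
  · exact Or.inr (Or.inr (Or.inr (Or.inr (h.isHEq (by norm_num)))))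
  · exact Or.inr (Or.inl h.isF11)
  · exact Or.inr (Or.inr (Or.inl h.isF12))

/-- The assumption σ ≤ 2(|V| - 1) serves the case of a single part, which `Good` admits without a
bound. -/
theorem Good.exists_partition {σ : ℕ} (h : Good G σ) (hσ : 0 < σ)
    (hle : σ ≤ 2 * (Fintype.card V - 1)) :
    ∃ P : Finpartition (Finset.univ : Finset V), IsProperPartition 2 G P ∧
      (P.parts.card : ℝ) ≤ 2 * ((Fintype.card V : ℝ) - 1) / (σ : ℝ) := by
  obtain ⟨P, hP, hc⟩ := h
  obtain ⟨Q, hQ, rfl⟩ := hP.exists_partition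
  refine ⟨Q, hQ, ?_⟩
  have h1 : Q.parts.card * σ ≤ 2 * (Fintype.card V - 1) := by
    rcases hc with hc | hc
    · have := Nat.mul_le_mul_right σ hc
      omega
    · exact hc
  rw [le_div_iff₀ (by exact_mod_cast hσ)]
  have h2 : Q.parts.card * σ + 2 ≤ 2 * Fintype.card V := by omega
  have h3 : (Q.parts.card : ℝ) * σ + 2 ≤ 2 * Fintype.card V := by exact_mod_cast h2
  linarith

end Conversion

/-! ### Bounds on σ₂ -/

section Sigma

variable {V : Type*} [DecidableEq V] [Fintype V] {G : SimpleGraph V} [DecidableRel G.Adj]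

theorem sigma2_le (hG : G ≠ ⊤) {u v : V} (hne : u ≠ v) (hadj : ¬ G.Adj u v) :
    (sigma2 G).toNat ≤ G.degree u + G.degree v := by
  have h1 : sigma2 G ≤ ((G.degree u + G.degree v : ℕ) : ℕ∞) :=
    iInf_le_of_le u (iInf_le_of_le v (iInf_le_of_le hne (iInf_le _ hadj)))
  rw [← ENat.natCast_toNat (mt (sigma2_eq_top_iff G).1 hG)] at h1
  exact_mod_cast h1

theorem le_sigma2 (hG : G ≠ ⊤) {m : ℕ} (h : ∀ v, m ≤ G.degree v) :
    m + m ≤ (sigma2 G).toNat := by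
  have h1 : ((m + m : ℕ) : ℕ∞) ≤ sigma2 G :=
    le_iInf fun u => le_iInf fun v => le_iInf fun _ => le_iInf fun _ => by
      exact_mod_cast Nat.add_le_add (h u) (h v)
  rw [← ENat.natCast_toNat (mt (sigma2_eq_top_iff G).1 hG)] at h1
  exact_mod_cast h1

theorem exists_nonadj (hG : G ≠ ⊤) : ∃ u v, u ≠ v ∧ ¬ G.Adj u v := by
  by_contra hcon
  push Not at hcon
  refine hG (SimpleGraph.ext ?_)
  ext u v
  exact ⟨fun h => h.ne, hcon u v⟩

theorem nonadj_degree_lt {u v : V} (hne : u ≠ v) (hadj : ¬ G.Adj u v) :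
    G.degree u + 2 ≤ Fintype.card V := by
  have h := degree_lt_card (G := G) (S := Finset.univ.erase v) (r := u) (by simp [hne])
    fun w hw => Finset.mem_erase.2 ⟨fun he => hadj (he ▸ hw), Finset.mem_univ _⟩
  rw [Finset.card_erase_of_mem (Finset.mem_univ _), Finset.card_univ] at h
  omega

/-- A non-neighbour of `v` has degree at most n - 2, which with deg v = 1 gives a sum below n. If
`v` has no non-neighbour, both vertices of a non-adjacent pair are neighbours of `v`, against deg v
= 1. -/
theorem sigma2_lt_of_degree_eq_one (hG : G ≠ ⊤) {v : V} (hv : G.degree v = 1) :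
    (sigma2 G).toNat < Fintype.card V := by
  by_cases h : ∃ u, u ≠ v ∧ ¬ G.Adj u v
  · obtain ⟨u, hne, hadj⟩ := h
    have := sigma2_le hG hne hadj
    have := nonadj_degree_lt hne hadj
    omega
  push Not at h
  obtain ⟨a, b, hab, hadj⟩ := exists_nonadj hG
  have ha : a ≠ v := fun he => hadj (he ▸ (h b (he ▸ hab.symm)).symm)
  have hb : b ≠ v := fun he => hadj (he ▸ h a (he ▸ hab))
  have h1 : ({a, b} : Finset V) ⊆ G.neighborFinset v := by
    intro w hw
    rw [Finset.mem_insert, Finset.mem_singleton] at hw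
    rw [G.mem_neighborFinset]
    rcases hw with rfl | rfl
    · exact (h _ ha).symm
    · exact (h _ hb).symm
  have h2 := Finset.card_le_card h1
  rw [Finset.card_pair hab, G.card_neighborFinset_eq_degree] at h2
  omega

end Sigma

end ProperPartition

theorem corollary1p12 {V : Type*} [Fintype V] [DecidableEq V] (G : SimpleGraph V)
    [DecidableRel G.Adj] (n δ : ℕ) (hn : Fintype.card V = n) (hδ : G.minDegree = δ)
    (hG : G ≠ ⊤) (hδ1 : 1 ≤ δ)
    (hσ : (n : ℝ) / (δ : ℝ) + (δ : ℝ) - 1 ≤ ((ProperPartition.sigma2 G).toNat : ℝ)) :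
    (∃ P : Finpartition (Finset.univ : Finset V),
      ProperPartition.IsProperPartition 2 G P ∧
      (P.parts.card : ℝ) ≤ 2 * ((n : ℝ) - 1) / ((ProperPartition.sigma2 G).toNat : ℝ)) ∨
    Nonempty (G ≃g ProperPartition.F5) ∨
    ProperPartition.IsF11 G ∨
    ProperPartition.IsF12 G ∨
    ProperPartition.IsHEq 6 G ∨
    ProperPartition.IsHEq 8 G := by
  have hmin : ∀ v, δ ≤ G.degree v := fun v => hδ ▸ G.minDegree_le_degree v
  have hσδ := ProperPartition.le_sigma2 hG hmin
  obtain ⟨a, b, hab, hadj⟩ := ProperPartition.exists_nonadj hG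
  have hab1 := ProperPartition.nonadj_degree_lt hab hadj
  have hab2 := ProperPartition.nonadj_degree_lt hab.symm fun h => hadj h.symm
  have hab3 := ProperPartition.sigma2_le hG hab hadj
  obtain ⟨D, hD⟩ : ∃ D, (ProperPartition.sigma2 G).toNat = δ + D :=
    ⟨(ProperPartition.sigma2 G).toNat - δ, by omega⟩
  have hcard : n ≤ δ * (D + 1) := by
    rw [hD] at hσ
    push_cast at hσ
    have h0 : (0 : ℝ) < δ := by exact_mod_cast hδ1
    have h1 : (n : ℝ) / δ ≤ D + 1 := by linarith
    rw [div_le_iff₀ h0] at h1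
    have h2 : (n : ℝ) ≤ δ * (D + 1) := by linarith
    exact_mod_cast h2
  -- For δ = 1 the hypothesis says n ≤ σ₂, which a vertex of degree one refutes.
  have hδ2 : 2 ≤ δ := by
    by_contra hcon
    obtain rfl : δ = 1 := by omega
    have : Nonempty V := ⟨a⟩
    obtain ⟨v, hv⟩ := G.exists_minimal_degree_vertex
    have := ProperPartition.sigma2_lt_of_degree_eq_one hG (hv.symm.trans hδ)
    omega
  have hcls : ProperPartition.OreClass G δ D :=
    ⟨hmin, fun u v hne hadj => hD ▸ ProperPartition.sigma2_le hG hne hadj, by omega,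
      hn.symm ▸ hcard⟩
  rcases ProperPartition.OreClass.good_or_exc n V G δ D hn hδ2 hcls with hg | he
  · rw [← hn, hD]
    -- The non-adjacent pair `a`, `b` gives σ₂ ≤ deg a + deg b ≤ 2(n - 2), enough for a partition
    -- with one part.
    exact Or.inl (hg.exists_partition (by omega) (by omega))
  · exact Or.inr he.exists_iso
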